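/- For integers $l,m,k\ge 2$ with $1/l+1/m+1/k<1$, a triangle group $\Delta(l,m,k)\le PSL_2(\mathbb R)={\rm Aut}\,\mathbb H$ is the group generated by its canonical generators $u,v,w$: the rotations through $2\pi/l,2\pi/m,2\pi/k$ about the vertices of a hyperbolic triangle with angles $\pi/l,\pi/m,\pi/k$, with $uvw=1$. A smooth quotient of a subgroup $\Delta\le PSL_2(\mathbb R)$ is a quotient $\Delta/K$ by a torsion-free normal subgroup $K$. A surface group is a subgroup of $PSL_2(\mathbb R)$ acting freely, properly discontinuously and cocompactly on $\mathbb H$. A hypermap $\mathcal H$ is a pair of permutations $x,y$ of a finite non-empty set $\Omega$ generating a transitive group; put $z=(xy)^{-1}$. Its automorphism group ${\rm Aut}\,\mathcal H$ is the centraliser of $\langle x,y\rangle$ in ${\rm Sym}(\Omega)$; it is regular if ${\rm Aut}\,\mathcal H$ is transitive on $\Omega$; its type is the triple of orders of $x,y,z$; its genus $g$ is given by $2-2g=c(x)+c(y)+c(z)-|\Omega|$, where $c$ counts cycles. A hypermap of type $(l,m,k)$ is a dessin on the Riemann surface $\mathbb H/K$, corresponding to the inclusion $K\le\Delta=\Delta(l,m,k)$,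 if there is an action of $\Delta$ on $\Omega$ in which canonical generators of $\Delta$ act as $x,y,z$ and $K$ is the stabiliser of a point. Let $n\ge 2$. There are infinitely many primes $p\equiv 1$ mod $8n$. For each such $p$, let $a,b,c\in\mathbb F_p$ and $d\in\mathbb F_p^*$ be such that $d$ has multiplicative order $8n$, $a=(d^4+1)/(d-d^3)$ and $a^2+bc+1=0$ (such $a,b,c,d$ exist), and let $x,y,z$ be the images in $L_2(p)=PSL_2(\mathbb F_p)$ of $$X=\begin{pmatrix}a&b\\c&-a\end{pmatrix},\quad Y=XZ^{-1}=\begin{pmatrix}a/d&bd\\c/d&-ad\end{pmatrix},\quad Z=\begin{pmatrix}d&0\\0&1/d\end{pmatrix}.$$ Then $x,y,z$ have orders $2,2n,4n$, $xyz=1$, and $x$ and $z$ generate $L_2(p)$. Triangle groups $\Delta(2,2n,4n)$ exist. Let $\Delta^*=\Delta(2,2n,4n)$ be any one of them, with canonical generators $u,v,w$, and let $\Delta_0,\Delta_1,\Delta_2$ be the normal closures in $\Delta^*$ of $\{u,v^2,w^2\}$, $\{v,w^2,u^2\}$, $\{w,u^2,v^2\}$ respectively; these have index $2$ in $\Delta^*$.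 There is an epimorphism $\Delta^*\to L_2(p)$ sending $u,v,w$ to $x,y,z$, with torsion-free kernel $M$. The finite group $G=L_2(p)\times C_2$ has a unique subgroup of index $2$, and is the smooth quotient $\Delta^*/L$, where $L=\Delta_0\cap M\le\Delta_0$. Put $K=\Delta_1\cap\Delta_2\cap M$. Then $K=\Delta_1\cap L=\Delta_2\cap L$, $K$ is a surface group, and $G$ is a smooth quotient $\Delta_i/K$ of $\Delta_i$ for $i=1,2$. Moreover there are two regular dessins $\mathcal H_1$ and $\mathcal H_2$, of types $(2n,2n,2n)$ and $(n,4n,4n)$, on the same compact Riemann surface $\mathbb H/K$, corresponding to the inclusions $K\le\Delta_1=\Delta(2n,2n,2n)$ and $K\le\Delta_2=\Delta(n,4n,4n)$, with ${\rm Aut}\,\mathcal H_1\cong{\rm Aut}\,\mathcal H_2\cong L_2(p)\times C_2$. Both have genus $1+\frac{2n-3}{4n}\,p(p^2-1)$, which is $613$ when $n=2$ and $p=17$. -/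

import Mathlib

open scoped UpperHalfPlane MatrixGroups

noncomputable section

/-! ### Hyperbolic triangles, rotations and triangle groups

The group `PSL₂(ℝ)` of automorphisms of the upper half-plane `ℍ` is realised as the group of
permutations of `ℍ` induced by `SL(2, ℝ)`; `Dist ℍ` is the hyperbolic metric. -/

/-- The group `PSL₂(ℝ)` of Möbius transformations of `ℍ`. -/
def autH : Subgroup (Equiv.Perm ℍ) := (MulAction.toPermHom SL(2, ℝ) ℍ).range

/-- The internal angle at `P` of the hyperbolic triangle with vertices `P`, `Q`, `R`
(for `Q ≠ P` and `R ≠ P`), given by the hyperbolic law of cosines. -/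
def hypAngle (P Q R : ℍ) : ℝ :=
  Real.arccos ((Real.cosh (dist P Q) * Real.cosh (dist P R) - Real.cosh (dist Q R)) /
    (Real.sinh (dist P Q) * Real.sinh (dist P R)))

/-- The matrix `A * [cos t, sin t; -sin t, cos t] * A⁻¹`, where `A = [√y, x/√y; 0, 1/√y]` sends
`i` to `P = x + i y`. -/
def rotMatrix (P : ℍ) (t : ℝ) : SL(2, ℝ) :=
  ⟨!![Real.cos t - P.re / P.im * Real.sin t, (P.im + P.re ^ 2 / P.im) * Real.sin t;
      -(Real.sin t / P.im), Real.cos t + P.re / P.im * Real.sin t], by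
    have h : P.im ≠ 0 := P.im_ne_zero
    rw [Matrix.det_fin_two_of]
    field_simp
    linear_combination (P.im ^ 2) * Real.sin_sq_add_cos_sq t⟩

/-- The anticlockwise rotation of the hyperbolic plane about `P` through the angle `φ`. -/
def hypRotation (P : ℍ) (φ : ℝ) : Equiv.Perm ℍ :=
  MulAction.toPermHom SL(2, ℝ) ℍ (rotMatrix P (φ / 2))

/-- `u, v, w` are canonical generators of a triangle group of type `(l, m, n)`: the rotations
through `2π/l`, `2π/m`, `2π/n` about the vertices of a hyperbolic triangle with internal angles
`π/l`, `π/m`, `π/n`, with `uvw = 1` (which fixes the orientation of the triangle). -/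
def IsCanonicalTriple (l m n : ℕ) (u v w : Equiv.Perm ℍ) : Prop :=
  ∃ P Q R : ℍ, P ≠ Q ∧ Q ≠ R ∧ R ≠ P ∧
    hypAngle P Q R = Real.pi / l ∧ hypAngle Q R P = Real.pi / m ∧
    hypAngle R P Q = Real.pi / n ∧
    u = hypRotation P (2 * Real.pi / l) ∧ v = hypRotation Q (2 * Real.pi / m) ∧
    w = hypRotation R (2 * Real.pi / n) ∧ u * v * w = 1

/-- The group generated by `u, v, w`; a triangle group `Δ(l, m, n) ≤ PSL₂(ℝ)` when
`IsCanonicalTriple l m n u v w`. -/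
def triangleGroup (u v w : Equiv.Perm ℍ) : Subgroup (Equiv.Perm ℍ) :=
  Subgroup.closure {u, v, w}

/-- The normal closure, in the subgroup `D`, of `a` and the squares of `b` and `c`. If `D` is a
triangle group with all periods even and `a, b, c` are its canonical generators in some order,
this is the subgroup of index 2 that contains `a` but neither `b` nor `c`. -/
def indexTwoSubgroup (D : Subgroup (Equiv.Perm ℍ)) (a b c : Equiv.Perm ℍ) :
    Subgroup (Equiv.Perm ℍ) :=
  (Subgroup.normalClosure {g : D | (g : Equiv.Perm ℍ) ∈ ({a, b ^ 2, c ^ 2} : Set _)}).map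
    D.subtype

/-- No element other than the identity has finite order. -/
def IsTorsionFreeSubgroup (K : Subgroup (Equiv.Perm ℍ)) : Prop :=
  ∀ g ∈ K, IsOfFinOrder g → g = 1

/-- `G` is the smooth quotient `D / K` of `D`, that is, `K` is a torsion-free normal
subgroup of `D` and `D / K ≅ G`. -/
def IsSmoothQuotient (D K : Subgroup (Equiv.Perm ℍ)) (G : Type) [Group G] : Prop :=
  IsTorsionFreeSubgroup K ∧
    ∃ f : D →* G, Function.Surjective f ∧ f.ker.map D.subtype = K

/-- `K` is a surface group: it acts on `ℍ` by Möbius transformations, freely, properly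
discontinuously and with compact orbit space, so that `ℍ / K` is a compact Riemann surface,
uniformised by `K`. -/
def IsSurfaceGroup (K : Subgroup (Equiv.Perm ℍ)) : Prop :=
  K ≤ autH ∧ (∀ g ∈ K, g ≠ 1 → ∀ t : ℍ, g t ≠ t) ∧ ProperlyDiscontinuousSMul K ℍ ∧
    CompactSpace (MulAction.orbitRel.Quotient K ℍ)

/-! ### Hypermaps and dessins -/

/-- A finite oriented hypermap: two permutations of a finite set generating a transitive group. -/
structure Hypermap where
  /-- the set permuted -/
  Ω : Type
  finite : Finite Ω
  /-- the first permutation, with the hypervertices as its cycles -/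
  x : Equiv.Perm Ω
  /-- the second permutation, with the hyperedges as its cycles -/
  y : Equiv.Perm Ω
  transitive : MulAction.IsPretransitive (Subgroup.closure {x, y}) Ω
  nonempty : Nonempty Ω

namespace Hypermap

/-- The third permutation, with `xyz = 1`, whose cycles are the hyperfaces. -/
def z (H : Hypermap) : Equiv.Perm H.Ω := (H.x * H.y)⁻¹

/-- The automorphism group: the centraliser of the monodromy group. -/
def aut (H : Hypermap) : Subgroup (Equiv.Perm H.Ω) :=
  Subgroup.centralizer (Subgroup.closure {H.x, H.y} : Set (Equiv.Perm H.Ω))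

/-- A hypermap is regular if its automorphism group is transitive. -/
def IsRegular (H : Hypermap) : Prop := MulAction.IsPretransitive H.aut H.Ω

/-- `H` has type `(l, m, n)`. -/
def HasType (H : Hypermap) (l m n : ℕ) : Prop :=
  orderOf H.x = l ∧ orderOf H.y = m ∧ orderOf H.z = n

/-- The number of cycles of a permutation, fixed points included. -/
def numCycles {S : Type} (g : Equiv.Perm S) : ℕ :=
  Nat.card (MulAction.orbitRel.Quotient (Subgroup.zpowers g) S)

/-- The genus `g` of the underlying surface, by Euler's formula `V - E + F = 2 - 2g` for the Walsh
map, with the cycles of `x` and of `y` as vertices, `Ω` as edges and the cycles of `z` as faces. -/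
def genus (H : Hypermap) : ℚ :=
  1 - ((numCycles H.x : ℚ) + numCycles H.y + numCycles H.z - Nat.card H.Ω) / 2

/-- `H`, of type `(l, m, n)`, is a dessin on the Riemann surface `ℍ / K`, with the triangle group
`D = Δ(l, m, n)` as its overgroup of `K`: the canonical generators of `D` act on `Ω` as
`x, y, z`, and `K` is the stabiliser in `D` of a point. (The associated Belyi function is the
projection `ℍ / K → ℍ / D`.) -/
def IsDessinOn (H : Hypermap) (l m n : ℕ) (D K : Subgroup (Equiv.Perm ℍ)) : Prop :=
  H.HasType l m n ∧
  ∃ u v w : D, IsCanonicalTriple l m n u v w ∧ D = triangleGroup u v w ∧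
    ∃ f : D →* Equiv.Perm H.Ω, f u = H.x ∧ f v = H.y ∧ f w = H.z ∧
      ∃ o : H.Ω, ((MulAction.stabilizer (Equiv.Perm H.Ω) o).comap f).map D.subtype = K

end Hypermap

/-! ### The matrices -/

/-- The group `L₂(p) = PSL₂(𝔽_p)`. -/
abbrev L2 (p : ℕ) : Type := Matrix.ProjectiveSpecialLinearGroup (Fin 2) (ZMod p)

/-- The image in `L₂(p)` of a matrix in `SL₂(p)`. -/
def toL2 {p : ℕ} (A : SL(2, ZMod p)) : L2 p := QuotientGroup.mk A

/-- `X = [a, b; c, -a]`. -/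
def matX {p : ℕ} (a b c : ZMod p) (h : a ^ 2 + b * c + 1 = 0) : SL(2, ZMod p) :=
  ⟨!![a, b; c, -a], by rw [Matrix.det_fin_two_of]; linear_combination -h⟩

/-- `Z = [d, 0; 0, 1/d]`. -/
def matZ {p : ℕ} (d : (ZMod p)ˣ) : SL(2, ZMod p) :=
  ⟨!![(d : ZMod p), 0; 0, ((d⁻¹ : (ZMod p)ˣ) : ZMod p)], by simp [Matrix.det_fin_two_of]⟩

/-- `Y = [a/d, b d; c/d, -a d]`, that is, `Y = X Z⁻¹`. -/
def matY {p : ℕ} (a b c : ZMod p) (d : (ZMod p)ˣ) (h : a ^ 2 + b * c + 1 = 0) : SL(2, ZMod p) :=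
  ⟨!![a * ((d⁻¹ : (ZMod p)ˣ) : ZMod p), b * d; c * ((d⁻¹ : (ZMod p)ˣ) : ZMod p), -(a * d)], by
    have hd : (d : ZMod p) * ((d⁻¹ : (ZMod p)ˣ) : ZMod p) = 1 := d.mul_inv
    rw [Matrix.det_fin_two_of]
    linear_combination (-(a ^ 2) - b * c) * hd - h⟩

/-- The group `L₂(p) × C₂`. -/
abbrev L2C2 (p : ℕ) : Type := L2 p × Multiplicative (ZMod 2)

end

open scoped UpperHalfPlane MatrixGroups

noncomputable section

/-! ### Positivity of roots for linear representations of Coxeter groups -/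

namespace CoxeterSystem

variable {B W V : Type*} [Group W] {M : CoxeterMatrix B} (cs : CoxeterSystem M W)
  [AddCommGroup V] [Module ℝ V]

/-! Algebraic core (`RotationTriangle.exists_dessins`). The triangle group Δ* of type (2, 2n, 4n)
has an epimorphism `f` to L₂(p), and, since all periods are even, characters χ₁, χ₂ to C₂ with χ₁
trivial on v and χ₂ trivial on w, both nontrivial on u. The index-two groups Δ₀, Δ₁, Δ₂ are the
kernels of χ₁χ₂, χ₁, χ₂. Because L₂(p) is perfect, (f, χ₁, χ₂) maps onto L₂(p) × C₂ × C₂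
(`surjective_prod_of_commutator_eq_top`). Its kernel is K, so restricting f together with the
remaining character exhibits L₂(p) × C₂ as Δᵢ/K. Doubling the triangle across either side through
its right angle shows that Δ₁ and Δ₂ are triangle groups of types (2n, 2n, 2n) and (n, 4n, 4n)
(`equilateral`, `isosceles`). The dessins are the regular representations of the quotient, and the
genus is a count of cosets of cyclic subgroups.

Geometric input. One needs the presentation of Δ* (to define f and the characters), its torsion (to
see that the kernel of f is torsion-free), and its discrete cocompact action (to get a surface
group). All three come from the extended group generated by the reflections in the sides. ℍ is
embedded in the traceless 2 × 2 matrices as a sheet of a hyperboloid, the inner product being a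
trace, and the unit normals of the sides serve as simple roots of a Coxeter group. Tits' lemma
(`root_nonneg`) says that a nontrivial element carries the closed triangle off the open one. Hence
the Coxeter group acts faithfully, orbits of interior points are uniformly separated, and
stabilisers of points of the closed triangle are generated by the reflections in the sides through
them. Passing to the rotation subgroup gives `exists_hom`, `exists_conj_of_isOfFinOrder` and
`isSurfaceGroup`.

Arithmetic input. The chosen value of a makes the trace of Y equal to d² + d⁻², so Y has eigenvalues
d^{±2} and the order of y is read off from that of d (`orderOf_toL2_matY`). For generation let H =
⟨X, Z⟩ in SL₂(p). If p divides |H|, then H contains a full group of transvections; X or Z moves its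
fixed line, and two such groups generate SL₂(p). If p does not divide |H|, every element other than
±1 has exactly two fixed points on the projective line over 𝔽_{p²}. Orbit counting, as in Klein's
classification of finite rotation groups, then excludes a group in which the point ∞ has stabiliser
of order at least 16 and orbit of length at least 3 (`not_two_fixed_points`). -/

theorem sin_smul_alternatingWord_root (ρ : W →* Module.End ℝ V) (α : B → V)
    (hρ : ∀ i j, ρ (cs.simple i) (α j) = α j + (2 * Real.cos (Real.pi / M i j)) • α i)
    (s t : B) (k : ℕ) :
    Real.sin (Real.pi / M s t) • ρ (cs.wordProd (alternatingWord s t k)) (α s) =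
      if Even k then
        Real.sin ((k + 1) * (Real.pi / M s t)) • α s + Real.sin (k * (Real.pi / M s t)) • α t
      else
        Real.sin (k * (Real.pi / M s t)) • α s +
          Real.sin ((k + 1) * (Real.pi / M s t)) • α t := by
  set θ : ℝ := Real.pi / M s t with hθ
  have hself : ∀ i, ρ (cs.simple i) (α i) = - α i := fun i => by
    rw [hρ, M.diagonal]
    simp only [Nat.cast_one, div_one, Real.cos_pi]
    module
  have hst : ρ (cs.simple s) (α t) = α t + (2 * Real.cos θ) • α s := hρ s t
  have hts : ρ (cs.simple t) (α s) = α s + (2 * Real.cos θ) • α t := by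
    rw [hρ t s, M.symmetric t s]
  -- The coefficients are Chebyshev polynomials in `cos θ`; scaling by `sin θ` turns them into
  -- sines, and this is their three-term recurrence.
  have key : ∀ k : ℕ, Real.sin (((k + 1 : ℕ) + 1) * θ) =
      2 * Real.cos θ * Real.sin ((k + 1) * θ) - Real.sin (k * θ) := fun k => by
    have h1 : ((k + 1 : ℕ) + 1) * θ = (k + 1) * θ + θ := by push_cast; ring
    have h2 : (k : ℝ) * θ = (k + 1) * θ - θ := by ring
    rw [h1, h2, Real.sin_add, Real.sin_sub]
    ring
  induction k with
  | zero => simp [alternatingWord]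
  | succ k ih =>
    rw [alternatingWord_succ', cs.wordProd_cons, map_mul, Module.End.mul_apply, ← map_smul, ih,
      key k]
    by_cases hk : Even k
    · have hk' : ¬ Even (k + 1) := by simp [hk, parity_simps]
      simp only [hk, if_true, hk', if_false, map_add, map_smul, hts, hself]
      push_cast
      module
    · have hk' : Even (k + 1) := by simp [hk, parity_simps]
      simp only [hk, if_true, hk', if_false, map_add, map_smul, hst, hself]
      push_cast
      module

/-- Take `v` shortest among the left factors of `w` whose complement is an alternating word in `s`,
`t` ending in `t`, with lengths adding. It is the minimal representative of the coset of `w` modulo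
`⟨s, t⟩`. -/
theorem length_mul_alternatingWord_decomposition {w : W} {s t : B} (hM : M s t ≠ 0)
    (hs : cs.length w < cs.length (w * cs.simple s))
    (ht : cs.length (w * cs.simple t) < cs.length w) :
    ∃ (v : W) (k : ℕ), w = v * cs.wordProd (alternatingWord s t k) ∧
      cs.length v < cs.length w ∧ k + 1 ≤ M s t ∧
      cs.length v < cs.length (v * cs.simple s) ∧ cs.length v < cs.length (v * cs.simple t) := by
  classical
  let S : Set ℕ := {n | ∃ (v : W) (k : ℕ), w = v * cs.wordProd (alternatingWord s t k) ∧
    cs.length w = cs.length v + k ∧ n = cs.length v}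
  have hwt : cs.length w = cs.length (w * cs.simple t) + 1 := by
    rcases cs.length_mul_simple w t with h | h <;> omega
  have hS : cs.length (w * cs.simple t) ∈ S :=
    ⟨w * cs.simple t, 1, by simp [alternatingWord], hwt, rfl⟩
  obtain ⟨v, k, hw, hl, hv⟩ := Nat.sInf_mem ⟨_, hS⟩
  have hmin : ∀ n ∈ S, cs.length v ≤ n := fun n hn => hv ▸ Nat.sInf_le hn
  have hvw : cs.length v < cs.length w := by
    have := hmin _ hS
    omega
  obtain ⟨j, rfl⟩ : ∃ j, k = j + 1 := ⟨k - 1, by omega⟩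
  -- If `v` could be shortened by the first letter of the alternating word, that letter would cancel
  -- and `w` would be shorter than it is.
  have hfirst : cs.length v < cs.length (v * cs.simple (if Even j then t else s)) := by
    rcases cs.length_mul_simple v (if Even j then t else s) with h | h
    · omega
    · exfalso
      have h1 : w = v * cs.simple (if Even j then t else s) *
          cs.wordProd (alternatingWord s t j) := by
        rw [hw, alternatingWord_succ', cs.wordProd_cons]
        group
      have h2 := cs.length_mul_le (v * cs.simple (if Even j then t else s))
        (cs.wordProd (alternatingWord s t j))
      have h3 := cs.length_wordProd_le (alternatingWord s t j)
      rw [length_alternatingWord] at h3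
      rw [← h1] at h2
      omega
  -- If `v` could be shortened by the other letter, that letter could be moved into the alternating
  -- word, against the minimality of `v`.
  have hnext : cs.length v < cs.length (v * cs.simple (if Even (j + 1) then t else s)) := by
    rcases cs.length_mul_simple v (if Even (j + 1) then t else s) with h | h
    · omega
    · exfalso
      have := hmin (cs.length (v * cs.simple (if Even (j + 1) then t else s)))
        ⟨_, j + 1 + 1, ?_, by omega, rfl⟩
      · omega
      · rw [alternatingWord_succ' s t (j + 1), cs.wordProd_cons, mul_assoc,
          cs.simple_mul_simple_cancel_left]
        exact hw
  refine ⟨v, j + 1, hw, hvw, ?_, ?_, ?_⟩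
  -- Otherwise `w s` is `v` times an alternating word too long to be reduced, so `w s` is not longer
  -- than `w`.
  · by_contra! hlt
    have h1 : w * cs.simple s = v * cs.wordProd (alternatingWord t s (j + 1 + 1)) := by
      rw [alternatingWord_succ t s, cs.wordProd_concat, ← mul_assoc, ← hw]
    have h2 := cs.not_isReduced_alternatingWord t s (m := j + 1 + 1)
      (by rwa [M.symmetric t s]) (by rw [M.symmetric t s]; omega)
    have h3 := cs.length_wordProd_le (alternatingWord t s (j + 1 + 1))
    rw [IsReduced] at h2
    rw [length_alternatingWord] at h2 h3
    have h4 := cs.length_mul_le v (cs.wordProd (alternatingWord t s (j + 1 + 1)))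
    rw [← h1] at h4
    omega
  · by_cases hj : Even j
    · simpa [hj, parity_simps] using hnext
    · simpa [hj] using hfirst
  · by_cases hj : Even j
    · simpa [hj] using hfirst
    · simpa [hj, parity_simps] using hnext

/-- Tits' lemma: if `ℓ w < ℓ (w sᵢ)` then `w αᵢ` is a nonnegative combination of simple roots. -/
theorem root_nonneg (ρ : W →* Module.End ℝ V) (α : B → V) (hM : ∀ i j, M i j ≠ 0)
    (hρ : ∀ i j, ρ (cs.simple i) (α j) = α j + (2 * Real.cos (Real.pi / M i j)) • α i)
    (φ : V →ₗ[ℝ] ℝ) (hφ : ∀ j, 0 ≤ φ (α j)) (w : W) (s : B)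
    (hs : cs.length w < cs.length (w * cs.simple s)) : 0 ≤ φ (ρ w (α s)) := by
  induction hn : cs.length w using Nat.strong_induction_on generalizing w s with
  | _ n ih =>
    by_cases hw : w = 1
    · subst hw
      simpa using hφ s
    obtain ⟨t, ht⟩ := cs.exists_rightDescent_of_ne_one hw
    rw [IsRightDescent] at ht
    have hst : s ≠ t := by
      rintro rfl
      omega
    obtain ⟨v, k, hwv, hv, hk, hvs, hvt⟩ :=
      cs.length_mul_alternatingWord_decomposition (hM s t) hs ht
    -- Up to the positive factor `sin θ`, `w αₛ` is a combination of `v αₛ` and `v αₜ` with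
    -- coefficients `sin (kθ)` and `sin ((k+1)θ)`, nonnegative as `k + 1 ≤ M s t`. Testing against a
    -- functional `φ` makes linear independence of the roots unnecessary.
    have h1 := ih _ (hn ▸ hv) v s hvs rfl
    have h2 := ih _ (hn ▸ hv) v t hvt rfl
    have hm : 2 ≤ M s t := by
      have := hM s t
      have := M.off_diagonal s t hst
      omega
    have hm' : (2 : ℝ) ≤ M s t := by exact_mod_cast hm
    have hk' : (k : ℝ) + 1 ≤ M s t := by exact_mod_cast hk
    have hθ : 0 < Real.pi / M s t := by positivity
    have hle : ∀ x : ℝ, 0 ≤ x → x ≤ M s t → 0 ≤ Real.sin (x * (Real.pi / M s t)) :=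
      fun x hx hx' => by
        apply Real.sin_nonneg_of_nonneg_of_le_pi (by positivity)
        calc x * (Real.pi / M s t) ≤ M s t * (Real.pi / M s t) := by gcongr
          _ = Real.pi := by field_simp
    have hsin : 0 < Real.sin (Real.pi / M s t) := by
      apply Real.sin_pos_of_pos_of_lt_pi hθ
      rw [div_lt_iff₀ (by linarith)]
      nlinarith [Real.pi_pos]
    have hA := hle k (by positivity) (by linarith)
    have hB := hle (k + 1) (by positivity) hk'
    have hcalc := congrArg (fun x => φ (ρ v x)) (cs.sin_smul_alternatingWord_root ρ α hρ s t k)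
    simp only [map_smul] at hcalc
    rw [← Module.End.mul_apply, ← map_mul, ← hwv] at hcalc
    have : 0 ≤ Real.sin (Real.pi / M s t) • φ (ρ w (α s)) := by
      rw [hcalc]
      split_ifs <;> simp only [map_add, map_smul, smul_eq_mul] <;> positivity
    exact nonneg_of_mul_nonneg_right (by simpa using this) hsin

/-- If `sᵢ` is a right descent of `w`, then `-w αᵢ` is a nonnegative combination of simple roots. -/
theorem root_nonpos (ρ : W →* Module.End ℝ V) (α : B → V) (hM : ∀ i j, M i j ≠ 0)
    (hρ : ∀ i j, ρ (cs.simple i) (α j) = α j + (2 * Real.cos (Real.pi / M i j)) • α i)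
    (φ : V →ₗ[ℝ] ℝ) (hφ : ∀ j, 0 ≤ φ (α j)) (w : W) (s : B)
    (hs : cs.IsRightDescent w s) : φ (ρ w (α s)) ≤ 0 := by
  have h := cs.root_nonneg ρ α hM hρ φ hφ (w * cs.simple s) s
    (by rwa [cs.simple_mul_simple_cancel_right])
  rw [map_mul, Module.End.mul_apply, hρ, M.diagonal] at h
  have : α s + (2 * Real.cos (Real.pi / (1 : ℕ))) • α s = - α s := by
    simp only [Nat.cast_one, div_one, Real.cos_pi]
    module
  rw [this, map_neg, map_neg] at h
  linarith

end CoxeterSystem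

/-! ### The upper half-plane as a sheet of a hyperboloid in `sl₂(ℝ)` -/

/-- The infinitesimal rotation about `z`: the traceless matrix with square `-1` that fixes `z`. -/
def rotGen (z : ℍ) : Matrix (Fin 2) (Fin 2) ℝ :=
  !![-(z.re / z.im), z.im + z.re ^ 2 / z.im; -(1 / z.im), z.re / z.im]

theorem coe_rotMatrix (P : ℍ) (t : ℝ) :
    (rotMatrix P t : Matrix (Fin 2) (Fin 2) ℝ) = Real.cos t • 1 + Real.sin t • rotGen P := by
  ext i j
  fin_cases i <;> fin_cases j <;> simp [rotMatrix, rotGen] <;> ring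

theorem rotGen_trace (z : ℍ) : (rotGen z).trace = 0 := by
  simp [rotGen, Matrix.trace_fin_two]

theorem rotGen_mul_self (z : ℍ) : rotGen z * rotGen z = -1 := by
  have h := z.im_ne_zero
  ext i j
  fin_cases i <;> fin_cases j <;> simp [rotGen, Matrix.mul_apply, Fin.sum_univ_two] <;>
    field_simp <;> ring

theorem rotGen_injective : Function.Injective rotGen := fun z w h => by
  have h1 : z.im = w.im := by
    have := congrFun (congrFun h 1) 0
    simpa [rotGen] using this
  have h2 : z.re = w.re := by
    have := congrFun (congrFun h 1) 1
    have hw := w.im_ne_zero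
    simp only [rotGen, h1, Matrix.of_apply, Matrix.cons_val', Matrix.cons_val_one,
      Matrix.cons_val_fin_one] at this
    field_simp at this
    exact this
  exact UpperHalfPlane.ext (Complex.ext h2 h1)

/-- This is the hyperboloid model: with the Lorentz form `tr (XY)` on traceless matrices, `rotGen`
embeds `ℍ` as one sheet of `tr X² = -2`, and hyperbolic distance becomes an inner product. -/
theorem trace_rotGen_mul_rotGen (z w : ℍ) :
    (rotGen z * rotGen w).trace = -2 * Real.cosh (dist z w) := by
  have hz := z.im_ne_zero
  have hw := w.im_ne_zero
  rw [UpperHalfPlane.cosh_dist, Complex.dist_eq, ← Complex.normSq_eq_norm_sq, Complex.normSq_apply]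
  simp [rotGen, Matrix.trace_fin_two]
  field_simp
  ring

/-- The adjugate, rather than the inverse, supplies the sign that keeps the image on the same sheet
when `det g < 0`. Reflections are thus covered along with rotations. -/
theorem rotGen_smul (g : GL (Fin 2) ℝ) (z : ℍ) :
    |g.det.val| • rotGen (g • z) =
      (g : Matrix (Fin 2) (Fin 2) ℝ) * rotGen z * Matrix.adjugate (g : Matrix (Fin 2) (Fin 2) ℝ) := by
  have hN := (UpperHalfPlane.normSq_denom_pos g z.im_ne_zero).ne'
  have him := UpperHalfPlane.im_smul_eq_div_normSq g z
  have hre := UpperHalfPlane.re_smul g z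
  have hdet : |g.det.val| ≠ 0 := abs_ne_zero.2 g.det_ne_zero
  have hdet' : |g.det.val| ^ 2 = (g 0 0 * g 1 1 - g 0 1 * g 1 0) ^ 2 := by
    rw [sq_abs, Matrix.GeneralLinearGroup.val_det_apply, Matrix.det_fin_two]
  rw [Complex.div_re] at hre
  have hNe : Complex.normSq (UpperHalfPlane.denom g z) =
      (g 1 0 * z.re + g 1 1) ^ 2 + (g 1 0 * z.im) ^ 2 := by
    simp [UpperHalfPlane.denom, Complex.normSq_apply]
    ring
  set N := Complex.normSq (UpperHalfPlane.denom g z)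
  simp only [UpperHalfPlane.num, UpperHalfPlane.denom, Complex.add_re, Complex.mul_re,
    Complex.ofReal_re, Complex.ofReal_im, Complex.add_im, Complex.mul_im, zero_mul, sub_zero,
    add_zero, UpperHalfPlane.coe_re, UpperHalfPlane.coe_im] at hre
  have hy := z.im_ne_zero
  have hre' : (g • z).re =
      ((g 0 0 * z.re + g 0 1) * (g 1 0 * z.re + g 1 1) + g 0 0 * z.im * (g 1 0 * z.im)) / N := by
    rw [hre]
    field_simp
  rw [Matrix.adjugate_fin_two]
  generalize |g.det.val| = δ at *
  ext i j
  fin_cases i <;> fin_cases j <;>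
    simp [rotGen, Matrix.mul_apply, Fin.sum_univ_two, him, hre'] <;> field_simp
  · ring
  · rw [hdet', hNe]; ring
  · rw [hNe]; ring
  · ring

theorem rotGen_smul_SL (g : SL(2, ℝ)) (z : ℍ) :
    rotGen (g • z) = (g : Matrix (Fin 2) (Fin 2) ℝ) * rotGen z * (g⁻¹ : SL(2, ℝ)) := by
  have h := rotGen_smul (g : GL (Fin 2) ℝ) z
  have hd : |((g : GL (Fin 2) ℝ)).det.val| = 1 := by simp
  rw [hd, one_smul] at h
  rw [Matrix.SpecialLinearGroup.coe_inv]
  exact h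

/-- Timelike vectors of the future cone are positive multiples of points of `ℍ`. -/
theorem exists_smul_rotGen_eq (X : Matrix (Fin 2) (Fin 2) ℝ) (htr : X.trace = 0)
    (hneg : (X * X).trace < 0) (h10 : X 1 0 < 0) :
    ∃ (z : ℍ) (μ : ℝ), 0 < μ ∧ X = μ • rotGen z := by
  rw [Matrix.trace_fin_two] at htr
  have h11 : X 1 1 = - X 0 0 := by linarith
  have hd : 0 < -(X 0 0 ^ 2 + X 0 1 * X 1 0) := by
    simp [Matrix.trace_fin_two, Matrix.mul_apply, Fin.sum_univ_two, h11] at hneg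
    nlinarith
  set μ := Real.sqrt (-(X 0 0 ^ 2 + X 0 1 * X 1 0)) with hμ
  have hμ0 : 0 < μ := Real.sqrt_pos.2 hd
  have hμ2 : μ ^ 2 = -(X 0 0 ^ 2 + X 0 1 * X 1 0) := Real.sq_sqrt hd.le
  refine ⟨⟨⟨X 0 0 / X 1 0, μ / (- X 1 0)⟩, div_pos hμ0 (by linarith)⟩, μ, hμ0, ?_⟩
  have e1 : (⟨⟨X 0 0 / X 1 0, μ / (- X 1 0)⟩, div_pos hμ0 (by linarith)⟩ : ℍ).re = X 0 0 / X 1 0 :=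
    rfl
  have e2 : (⟨⟨X 0 0 / X 1 0, μ / (- X 1 0)⟩, div_pos hμ0 (by linarith)⟩ : ℍ).im = μ / (- X 1 0) :=
    rfl
  have h10' := h10.ne
  have h01 : X 0 1 = -(μ ^ 2 + X 0 0 ^ 2) / X 1 0 := by
    rw [hμ2]
    field_simp
    ring
  have hμ' := hμ0.ne'
  ext i j
  fin_cases i <;> fin_cases j <;> simp [rotGen, e1, e2, h11]
  · field_simp
  · rw [h01]; field_simp; ring
  · field_simp
  · field_simp

theorem rotGen_one_zero_neg (z : ℍ) : rotGen z 1 0 < 0 := by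
  have := z.im_pos
  simp [rotGen, this]

/-- A nonempty sum of points of the sheet lies in the future cone. -/
theorem exists_smul_rotGen_eq_sum {ι : Type*} (s : Finset ι) (hs : s.Nonempty) (f : ι → ℍ) :
    ∃ (z : ℍ) (μ : ℝ), 0 < μ ∧ ∑ i ∈ s, rotGen (f i) = μ • rotGen z := by
  apply exists_smul_rotGen_eq
  · simp [Matrix.trace_sum, rotGen_trace]
  · rw [Finset.sum_mul_sum, Matrix.trace_sum]
    apply Finset.sum_neg _ hs
    intro i _
    rw [Matrix.trace_sum]
    apply Finset.sum_neg _ hs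
    intro j _
    rw [trace_rotGen_mul_rotGen]
    linarith [Real.one_le_cosh (dist (f i) (f j))]
  · rw [Matrix.sum_apply]
    exact Finset.sum_neg (fun i _ => rotGen_one_zero_neg _) hs

theorem smul_rotGen_injective {z w : ℍ} {μ ν : ℝ} (hμ : 0 < μ) (hν : 0 < ν)
    (h : μ • rotGen z = ν • rotGen w) : z = w := by
  have h2 := congrArg (fun X => (X * X).trace) h
  simp only [Matrix.smul_mul, Matrix.mul_smul, rotGen_mul_self, smul_smul] at h2
  simp at h2
  have : μ = ν := by nlinarith
  subst this
  exact rotGen_injective (smul_right_injective _ hμ.ne' h)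

/-! ### Rotations -/

theorem rotGen_mul_inv_rotMatrix (P : ℍ) (t : ℝ) :
    ((rotMatrix P t)⁻¹ : SL(2, ℝ)) = rotMatrix P (-t) := by
  apply Subtype.ext
  rw [Matrix.SpecialLinearGroup.coe_inv, Matrix.adjugate_fin_two]
  ext i j
  fin_cases i <;> fin_cases j <;> simp [rotMatrix] <;> ring

theorem rotMatrix_add (P : ℍ) (s t : ℝ) :
    rotMatrix P (s + t) = rotMatrix P s * rotMatrix P t := by
  apply Subtype.ext
  rw [Matrix.SpecialLinearGroup.coe_mul]
  simp only [coe_rotMatrix, Real.cos_add, Real.sin_add]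
  simp only [mul_add, add_mul, Matrix.smul_mul, Matrix.mul_smul, one_mul, mul_one,
    rotGen_mul_self]
  module

theorem rotMatrix_zero (P : ℍ) : rotMatrix P 0 = 1 := by
  apply Subtype.ext
  rw [coe_rotMatrix]
  simp

theorem rotMatrix_pow (P : ℍ) (t : ℝ) (k : ℕ) : rotMatrix P t ^ k = rotMatrix P (k * t) := by
  induction k with
  | zero => simp [rotMatrix_zero]
  | succ k ih => rw [pow_succ, ih, ← rotMatrix_add]; congr 1; push_cast; ring

theorem rotMatrix_pi (P : ℍ) : rotMatrix P Real.pi = -1 := by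
  apply Subtype.ext
  rw [coe_rotMatrix]
  simp

theorem rotMatrix_smul (P : ℍ) (g : SL(2, ℝ)) (t : ℝ) :
    rotMatrix (g • P) t = g * rotMatrix P t * g⁻¹ := by
  apply Subtype.ext
  simp only [Matrix.SpecialLinearGroup.coe_mul, coe_rotMatrix, rotGen_smul_SL, mul_add, add_mul,
    Matrix.smul_mul, Matrix.mul_smul, mul_one]
  rw [← Matrix.SpecialLinearGroup.coe_mul, mul_inv_cancel, Matrix.SpecialLinearGroup.coe_one]

/-- The Möbius transformation of `ℍ` induced by a matrix. -/
abbrev moebius : SL(2, ℝ) →* Equiv.Perm ℍ := MulAction.toPermHom SL(2, ℝ) ℍ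

theorem moebius_apply (g : SL(2, ℝ)) (z : ℍ) : moebius g z = g • z := rfl

theorem moebius_neg (g : SL(2, ℝ)) : moebius (-g) = moebius g := by
  ext1 z
  apply rotGen_injective
  rw [moebius_apply, moebius_apply, rotGen_smul_SL, rotGen_smul_SL, inv_neg,
    Matrix.SpecialLinearGroup.coe_neg, Matrix.SpecialLinearGroup.coe_neg]
  simp

/-- `g` acts trivially on `ℍ` only if `g = ±1`. -/
theorem moebius_eq_one_iff (g : SL(2, ℝ)) : moebius g = 1 ↔ g = 1 ∨ g = -1 := by
  constructor
  · intro h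
    have key : ∀ z : ℍ, (g : Matrix (Fin 2) (Fin 2) ℝ) * rotGen z = rotGen z * g := fun z => by
      have h1 := rotGen_smul_SL g z
      rw [← moebius_apply, h, Equiv.Perm.one_apply] at h1
      conv_rhs => rw [h1]
      rw [Matrix.mul_assoc _ _ (g : Matrix (Fin 2) (Fin 2) ℝ), ← Matrix.SpecialLinearGroup.coe_mul,
        inv_mul_cancel, Matrix.SpecialLinearGroup.coe_one, mul_one]
    have hd := g.det_coe
    rw [Matrix.det_fin_two] at hd
    -- Commuting with the generators at `i` and `2i` already forces `g` to be scalar: the first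
    -- makes it a rotation matrix, and the second kills the off-diagonal part.
    have k1 := key ⟨⟨0, 1⟩, one_pos⟩
    have k2 := key ⟨⟨0, 2⟩, two_pos⟩
    have e1 := congrFun (congrFun k1 0) 0
    have e2 := congrFun (congrFun k1 0) 1
    have e3 := congrFun (congrFun k2 0) 0
    simp [rotGen, Matrix.mul_apply, Fin.sum_univ_two, UpperHalfPlane.im, UpperHalfPlane.re]
      at e1 e2 e3
    have h10 : g 1 0 = 0 := by linarith
    have h01 : g 0 1 = 0 := by linarith
    have h2 : (g 0 0 - 1) * (g 0 0 + 1) = 0 := by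
      rw [h10, ← e2] at hd
      linarith
    rcases mul_eq_zero.1 h2 with h3 | h3
    · left
      ext i j
      fin_cases i <;> fin_cases j <;> simp [h10, h01] <;> linarith
    · right
      ext i j
      fin_cases i <;> fin_cases j <;> simp [h10, h01] <;> linarith
  · rintro (rfl | rfl)
    · exact map_one _
    · rw [moebius_neg]
      exact map_one _

theorem hypRotation_eq (P : ℍ) (φ : ℝ) : hypRotation P φ = moebius (rotMatrix P (φ / 2)) := rfl

/-! ### Rotations with product `-1` and the dual law of cosines -/

theorem SL2_trace_inv (g : SL(2, ℝ)) :
    ((g⁻¹ : SL(2, ℝ)) : Matrix (Fin 2) (Fin 2) ℝ).trace =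
      (g : Matrix (Fin 2) (Fin 2) ℝ).trace := by
  rw [Matrix.SpecialLinearGroup.coe_inv, Matrix.adjugate_fin_two, Matrix.trace_fin_two,
    Matrix.trace_fin_two]
  simp [add_comm]

theorem trace_rotMatrix (P : ℍ) (t : ℝ) :
    (rotMatrix P t : Matrix (Fin 2) (Fin 2) ℝ).trace = 2 * Real.cos t := by
  rw [coe_rotMatrix, Matrix.trace_add, Matrix.trace_smul, Matrix.trace_smul, rotGen_trace]
  simp [mul_comm]

theorem trace_rotMatrix_mul (P Q : ℍ) (s t : ℝ) :
    ((rotMatrix P s * rotMatrix Q t : SL(2, ℝ)) : Matrix (Fin 2) (Fin 2) ℝ).trace =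
      2 * (Real.cos s * Real.cos t - Real.sin s * Real.sin t * Real.cosh (dist P Q)) := by
  rw [Matrix.SpecialLinearGroup.coe_mul]
  simp only [coe_rotMatrix, mul_add, add_mul, Matrix.smul_mul, Matrix.mul_smul, one_mul, mul_one,
    Matrix.trace_add, Matrix.trace_smul, rotGen_trace, trace_rotGen_mul_rotGen, smul_eq_mul]
  simp
  ring

/-- The dual law of cosines, from comparing traces of the rotation about `P` and of the product of
the other two. -/
theorem sin_mul_sin_mul_cosh_dist {P Q R : ℍ} {α β γ : ℝ}
    (h : rotMatrix P α * rotMatrix Q β * rotMatrix R γ = -1) :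
    Real.sin β * Real.sin γ * Real.cosh (dist Q R) =
      Real.cos α + Real.cos β * Real.cos γ := by
  have h1 : rotMatrix Q β * rotMatrix R γ = -(rotMatrix P α)⁻¹ := by
    rw [mul_assoc] at h
    rw [eq_inv_mul_of_mul_eq h, mul_neg, mul_one]
  have h2 := trace_rotMatrix_mul Q R β γ
  rw [h1, Matrix.SpecialLinearGroup.coe_neg, Matrix.trace_neg, SL2_trace_inv,
    trace_rotMatrix] at h2
  linarith

theorem mul_rotate_eq_neg_one {G : Type*} [Group G] [HasDistribNeg G] {a b c : G}
    (h : a * b * c = -1) : b * c * a = -1 := by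
  rw [mul_assoc] at h
  rw [eq_inv_mul_of_mul_eq h, mul_neg, mul_one, neg_mul, inv_mul_cancel]

/-- Coinciding vertices would give `cos (β + γ) = cos (π - α)`, which the angle sum excludes. -/
theorem ne_of_rotMatrix_mul {P Q R : ℍ} {α β γ : ℝ}
    (h : rotMatrix P α * rotMatrix Q β * rotMatrix R γ = -1) (hα : 0 < α) (hβ : 0 < β)
    (hγ : 0 < γ) (hsum : α + β + γ < Real.pi) : Q ≠ R := by
  rintro rfl
  have h1 := sin_mul_sin_mul_cosh_dist h
  rw [dist_self, Real.cosh_zero, mul_one] at h1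
  have h2 : Real.cos (Real.pi - α) < Real.cos (β + γ) :=
    Real.cos_lt_cos_of_nonneg_of_le_pi (by linarith) (by linarith) (by linarith)
  rw [Real.cos_pi_sub, Real.cos_add] at h2
  linarith

/-- The product relation alone determines the angles: the dual law of cosines gives all sides, and
these are substituted into the ordinary law. -/
theorem hypAngle_eq {P Q R : ℍ} {α β γ : ℝ}
    (h : rotMatrix P α * rotMatrix Q β * rotMatrix R γ = -1) (hα : 0 < α) (hβ : 0 < β)
    (hγ : 0 < γ) (hsum : α + β + γ < Real.pi) : hypAngle P Q R = α := by
  have hh := mul_rotate_eq_neg_one h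
  have hhh := mul_rotate_eq_neg_one hh
  have hPQ : P ≠ Q := ne_of_rotMatrix_mul hhh hγ hα hβ (by linarith)
  have hPR : R ≠ P := ne_of_rotMatrix_mul hh hβ hγ hα (by linarith)
  have e1 := sin_mul_sin_mul_cosh_dist h
  have e2 := sin_mul_sin_mul_cosh_dist hh
  have e3 := sin_mul_sin_mul_cosh_dist hhh
  rw [dist_comm] at e2
  have d1 : 0 < Real.sinh (dist P Q) := Real.sinh_pos_iff.2 (dist_pos.2 hPQ)
  have d2 : 0 < Real.sinh (dist P R) := Real.sinh_pos_iff.2 (dist_pos.2 hPR.symm)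
  have q1 := Real.cosh_sq (dist P Q)
  have q2 := Real.cosh_sq (dist P R)
  have sα : 0 < Real.sin α := Real.sin_pos_of_pos_of_lt_pi hα (by linarith)
  have sβ : 0 < Real.sin β := Real.sin_pos_of_pos_of_lt_pi hβ (by linarith)
  have sγ : 0 < Real.sin γ := Real.sin_pos_of_pos_of_lt_pi hγ (by linarith)
  have t1 := Real.sin_sq_add_cos_sq α
  have t2 := Real.sin_sq_add_cos_sq β
  have t3 := Real.sin_sq_add_cos_sq γ
  rw [hypAngle]
  generalize Real.sinh (dist P Q) = sPQ at *
  generalize Real.sinh (dist P R) = sPR at *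
  generalize Real.cosh (dist P Q) = cPQ at *
  generalize Real.cosh (dist P R) = cPR at *
  generalize Real.cosh (dist Q R) = cQR at *
  rw [← Real.arccos_cos hα.le (by linarith)]
  congr 1
  generalize Real.sin α = s1 at *
  generalize Real.sin β = s2 at *
  generalize Real.sin γ = s3 at *
  generalize Real.cos α = c1 at *
  generalize Real.cos β = c2 at *
  generalize Real.cos γ = c3 at *
  -- The common value of the squares `(sin · sin · sinh)²` over the three sides, symmetric in the
  -- angles; its symmetry is the law of sines.
  set Δ := c1 ^ 2 + c2 ^ 2 + c3 ^ 2 + 2 * c1 * c2 * c3 - 1 with hΔ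
  have g1 : (s1 * s2 * sPQ) ^ 2 = Δ := by
    have : (s1 * s2 * sPQ) ^ 2 = (s1 * s2 * cPQ) ^ 2 - s1 ^ 2 * s2 ^ 2 := by rw [mul_pow _ cPQ, q1]; ring
    rw [this, e3, hΔ]
    have a1 : s1 ^ 2 = 1 - c1 ^ 2 := by linarith
    have a2 : s2 ^ 2 = 1 - c2 ^ 2 := by linarith
    rw [a1, a2]
    ring
  have g2 : (s1 * s3 * sPR) ^ 2 = Δ := by
    have : (s1 * s3 * sPR) ^ 2 = (s3 * s1 * cPR) ^ 2 - s1 ^ 2 * s3 ^ 2 := by rw [mul_pow _ cPR, q2]; ring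
    rw [this, e2, hΔ]
    have a1 : s1 ^ 2 = 1 - c1 ^ 2 := by linarith
    have a2 : s3 ^ 2 = 1 - c3 ^ 2 := by linarith
    rw [a1, a2]
    ring
  have g3 : s1 * s2 * sPQ = s1 * s3 * sPR :=
    (pow_left_inj₀ (by positivity) (by positivity) two_ne_zero).1 (g1.trans g2.symm)
  have g4 : (s1 * s2 * sPQ) * (s1 * s3 * sPR) = Δ := by rw [← g3, ← sq, g1]
  rw [div_eq_iff (by positivity)]
  have hs : s1 ^ 2 * s2 * s3 ≠ 0 := by positivity
  apply mul_left_cancel₀ hs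
  have r1 : s1 ^ 2 * s2 * s3 * (cPQ * cPR - cQR) =
      (s1 * s2 * cPQ) * (s3 * s1 * cPR) - s1 ^ 2 * (s2 * s3 * cQR) := by ring
  have r2 : s1 ^ 2 * s2 * s3 * (c1 * (sPQ * sPR)) = c1 * ((s1 * s2 * sPQ) * (s1 * s3 * sPR)) := by
    ring
  have a1 : s1 ^ 2 = 1 - c1 ^ 2 := by linarith
  rw [r1, r2, e1, e2, e3, g4, a1, hΔ]
  ring

/-- Three rotations of the hyperbolic plane through `2π/l`, `2π/m`, `2π/k`, given by matrices with
product `-1`. -/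
structure RotationTriangle (l m k : ℕ) where
  P : ℍ
  Q : ℍ
  R : ℍ
  two_le_l : 2 ≤ l
  two_le_m : 2 ≤ m
  two_le_k : 2 ≤ k
  sum_lt : Real.pi / l + Real.pi / m + Real.pi / k < Real.pi
  mul_eq : rotMatrix P (Real.pi / l) * rotMatrix Q (Real.pi / m) * rotMatrix R (Real.pi / k) = -1

theorem hypRotation_two_pi_div (P : ℍ) (l : ℕ) :
    hypRotation P (2 * Real.pi / l) = moebius (rotMatrix P (Real.pi / l)) := by
  rw [hypRotation_eq]
  congr 2
  ring

/-- The matrix carries half the angle, so its `l`-th power is `-1`, which acts trivially. Conversely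
the lower left entry of `±1` forces `sin (jπ/l) = 0`. -/
theorem hypRotation_pow_eq_one_iff (P : ℍ) {l : ℕ} (hl : l ≠ 0) (j : ℕ) :
    hypRotation P (2 * Real.pi / l) ^ j = 1 ↔ l ∣ j := by
  have hl' : (l : ℝ) ≠ 0 := by exact_mod_cast hl
  rw [hypRotation_two_pi_div, ← map_pow, moebius_eq_one_iff, rotMatrix_pow]
  constructor
  · intro h
    have hs : Real.sin (j * (Real.pi / l)) = 0 := by
      have h1 : ∀ g : SL(2, ℝ), g = 1 ∨ g = -1 → g 1 0 = 0 := by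
        rintro g (rfl | rfl) <;> simp
      have h2 := h1 _ h
      have h3 := congrFun (congrFun (coe_rotMatrix P (j * (Real.pi / l))) 1) 0
      rw [h2] at h3
      have := (rotGen_one_zero_neg P).ne
      simpa [this] using h3.symm
    obtain ⟨i, hi⟩ := Real.sin_eq_zero_iff.1 hs
    have : (i : ℝ) * l = j := by
      field_simp at hi
      exact hi
    have h4 : (j : ℤ) = l * i := by
      have : ((i * l : ℤ) : ℝ) = (j : ℤ) := by push_cast; exact this
      have := Int.cast_injective this
      rw [← this]; ring
    exact Int.natCast_dvd_natCast.1 ⟨i, h4⟩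
  · rintro ⟨i, rfl⟩
    have h1 : ((l * i : ℕ) : ℝ) * (Real.pi / l) = i * Real.pi := by
      push_cast
      field_simp
    rw [h1, ← rotMatrix_pow, rotMatrix_pi]
    exact neg_one_pow_eq_or _ i

theorem orderOf_hypRotation (P : ℍ) {l : ℕ} (hl : l ≠ 0) :
    orderOf (hypRotation P (2 * Real.pi / l)) = l :=
  Nat.dvd_antisymm (orderOf_dvd_of_pow_eq_one ((hypRotation_pow_eq_one_iff P hl l).2 dvd_rfl))
    ((hypRotation_pow_eq_one_iff P hl _).1 (pow_orderOf_eq_one _))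

namespace RotationTriangle

variable {l m k : ℕ} (T : RotationTriangle l m k)

/-- The rotation about the first vertex. -/
def u : Equiv.Perm ℍ := hypRotation T.P (2 * Real.pi / l)

/-- The rotation about the second vertex. -/
def v : Equiv.Perm ℍ := hypRotation T.Q (2 * Real.pi / m)

/-- The rotation about the third vertex. -/
def w : Equiv.Perm ℍ := hypRotation T.R (2 * Real.pi / k)

/-- Cyclic rotation of the vertices. -/
def rotate : RotationTriangle m k l where
  P := T.Q
  Q := T.R
  R := T.P
  two_le_l := T.two_le_m
  two_le_m := T.two_le_k
  two_le_k := T.two_le_l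
  sum_lt := by linarith [T.sum_lt]
  mul_eq := mul_rotate_eq_neg_one T.mul_eq

theorem pi_div_l_pos {l m k : ℕ} (T : RotationTriangle l m k) : 0 < Real.pi / l := by
  have : 0 < l := by linarith [T.two_le_l]
  positivity

theorem u_mul_v_mul_w : T.u * T.v * T.w = 1 := by
  rw [u, v, w, hypRotation_two_pi_div, hypRotation_two_pi_div, hypRotation_two_pi_div, ← map_mul,
    ← map_mul, T.mul_eq, moebius_eq_one_iff]
  exact Or.inr rfl

theorem Q_ne_R : T.Q ≠ T.R :=
  ne_of_rotMatrix_mul T.mul_eq T.pi_div_l_pos T.rotate.pi_div_l_pos T.rotate.rotate.pi_div_l_pos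
    T.sum_lt

theorem hypAngle_P : hypAngle T.P T.Q T.R = Real.pi / l :=
  hypAngle_eq T.mul_eq T.pi_div_l_pos T.rotate.pi_div_l_pos T.rotate.rotate.pi_div_l_pos T.sum_lt

theorem isCanonicalTriple : IsCanonicalTriple l m k T.u T.v T.w :=
  ⟨T.P, T.Q, T.R, T.rotate.rotate.Q_ne_R, T.Q_ne_R, T.rotate.Q_ne_R, T.hypAngle_P,
    T.rotate.hypAngle_P, T.rotate.rotate.hypAngle_P, rfl, rfl, rfl, T.u_mul_v_mul_w⟩

theorem sin_pos {l m k : ℕ} (T : RotationTriangle l m k) : 0 < Real.sin (Real.pi / l) := by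
  apply Real.sin_pos_of_pos_of_lt_pi T.pi_div_l_pos
  have := T.sum_lt
  have := T.rotate.pi_div_l_pos
  have := T.rotate.rotate.pi_div_l_pos
  linarith

theorem u_pow_eq_one : T.u ^ l = 1 :=
  (hypRotation_pow_eq_one_iff _ (by linarith [T.two_le_l]) _).2 dvd_rfl

theorem orderOf_u : orderOf T.u = l := orderOf_hypRotation _ (by linarith [T.two_le_l])

end RotationTriangle

theorem sum_pi_div_lt {n : ℕ} (hn : 2 ≤ n) :
    Real.pi / (2 : ℕ) + Real.pi / (2 * n : ℕ) + Real.pi / (4 * n : ℕ) < Real.pi := by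
  have hn' : (2 : ℝ) ≤ n := by exact_mod_cast hn
  have h : (n : ℝ)⁻¹ ≤ 2⁻¹ := inv_anti₀ (by norm_num) hn'
  have hp := Real.pi_pos
  have : Real.pi / (2 : ℕ) + Real.pi / (2 * n : ℕ) + Real.pi / (4 * n : ℕ) =
      Real.pi * (1 / 2 + 3 / 4 * (n : ℝ)⁻¹) := by
    push_cast
    field_simp
    ring
  rw [this]
  nlinarith

/-- The relation `uvw = 1` lifts to `SL₂(ℝ)` only up to sign. The sign `+1` is impossible: as the
first rotation has trace 0, it would make the positive number `cos (π/2n)` equal to `-sin (π/4n)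
cosh d ≤ 0`. -/
theorem IsCanonicalTriple.exists_rotationTriangle {n : ℕ} (hn : 2 ≤ n) {u v w : Equiv.Perm ℍ}
    (h : IsCanonicalTriple 2 (2 * n) (4 * n) u v w) :
    ∃ T : RotationTriangle 2 (2 * n) (4 * n), u = T.u ∧ v = T.v ∧ w = T.w := by
  obtain ⟨P, Q, R, -, -, -, -, -, -, rfl, rfl, rfl, h1⟩ := h
  refine ⟨⟨P, Q, R, le_rfl, by omega, by omega, sum_pi_div_lt hn, ?_⟩, rfl, rfl, rfl⟩
  rw [hypRotation_two_pi_div, hypRotation_two_pi_div, hypRotation_two_pi_div, ← map_mul,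
    ← map_mul, moebius_eq_one_iff] at h1
  refine h1.resolve_left fun h2 => ?_
  have hp := Real.pi_pos
  have hn' : (2 : ℝ) ≤ n := by exact_mod_cast hn
  have hpn : Real.pi / n ≤ Real.pi / 2 := by gcongr
  have hpn' : 0 < Real.pi / n := by positivity
  have h3 : rotMatrix R (Real.pi / (4 * n : ℕ)) * rotMatrix P (Real.pi / (2 : ℕ)) =
      (rotMatrix Q (Real.pi / (2 * n : ℕ)))⁻¹ := by
    apply eq_inv_of_mul_eq_one_left
    rw [mul_assoc]
    rwa [mul_eq_one_iff_eq_inv, eq_comm, inv_eq_iff_mul_eq_one, ] at h2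
  have h4 := trace_rotMatrix_mul R P (Real.pi / (4 * n : ℕ)) (Real.pi / (2 : ℕ))
  rw [h3, SL2_trace_inv, trace_rotMatrix, Nat.cast_two, Real.cos_pi_div_two,
    Real.sin_pi_div_two] at h4
  have h5 : 0 < Real.cos (Real.pi / (2 * n : ℕ)) := by
    apply Real.cos_pos_of_mem_Ioo
    have : Real.pi / (2 * n : ℕ) = Real.pi / n / 2 := by push_cast; field_simp
    rw [this]
    constructor <;> linarith
  have h6 : 0 ≤ Real.sin (Real.pi / (4 * n : ℕ)) := by
    have : Real.pi / (4 * n : ℕ) = Real.pi / n / 4 := by push_cast; field_simp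
    rw [this]
    apply Real.sin_nonneg_of_nonneg_of_le_pi <;> linarith
  nlinarith [Real.cosh_pos (dist R P)]

/-- Put the right angle at `P = i` and `R = iy` on the imaginary axis, then solve the matrix
equation for `Q`. -/
theorem exists_rotationTriangle {n : ℕ} (hn : 2 ≤ n) :
    Nonempty (RotationTriangle 2 (2 * n) (4 * n)) := by
  have hp := Real.pi_pos
  have hn' : (2 : ℝ) ≤ n := by exact_mod_cast hn
  set γ : ℝ := Real.pi / (4 * n : ℕ) with hγ
  have hβ : Real.pi / (2 * n : ℕ) = 2 * γ := by rw [hγ]; push_cast; field_simp; ring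
  have hγ0 : 0 < γ := by positivity
  have hγ8 : γ ≤ Real.pi / 8 := by
    rw [hγ]
    push_cast
    gcongr
    linarith
  have hs3 : 0 < Real.sin γ := Real.sin_pos_of_pos_of_lt_pi hγ0 (by linarith)
  have hc3 : 0 < Real.cos γ := Real.cos_pos_of_mem_Ioo ⟨by linarith, by linarith⟩
  have hs2 : 0 < Real.sin (2 * γ) := Real.sin_pos_of_pos_of_lt_pi (by linarith) (by linarith)
  have hlt : Real.sin γ < Real.cos (2 * γ) := by
    rw [← Real.cos_pi_div_two_sub]
    apply Real.cos_lt_cos_of_nonneg_of_le_pi <;> linarith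
  -- The value of `cosh (dist P R)` dictated by the dual law of cosines; `y` below is the root
  -- greater than 1 of `y + 1/y = 2κ`.
  set κ := Real.cos (2 * γ) / Real.sin γ with hκ
  have hκ1 : 1 < κ := (one_lt_div hs3).2 hlt
  set y := κ + Real.sqrt (κ ^ 2 - 1) with hy
  have hsq : Real.sqrt (κ ^ 2 - 1) ^ 2 = κ ^ 2 - 1 := Real.sq_sqrt (by nlinarith)
  have hy0 : 0 < y := by positivity
  have hyκ : y ^ 2 + 1 = 2 * κ * y := by rw [hy]; nlinarith
  have hκs : κ * Real.sin γ = Real.cos (2 * γ) := by rw [hκ]; field_simp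
  have hyy : Real.sin γ * (y ^ 2 + 1) = 2 * Real.cos (2 * γ) * y := by
    rw [hyκ, ← hκs]; ring
  have t2 := Real.sin_sq_add_cos_sq (2 * γ)
  have t3 := Real.sin_sq_add_cos_sq γ
  obtain ⟨P, hPre, hPim⟩ : ∃ P : ℍ, P.re = 0 ∧ P.im = 1 := ⟨⟨⟨0, 1⟩, one_pos⟩, rfl, rfl⟩
  obtain ⟨R, hRre, hRim⟩ : ∃ R : ℍ, R.re = 0 ∧ R.im = y := ⟨⟨⟨0, y⟩, hy0⟩, rfl, rfl⟩
  -- The coordinates of `Q` are read off from the lower row of the half-turn about `P` times the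
  -- inverse of the rotation about `R`.
  obtain ⟨Q, hQre, hQim⟩ : ∃ Q : ℍ, Q.re = (Real.sin γ * y - Real.cos (2 * γ)) / Real.cos γ ∧
      Q.im = Real.sin (2 * γ) / Real.cos γ := ⟨⟨⟨_, _⟩, div_pos hs2 hc3⟩, rfl, rfl⟩
  refine ⟨⟨P, Q, R, le_rfl, by omega, by omega, sum_pi_div_lt hn, ?_⟩⟩
  rw [hβ, Nat.cast_two, ← hγ]
  have hPU : rotMatrix P (Real.pi / 2) * rotMatrix P (Real.pi / 2) = -1 := by
    rw [← rotMatrix_add, add_halves, rotMatrix_pi]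
  have hV : rotMatrix Q (2 * γ) = rotMatrix P (Real.pi / 2) * (rotMatrix R γ)⁻¹ := by
    apply Subtype.ext
    rw [rotGen_mul_inv_rotMatrix, Matrix.SpecialLinearGroup.coe_mul]
    clear_value κ y γ
    ext i j
    fin_cases i <;> fin_cases j <;>
      simp [rotMatrix, Matrix.mul_apply, Fin.sum_univ_two, hPre, hPim, hRre, hRim, hQre, hQim]
    all_goals
      generalize Real.sin (2 * γ) = s2 at *
      generalize Real.cos (2 * γ) = c2 at *
      generalize Real.sin γ = s3 at *
      generalize Real.cos γ = c3 at *
      field_simp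
    · linarith
    · have h2 : s2 ^ 2 = 1 - c2 ^ 2 := by linarith
      have h3 : c3 ^ 2 = 1 - s3 ^ 2 := by linarith
      rw [h2, h3]
      linear_combination s3 * hyy
    · ring
  rw [hV, ← mul_assoc, hPU, mul_assoc, inv_mul_cancel, mul_one]

/-! ### Traceless matrices and mirrors -/

section Traceless

variable {F : Type*} [CommRing F]

/-- Polarised Cayley–Hamilton: the traceless matrices satisfy the Clifford relations of the trace
form. -/
theorem mul_add_mul_eq_trace_smul {A B : Matrix (Fin 2) (Fin 2) F} (hA : A.trace = 0)
    (hB : B.trace = 0) : A * B + B * A = (A * B).trace • 1 := by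
  rw [Matrix.trace_fin_two] at hA hB
  have hA' : A 1 1 = - A 0 0 := by linear_combination hA
  have hB' : B 1 1 = - B 0 0 := by linear_combination hB
  ext i j
  fin_cases i <;> fin_cases j <;>
    simp [Matrix.trace_fin_two, Matrix.mul_apply, Fin.sum_univ_two, hA', hB'] <;> ring

/-- The commutator acts as a cross product; this expands `X` in the basis dual to `a, b, c`, cleared
of the triple product in the denominator. -/
theorem trace_triple_smul {X a b c : Matrix (Fin 2) (Fin 2) F} (hX : X.trace = 0)
    (ha : a.trace = 0) (hb : b.trace = 0) (hc : c.trace = 0) :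
    (a * (b * c - c * b)).trace • X = (X * a).trace • (b * c - c * b) +
      (X * b).trace • (c * a - a * c) + (X * c).trace • (a * b - b * a) := by
  rw [Matrix.trace_fin_two] at hX ha hb hc
  have hX' : X 1 1 = - X 0 0 := by linear_combination hX
  have ha' : a 1 1 = - a 0 0 := by linear_combination ha
  have hb' : b 1 1 = - b 0 0 := by linear_combination hb
  have hc' : c 1 1 = - c 0 0 := by linear_combination hc
  ext i j
  fin_cases i <;> fin_cases j <;>
    simp [Matrix.trace_fin_two, Matrix.mul_apply, Fin.sum_univ_two, hX', ha', hb', hc'] <;> ring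

theorem adjugate_eq_neg {A : Matrix (Fin 2) (Fin 2) F} (hA : A.trace = 0) :
    A.adjugate = -A := by
  rw [Matrix.trace_fin_two] at hA
  have hA' : A 1 1 = - A 0 0 := by linear_combination hA
  rw [Matrix.adjugate_fin_two]
  ext i j
  fin_cases i <;> fin_cases j <;> simp [hA']

end Traceless

/-- The right-hand side is symmetric in the three angles, so this contains the law of sines. -/
theorem sq_sin_mul_sin_mul_sinh_dist {P Q R : ℍ} {α β γ : ℝ}
    (h : rotMatrix P α * rotMatrix Q β * rotMatrix R γ = -1) :
    (Real.sin β * Real.sin γ * Real.sinh (dist Q R)) ^ 2 =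
      Real.cos α ^ 2 + Real.cos β ^ 2 + Real.cos γ ^ 2 +
        2 * Real.cos α * Real.cos β * Real.cos γ - 1 := by
  have e := sin_mul_sin_mul_cosh_dist h
  have h1 : (Real.sin β * Real.sin γ * Real.sinh (dist Q R)) ^ 2 =
      (Real.sin β * Real.sin γ * Real.cosh (dist Q R)) ^ 2 - Real.sin β ^ 2 * Real.sin γ ^ 2 := by
    rw [mul_pow _ (Real.cosh _), Real.cosh_sq]
    ring
  rw [h1, e, Real.sin_sq, Real.sin_sq]
  ring

namespace RotationTriangle

variable {l m k : ℕ}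

/-- The commutator of the infinitesimal rotations about `P` and `Q`. -/
def cross (T : RotationTriangle l m k) : Matrix (Fin 2) (Fin 2) ℝ :=
  rotGen T.P * rotGen T.Q - rotGen T.Q * rotGen T.P

/-- The unit normal of the side `PQ`, on the side of `R`. -/
def mirror (T : RotationTriangle l m k) : Matrix (Fin 2) (Fin 2) ℝ :=
  (2 * Real.sinh (dist T.P T.Q))⁻¹ • T.cross

theorem cross_trace (T : RotationTriangle l m k) : T.cross.trace = 0 := by
  rw [cross, Matrix.trace_sub, Matrix.trace_mul_comm, sub_self]

theorem cross_mul_self (T : RotationTriangle l m k) :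
    T.cross * T.cross = (4 * Real.sinh (dist T.P T.Q) ^ 2) • 1 := by
  have h := mul_add_mul_eq_trace_smul (rotGen_trace T.P) (rotGen_trace T.Q)
  rw [trace_rotGen_mul_rotGen] at h
  have hA := rotGen_mul_self T.P
  have hB := rotGen_mul_self T.Q
  have hs := Real.sinh_sq (dist T.P T.Q)
  rw [hs, cross]
  generalize rotGen T.P = A at *
  generalize rotGen T.Q = B at *
  generalize Real.cosh (dist T.P T.Q) = c at *
  have h' : A * B = (-2 * c) • 1 - B * A := by rw [← h]; abel
  have hBAB : B * A * B = (-2 * c) • B + A := by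
    rw [mul_assoc, h', mul_sub, ← mul_assoc, hB]
    simp
  have hsq : (A * B - B * A) * (A * B - B * A) =
      A * (B * A * B) - A * (B * B) * A - B * (A * A) * B + (B * A * B) * A := by noncomm_ring
  rw [hsq, hBAB, hA, hB, mul_add, add_mul, Matrix.mul_smul, Matrix.smul_mul, hA]
  have hBA : B * A = (-2 * c) • 1 - A * B := by rw [← h]; abel
  simp only [mul_neg, neg_mul, mul_one, hA, hB, hBA]
  module

theorem sinh_pos (T : RotationTriangle l m k) : 0 < Real.sinh (dist T.P T.Q) :=
  Real.sinh_pos_iff.2 (dist_pos.2 T.rotate.rotate.Q_ne_R)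

theorem mirror_trace (T : RotationTriangle l m k) : T.mirror.trace = 0 := by
  rw [mirror, Matrix.trace_smul, cross_trace, smul_zero]

theorem mirror_mul_self (T : RotationTriangle l m k) : T.mirror * T.mirror = 1 := by
  have := T.sinh_pos
  rw [mirror, Matrix.smul_mul, Matrix.mul_smul, cross_mul_self, smul_smul, smul_smul]
  convert one_smul ℝ (1 : Matrix (Fin 2) (Fin 2) ℝ) using 2
  field_simp
  norm_num

theorem trace_rotGen_P_mul_mirror (T : RotationTriangle l m k) :
    (rotGen T.P * T.mirror).trace = 0 := by
  rw [mirror, Matrix.mul_smul, Matrix.trace_smul, cross, mul_sub, Matrix.trace_sub,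
    Matrix.trace_mul_comm _ (rotGen T.Q * rotGen T.P), mul_assoc, Matrix.trace_mul_comm (rotGen T.Q),
    ← mul_assoc, sub_self, smul_zero]

theorem trace_rotGen_Q_mul_mirror (T : RotationTriangle l m k) :
    (rotGen T.Q * T.mirror).trace = 0 := by
  rw [mirror, Matrix.mul_smul, Matrix.trace_smul, cross, mul_sub, Matrix.trace_sub,
    Matrix.trace_mul_comm _ (rotGen T.P * rotGen T.Q), mul_assoc, Matrix.trace_mul_comm (rotGen T.P),
    ← mul_assoc, sub_self, smul_zero]

/-- Expand the rotation about `R` as minus the product of the inverses of the other two. This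
expresses the third vertex through `P` and `Q`, which locates it relative to the side `PQ` and
yields the other mirrors. -/
theorem sin_smul_rotGen_R (T : RotationTriangle l m k) :
    Real.sin (Real.pi / k) • rotGen T.R =
      -(Real.cos (Real.pi / k) + Real.cos (Real.pi / l) * Real.cos (Real.pi / m)) • 1 +
      (Real.cos (Real.pi / m) * Real.sin (Real.pi / l)) • rotGen T.P +
      (Real.cos (Real.pi / l) * Real.sin (Real.pi / m)) • rotGen T.Q -
      (Real.sin (Real.pi / l) * Real.sin (Real.pi / m)) • (rotGen T.Q * rotGen T.P) := by
  have h : rotMatrix T.R (Real.pi / k) =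
      -(rotMatrix T.Q (-(Real.pi / m)) * rotMatrix T.P (-(Real.pi / l))) := by
    have := T.mul_eq
    rw [eq_inv_mul_of_mul_eq this, mul_inv_rev, rotGen_mul_inv_rotMatrix, rotGen_mul_inv_rotMatrix,
      mul_neg, mul_one]
  have h' := congrArg (fun g : SL(2, ℝ) => (g : Matrix (Fin 2) (Fin 2) ℝ)) h
  simp only [Matrix.SpecialLinearGroup.coe_neg, Matrix.SpecialLinearGroup.coe_mul, coe_rotMatrix,
    Real.cos_neg, Real.sin_neg] at h'
  rw [← eq_sub_iff_add_eq'] at h'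
  rw [h']
  simp only [mul_add, add_mul, Matrix.smul_mul, Matrix.mul_smul, one_mul, mul_one]
  module

/-- In the expansion of the third vertex only the term in `rotGen Q * rotGen P` pairs nontrivially
with the normal of `PQ`, and its sign is the orientation fixed by the product `-1`. -/
theorem trace_rotGen_R_mul_mirror_pos (T : RotationTriangle l m k) :
    0 < (rotGen T.R * T.mirror).trace := by
  have h := congrArg (fun X => (X * T.cross).trace) T.sin_smul_rotGen_R
  have hP := T.trace_rotGen_P_mul_mirror
  have hQ := T.trace_rotGen_Q_mul_mirror
  have hs := T.sinh_pos
  have hs' : (2 * Real.sinh (dist T.P T.Q))⁻¹ ≠ 0 := by positivity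
  rw [mirror, Matrix.mul_smul, Matrix.trace_smul, smul_eq_mul] at hP hQ ⊢
  have hP' := (mul_eq_zero.1 hP).resolve_left hs'
  have hQ' := (mul_eq_zero.1 hQ).resolve_left hs'
  have hC := congrArg Matrix.trace T.cross_mul_self
  have hC2 : (rotGen T.Q * rotGen T.P * T.cross).trace = - (T.cross * T.cross).trace / 2 := by
    have h1 : (rotGen T.P * rotGen T.Q * T.cross).trace =
        - (rotGen T.Q * rotGen T.P * T.cross).trace := by
      have := mul_add_mul_eq_trace_smul (rotGen_trace T.P) (rotGen_trace T.Q)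
      rw [eq_sub_of_add_eq this, sub_mul, Matrix.trace_sub, Matrix.smul_mul, one_mul,
        Matrix.trace_smul, cross_trace, smul_zero, zero_sub]
    have h2 : (T.cross * T.cross).trace = (rotGen T.P * rotGen T.Q * T.cross).trace -
        (rotGen T.Q * rotGen T.P * T.cross).trace := by
      rw [← Matrix.trace_sub, ← sub_mul]; rfl
    rw [h2, h1]
    ring
  simp only [Matrix.smul_mul, Matrix.trace_smul, add_mul, sub_mul, Matrix.trace_add,
    Matrix.trace_sub, hP', hQ', hC2, hC, one_mul, T.cross_trace, smul_eq_mul, mul_zero,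
    Matrix.trace_one, Fintype.card_fin] at h
  have s1 := T.sin_pos
  have s2 := T.rotate.sin_pos
  have s3 := T.rotate.rotate.sin_pos
  have : 0 < Real.sin (Real.pi / k) * (rotGen T.R * T.cross).trace := by
    rw [h]
    have : 0 < Real.sin (Real.pi / l) * Real.sin (Real.pi / m) *
      Real.sinh (dist T.P T.Q) ^ 2 := by positivity
    push_cast
    linarith
  have := pos_of_mul_pos_right this s3.le
  positivity

theorem sin_mul_sinh_dist (T : RotationTriangle l m k) :
    Real.sin (Real.pi / k) * Real.sinh (dist T.R T.P) =
      Real.sin (Real.pi / m) * Real.sinh (dist T.P T.Q) := by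
  have h1 := sq_sin_mul_sin_mul_sinh_dist T.rotate.mul_eq
  have h2 := sq_sin_mul_sin_mul_sinh_dist T.rotate.rotate.mul_eq
  have s1 := T.sin_pos
  have s2 := T.rotate.sin_pos
  have s3 := T.rotate.rotate.sin_pos
  have d1 := T.sinh_pos
  have d2 := T.rotate.rotate.sinh_pos
  change (Real.sin (Real.pi / k) * Real.sin (Real.pi / l) * Real.sinh (dist T.R T.P)) ^ 2 = _ at h1
  change (Real.sin (Real.pi / l) * Real.sin (Real.pi / m) * Real.sinh (dist T.P T.Q)) ^ 2 = _ at h2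
  change 0 < Real.sinh (dist T.R T.P) at d2
  have h3 : Real.sin (Real.pi / k) * Real.sin (Real.pi / l) * Real.sinh (dist T.R T.P) =
      Real.sin (Real.pi / l) * Real.sin (Real.pi / m) * Real.sinh (dist T.P T.Q) := by
    refine (pow_left_inj₀ (by positivity) (by positivity) two_ne_zero).1 ?_
    rw [h1, h2]
    ring
  apply mul_left_cancel₀ s1.ne'
  linarith

/-- The normals of the two sides at `P` differ by the half-angle rotation, so the reflections in
them compose to the rotation through `2π/l`. The law of sines matches the normalisations. -/
theorem mirror_rotate_rotate (T : RotationTriangle l m k) :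
    T.rotate.rotate.mirror = -(rotMatrix T.P (Real.pi / l) * T.mirror) := by
  have hs := T.sin_mul_sinh_dist
  have s2 := T.rotate.sin_pos
  have s3 := T.rotate.rotate.sin_pos
  have d1 := T.sinh_pos
  have d2 : 0 < Real.sinh (dist T.R T.P) := T.rotate.rotate.sinh_pos
  have hc : Real.sin (Real.pi / k) • T.rotate.rotate.cross =
      -Real.sin (Real.pi / m) • (rotMatrix T.P (Real.pi / l) * T.cross) := by
    change Real.sin (Real.pi / k) • (rotGen T.R * rotGen T.P - rotGen T.P * rotGen T.R) = _
    rw [smul_sub, ← Matrix.smul_mul, ← Matrix.mul_smul, sin_smul_rotGen_R, coe_rotMatrix, cross]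
    have hA := rotGen_mul_self T.P
    generalize rotGen T.P = A at *
    have hA' : ∀ X : Matrix (Fin 2) (Fin 2) ℝ, A * (A * X) = -X := fun X => by
      rw [← mul_assoc, hA, neg_one_mul]
    simp only [mul_add, add_mul, mul_sub, sub_mul, Matrix.smul_mul, Matrix.mul_smul, one_mul,
      mul_one, mul_assoc, hA, hA', mul_neg, smul_neg, smul_sub, smul_add]
    module
  change (2 * Real.sinh (dist T.R T.P))⁻¹ • T.rotate.rotate.cross = _
  rw [mirror, Matrix.mul_smul]
  have hc2 : T.rotate.rotate.cross = -((Real.sin (Real.pi / k))⁻¹ * Real.sin (Real.pi / m)) •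
      (rotMatrix T.P (Real.pi / l) * T.cross) := by
    rw [neg_smul, mul_smul, ← smul_neg, ← neg_smul, ← hc, smul_smul, inv_mul_cancel₀ s3.ne',
      one_smul]
  rw [hc2, smul_smul, ← neg_smul]
  congr 1
  field_simp
  linarith

theorem mirror_rotate_rotate_mul_mirror (T : RotationTriangle l m k) :
    T.rotate.rotate.mirror * T.mirror = -(rotMatrix T.P (Real.pi / l)) := by
  rw [mirror_rotate_rotate, neg_mul, mul_assoc, mirror_mul_self, mul_one]

end RotationTriangle

/-! ### The reflection group of a hyperbolic triangle -/

/-- The linear reflection `X ↦ -a X a` in a traceless matrix `a` with `a² = 1`. -/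
def conjNeg (a : Matrix (Fin 2) (Fin 2) ℝ) : Module.End ℝ (Matrix (Fin 2) (Fin 2) ℝ) :=
  -(LinearMap.mulLeft ℝ a ∘ₗ LinearMap.mulRight ℝ a)

theorem conjNeg_apply (a X : Matrix (Fin 2) (Fin 2) ℝ) : conjNeg a X = -(a * X * a) := by
  simp [conjNeg, mul_assoc]

theorem conjNeg_mul_pow_apply (a b X : Matrix (Fin 2) (Fin 2) ℝ) (n : ℕ) :
    ((conjNeg a * conjNeg b) ^ n) X = (a * b) ^ n * X * (b * a) ^ n := by
  induction n generalizing X with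
  | zero => simp
  | succ n ih =>
    rw [pow_succ, Module.End.mul_apply, ih, Module.End.mul_apply, conjNeg_apply, conjNeg_apply,
      pow_succ, pow_succ']
    noncomm_ring

namespace RotationTriangle

variable {l m k : ℕ}

/-- The Coxeter matrix of the extended triangle group. -/
def coxeterMatrix (T : RotationTriangle l m k) : CoxeterMatrix (Fin 3) where
  -- Index `i` stands for the side opposite the `i`-th of the vertices `P, Q, R`; sides 1 and 2 meet
  -- at `P`, whence the entry `l`.
  M := !![1, k, m; k, 1, l; m, l, 1]
  isSymm := by
    ext i j
    fin_cases i <;> fin_cases j <;> rfl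
  diagonal i := by fin_cases i <;> rfl
  off_diagonal i j h := by
    have := T.two_le_l
    have := T.two_le_m
    have := T.two_le_k
    fin_cases i <;> fin_cases j <;> simp at h ⊢ <;> omega

/-- The unit normals of the three sides. -/
def normal (T : RotationTriangle l m k) : Fin 3 → Matrix (Fin 2) (Fin 2) ℝ :=
  ![T.rotate.mirror, T.rotate.rotate.mirror, T.mirror]

theorem normal_trace (T : RotationTriangle l m k) (i : Fin 3) : (T.normal i).trace = 0 := by
  fin_cases i
  · exact T.rotate.mirror_trace
  · exact T.rotate.rotate.mirror_trace
  · exact T.mirror_trace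

theorem normal_mul_self (T : RotationTriangle l m k) (i : Fin 3) :
    T.normal i * T.normal i = 1 := by
  fin_cases i
  · exact T.rotate.mirror_mul_self
  · exact T.rotate.rotate.mirror_mul_self
  · exact T.mirror_mul_self

theorem normal_one_mul_normal_two (T : RotationTriangle l m k) :
    T.normal 1 * T.normal 2 = -(rotMatrix T.P (Real.pi / l)) :=
  T.mirror_rotate_rotate_mul_mirror

theorem normal_two_mul_normal_zero (T : RotationTriangle l m k) :
    T.normal 2 * T.normal 0 = -(rotMatrix T.Q (Real.pi / m)) :=
  T.rotate.mirror_rotate_rotate_mul_mirror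

theorem normal_zero_mul_normal_one (T : RotationTriangle l m k) :
    T.normal 0 * T.normal 1 = -(rotMatrix T.R (Real.pi / k)) :=
  T.rotate.rotate.mirror_rotate_rotate_mul_mirror

theorem trace_normal_mul_normal (T : RotationTriangle l m k) (i j : Fin 3) :
    (T.normal i * T.normal j).trace = -2 * Real.cos (Real.pi / T.coxeterMatrix i j) := by
  have h12 : (T.normal 1 * T.normal 2).trace = -2 * Real.cos (Real.pi / l) := by
    rw [normal_one_mul_normal_two, Matrix.trace_neg, trace_rotMatrix, neg_mul]
  have h20 : (T.normal 2 * T.normal 0).trace = -2 * Real.cos (Real.pi / m) := by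
    rw [normal_two_mul_normal_zero, Matrix.trace_neg, trace_rotMatrix, neg_mul]
  have h01 : (T.normal 0 * T.normal 1).trace = -2 * Real.cos (Real.pi / k) := by
    rw [normal_zero_mul_normal_one, Matrix.trace_neg, trace_rotMatrix, neg_mul]
  by_cases hij : i = j
  · subst hij
    rw [normal_mul_self, CoxeterMatrix.diagonal]
    simp
  · fin_cases i <;> fin_cases j <;> first | exact absurd rfl hij | skip
    · exact h01
    · exact (Matrix.trace_mul_comm _ _).trans h20
    · exact (Matrix.trace_mul_comm _ _).trans h01
    · exact h12
    · exact h20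
    · exact (Matrix.trace_mul_comm _ _).trans h12

theorem neg_rotMatrix_pow (P : ℍ) {l : ℕ} (hl : l ≠ 0) :
    (-(rotMatrix P (Real.pi / l) : Matrix (Fin 2) (Fin 2) ℝ)) ^ l = 1 ∨
      (-(rotMatrix P (Real.pi / l) : Matrix (Fin 2) (Fin 2) ℝ)) ^ l = -1 := by
  have hl' : (l : ℝ) ≠ 0 := by exact_mod_cast hl
  have h : (rotMatrix P (Real.pi / l) : Matrix (Fin 2) (Fin 2) ℝ) ^ l = -1 := by
    rw [← Matrix.SpecialLinearGroup.coe_pow, rotMatrix_pow, mul_div_cancel₀ _ hl', rotMatrix_pi]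
    simp
  rw [neg_pow, h]
  rcases neg_one_pow_eq_or (Matrix (Fin 2) (Fin 2) ℝ) l with h | h <;> simp [h]

theorem mul_swap_pow (T : RotationTriangle l m k) (i j : Fin 3) (n : ℕ) :
    (T.normal i * T.normal j) ^ n * (T.normal j * T.normal i) ^ n = 1 := by
  have h1 : (T.normal i * T.normal j) * (T.normal j * T.normal i) = 1 := by
    rw [mul_assoc, ← mul_assoc (T.normal j), normal_mul_self, one_mul, normal_mul_self]
  have h2 : (T.normal j * T.normal i) * (T.normal i * T.normal j) = 1 := by
    rw [mul_assoc, ← mul_assoc (T.normal i), normal_mul_self, one_mul, normal_mul_self]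
  have hc : Commute (T.normal i * T.normal j) (T.normal j * T.normal i) := h1.trans h2.symm
  rw [← hc.mul_pow, h1, one_pow]

theorem normal_mul_normal_pow (T : RotationTriangle l m k) (i j : Fin 3) :
    (T.normal i * T.normal j) ^ T.coxeterMatrix i j = 1 ∨
      (T.normal i * T.normal j) ^ T.coxeterMatrix i j = -1 := by
  have hl := T.two_le_l
  have hm := T.two_le_m
  have hk := T.two_le_k
  have h12 := neg_rotMatrix_pow T.P (l := l) (by omega)
  have h20 := neg_rotMatrix_pow T.Q (l := m) (by omega)
  have h01 := neg_rotMatrix_pow T.R (l := k) (by omega)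
  rw [← normal_one_mul_normal_two] at h12
  rw [← normal_two_mul_normal_zero] at h20
  rw [← normal_zero_mul_normal_one] at h01
  have hswap : ∀ (i j : Fin 3) (n : ℕ), ((T.normal i * T.normal j) ^ n = 1 ∨
      (T.normal i * T.normal j) ^ n = -1) → ((T.normal j * T.normal i) ^ n = 1 ∨
      (T.normal j * T.normal i) ^ n = -1) := by
    intro i j n h
    have h1 := T.mul_swap_pow i j n
    rcases h with h | h <;> rw [h] at h1
    · left; simpa using h1
    · right; rw [neg_one_mul] at h1; rw [← h1, neg_neg]
  by_cases hij : i = j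
  · subst hij
    left
    rw [normal_mul_self, one_pow]
  · fin_cases i <;> fin_cases j <;> first | exact absurd rfl hij | skip
    · exact h01
    · exact hswap _ _ _ h20
    · exact hswap _ _ _ h01
    · exact h12
    · exact h20
    · exact hswap _ _ _ h12

/-- The Coxeter system of the extended triangle group. -/
abbrev cs (T : RotationTriangle l m k) : CoxeterSystem T.coxeterMatrix T.coxeterMatrix.Group :=
  T.coxeterMatrix.toCoxeterSystem

theorem isLiftable_conjNeg (T : RotationTriangle l m k) :
    T.coxeterMatrix.IsLiftable fun i => conjNeg (T.normal i) := fun i j => by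
  ext1 X
  rw [conjNeg_mul_pow_apply, Module.End.one_apply]
  have h1 := T.mul_swap_pow i j (T.coxeterMatrix i j)
  rcases T.normal_mul_normal_pow i j with h | h <;> rw [h] at h1 ⊢
  · rw [one_mul] at h1
    rw [h1, one_mul, mul_one]
  · rw [neg_one_mul, neg_eq_iff_eq_neg] at h1
    rw [h1]
    simp

/-- The reflection representation. -/
def rep (T : RotationTriangle l m k) :
    T.coxeterMatrix.Group →* Module.End ℝ (Matrix (Fin 2) (Fin 2) ℝ) :=
  T.cs.lift ⟨fun i => conjNeg (T.normal i), T.isLiftable_conjNeg⟩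

theorem rep_simple (T : RotationTriangle l m k) (i : Fin 3) :
    T.rep (T.cs.simple i) = conjNeg (T.normal i) :=
  T.cs.lift_apply_simple T.isLiftable_conjNeg i

/-- The unit normal of a side as an invertible matrix. -/
def normalGL (T : RotationTriangle l m k) (i : Fin 3) : GL (Fin 2) ℝ :=
  ⟨T.normal i, T.normal i, T.normal_mul_self i, T.normal_mul_self i⟩

theorem isLiftable_normalGL (T : RotationTriangle l m k) : T.coxeterMatrix.IsLiftable
    fun i => MulAction.toPermHom (GL (Fin 2) ℝ) ℍ (T.normalGL i) := fun i j => by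
  rw [← map_mul, ← map_pow]
  have h : (T.normalGL i * T.normalGL j) ^ T.coxeterMatrix i j = 1 ∨
      (T.normalGL i * T.normalGL j) ^ T.coxeterMatrix i j = -1 := by
    rcases T.normal_mul_normal_pow i j with h | h
    · left; exact Units.ext h
    · right; exact Units.ext h
  rcases h with h | h
  · exact (congrArg _ h).trans (map_one _)
  · refine (congrArg _ h).trans ?_
    ext1 z
    change (-1 : GL (Fin 2) ℝ) • z = z
    rw [UpperHalfPlane.neg_smul, one_smul]

/-- The action of the extended triangle group on `ℍ`. -/
def act (T : RotationTriangle l m k) : T.coxeterMatrix.Group →* Equiv.Perm ℍ :=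
  T.cs.lift ⟨fun i => MulAction.toPermHom (GL (Fin 2) ℝ) ℍ (T.normalGL i), T.isLiftable_normalGL⟩

theorem act_simple (T : RotationTriangle l m k) (i : Fin 3) :
    T.act (T.cs.simple i) = MulAction.toPermHom (GL (Fin 2) ℝ) ℍ (T.normalGL i) :=
  T.cs.lift_apply_simple T.isLiftable_normalGL i

theorem act_simple_mul_simple (T : RotationTriangle l m k) {i j : Fin 3} {g : SL(2, ℝ)}
    (h : T.normal i * T.normal j = -(g : Matrix (Fin 2) (Fin 2) ℝ)) :
    T.act (T.cs.simple i * T.cs.simple j) = moebius g := by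
  rw [map_mul, act_simple, act_simple, ← map_mul]
  have : T.normalGL i * T.normalGL j = -(g : GL (Fin 2) ℝ) := Units.ext h
  rw [this]
  ext1 z
  change (-(g : GL (Fin 2) ℝ)) • z = _
  rw [UpperHalfPlane.neg_smul]
  rfl

theorem act_one_two (T : RotationTriangle l m k) :
    T.act (T.cs.simple 1 * T.cs.simple 2) = T.u := by
  rw [T.act_simple_mul_simple T.normal_one_mul_normal_two, u, hypRotation_two_pi_div]

theorem act_two_zero (T : RotationTriangle l m k) :
    T.act (T.cs.simple 2 * T.cs.simple 0) = T.v := by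
  rw [T.act_simple_mul_simple T.normal_two_mul_normal_zero, v, hypRotation_two_pi_div]

theorem act_zero_one (T : RotationTriangle l m k) :
    T.act (T.cs.simple 0 * T.cs.simple 1) = T.w := by
  rw [T.act_simple_mul_simple T.normal_zero_mul_normal_one, w, hypRotation_two_pi_div]

/-- Intertwines the action on `ℍ` with the linear representation. A normal is traceless with square
1, so its adjugate is its negative and conjugation becomes `conjNeg`. -/
theorem rotGen_act (T : RotationTriangle l m k) (g : T.coxeterMatrix.Group) (z : ℍ) :
    rotGen (T.act g z) = T.rep g (rotGen z) := by
  induction g using T.cs.simple_induction_left generalizing z with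
  | one => simp
  | mul_simple_left g i ih =>
    rw [map_mul, map_mul, Equiv.Perm.mul_apply, Module.End.mul_apply, ← ih, act_simple,
      rep_simple, conjNeg_apply]
    have h := rotGen_smul (T.normalGL i) (T.act g z)
    have hdet : |(T.normalGL i).det.val| = 1 := by
      have h2 : (T.normalGL i).det.val * (T.normalGL i).det.val = 1 := by
        rw [← Units.val_mul, ← map_mul]
        have : T.normalGL i * T.normalGL i = 1 := Units.ext (T.normal_mul_self i)
        rw [this, map_one, Units.val_one]
      rcases mul_self_eq_one_iff.1 h2 with h3 | h3 <;> simp [h3]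
    rw [hdet, one_smul] at h
    change rotGen (T.normalGL i • T.act g z) = _
    rw [h]
    change T.normal i * _ * (T.normal i).adjugate = _
    rw [adjugate_eq_neg (T.normal_trace i), mul_neg]

theorem trace_rep_mul_rep (T : RotationTriangle l m k) (g : T.coxeterMatrix.Group)
    (X Y : Matrix (Fin 2) (Fin 2) ℝ) : (T.rep g X * T.rep g Y).trace = (X * Y).trace := by
  induction g using T.cs.simple_induction_left with
  | one => simp
  | mul_simple_left g i ih =>
    have h : ∀ A B : Matrix (Fin 2) (Fin 2) ℝ,
        T.normal i * A * T.normal i * (T.normal i * B * T.normal i) =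
          T.normal i * (A * B * T.normal i) := fun A B => by
      rw [mul_assoc (T.normal i * A), ← mul_assoc (T.normal i), ← mul_assoc (T.normal i),
        normal_mul_self, one_mul]
      simp only [mul_assoc]
    rw [map_mul, Module.End.mul_apply, Module.End.mul_apply, ← ih, rep_simple, conjNeg_apply,
      conjNeg_apply, neg_mul_neg, h, Matrix.trace_mul_comm, mul_assoc (_ * _), normal_mul_self,
      mul_one]

end RotationTriangle

/-! ### The chamber of the reflection group -/

theorem continuous_rotGen : Continuous rotGen := by
  have h1 : Continuous fun z : ℍ => z.im := UpperHalfPlane.continuous_im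
  have h2 : Continuous fun z : ℍ => z.re := UpperHalfPlane.continuous_re
  have h3 : ∀ z : ℍ, z.im ≠ 0 := fun z => z.im_ne_zero
  refine continuous_matrix fun i j => ?_
  fin_cases i <;> fin_cases j <;> simp only [rotGen] <;> simp <;> fun_prop (disch := exact h3 _)

theorem Metric.finite_of_le_dist_of_isCompact {ι X : Type*} [PseudoMetricSpace X] {f : ι → X}
    {ε : ℝ} (hε : 0 < ε) (hf : ∀ i j, i ≠ j → ε ≤ dist (f i) (f j)) {K : Set X}
    (hK : IsCompact K) : {i | f i ∈ K}.Finite := by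
  obtain ⟨t, ht, hKt⟩ := Metric.totallyBounded_iff.1 hK.totallyBounded (ε / 2) (by positivity)
  have h : ∀ i : {i | f i ∈ K}, ∃ y ∈ t, dist (f i) y < ε / 2 := fun i => by
    simpa using hKt i.2
  choose c hc hd using h
  have : Finite t := ht
  have hinj : Function.Injective fun i => (⟨c i, hc i⟩ : t) := fun i j hij => by
    by_contra hne
    have h1 := hf i j fun h => hne (Subtype.ext h)
    have h2 := dist_triangle_right (f i) (f j) (c i)
    have h3 := hd i
    have h4 := hd j
    rw [← show c i = c j from congrArg Subtype.val hij] at h4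
    linarith
  exact Set.finite_coe_iff.1 (Finite.of_injective _ hinj)

namespace RotationTriangle

variable {l m k : ℕ}

theorem trace_rotGen_act_mul (T : RotationTriangle l m k) (g : T.coxeterMatrix.Group) (z : ℍ)
    (X : Matrix (Fin 2) (Fin 2) ℝ) :
    (rotGen (T.act g z) * X).trace = (rotGen z * T.rep g⁻¹ X).trace := by
  rw [← T.trace_rep_mul_rep g (rotGen z), ← rotGen_act, ← Module.End.mul_apply, ← map_mul,
    mul_inv_cancel, map_one, Module.End.one_apply]

theorem dist_act (T : RotationTriangle l m k) (g : T.coxeterMatrix.Group) (z z' : ℍ) :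
    dist (T.act g z) (T.act g z') = dist z z' := by
  have h : (rotGen (T.act g z) * rotGen (T.act g z')).trace = (rotGen z * rotGen z').trace := by
    rw [rotGen_act, rotGen_act, trace_rep_mul_rep]
  rw [trace_rotGen_mul_rotGen, trace_rotGen_mul_rotGen] at h
  have h2 : Real.cosh (dist (T.act g z) (T.act g z')) = Real.cosh (dist z z') := by linarith
  have h3 := Real.cosh_le_cosh.1 h2.le
  have h4 := Real.cosh_le_cosh.1 h2.ge
  rw [abs_of_nonneg dist_nonneg, abs_of_nonneg dist_nonneg] at h3 h4
  exact le_antisymm h3 h4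

/-- The closed triangle. -/
def chamber (T : RotationTriangle l m k) : Set ℍ := {z | ∀ i, 0 ≤ (rotGen z * T.normal i).trace}

/-- The open triangle. -/
def openChamber (T : RotationTriangle l m k) : Set ℍ :=
  {z | ∀ i, 0 < (rotGen z * T.normal i).trace}

theorem continuous_trace_rotGen_mul (X : Matrix (Fin 2) (Fin 2) ℝ) :
    Continuous fun z => (rotGen z * X).trace :=
  (continuous_rotGen.matrix_mul continuous_const).matrix_trace

theorem isOpen_openChamber (T : RotationTriangle l m k) : IsOpen T.openChamber := by
  rw [openChamber, Set.ofPred_forall]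
  exact isOpen_iInter_of_finite fun i =>
    isOpen_lt continuous_const (continuous_trace_rotGen_mul _)

theorem isClosed_chamber (T : RotationTriangle l m k) : IsClosed T.chamber := by
  rw [chamber, Set.ofPred_forall]
  exact isClosed_iInter fun i => isClosed_le continuous_const (continuous_trace_rotGen_mul _)

/-- The vertices of the triangle. -/
def vertex (T : RotationTriangle l m k) : Fin 3 → ℍ := ![T.P, T.Q, T.R]

theorem trace_vertex_mul_normal_self_pos (T : RotationTriangle l m k) (i : Fin 3) :
    0 < (rotGen (T.vertex i) * T.normal i).trace := by
  fin_cases i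
  · exact T.rotate.trace_rotGen_R_mul_mirror_pos
  · exact T.rotate.rotate.trace_rotGen_R_mul_mirror_pos
  · exact T.trace_rotGen_R_mul_mirror_pos

theorem trace_vertex_mul_normal_of_ne (T : RotationTriangle l m k) {i j : Fin 3} (h : i ≠ j) :
    (rotGen (T.vertex i) * T.normal j).trace = 0 := by
  fin_cases i <;> fin_cases j <;> first | exact absurd rfl h | skip
  · exact T.rotate.rotate.trace_rotGen_Q_mul_mirror
  · exact T.trace_rotGen_P_mul_mirror
  · exact T.rotate.trace_rotGen_P_mul_mirror
  · exact T.trace_rotGen_Q_mul_mirror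
  · exact T.rotate.trace_rotGen_Q_mul_mirror
  · exact T.rotate.rotate.trace_rotGen_P_mul_mirror

/-- The normalised sum of the vertices is interior: each normal is orthogonal to two vertices and
positive on the third. -/
theorem openChamber_nonempty (T : RotationTriangle l m k) : T.openChamber.Nonempty := by
  obtain ⟨z, μ, hμ, hz⟩ := exists_smul_rotGen_eq_sum Finset.univ Finset.univ_nonempty T.vertex
  refine ⟨z, fun i => ?_⟩
  have h : 0 < μ * (rotGen z * T.normal i).trace := by
    rw [← smul_eq_mul, ← Matrix.trace_smul, ← Matrix.smul_mul, ← hz, Finset.sum_mul,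
      Matrix.trace_sum]
    rw [Finset.sum_eq_single i (fun j _ hj => T.trace_vertex_mul_normal_of_ne hj) (by simp)]
    exact T.trace_vertex_mul_normal_self_pos i
  exact pos_of_mul_pos_right h hμ.le

theorem openChamber_subset_chamber (T : RotationTriangle l m k) : T.openChamber ⊆ T.chamber :=
  fun _ hz i => (hz i).le

theorem coxeterMatrix_ne_zero (T : RotationTriangle l m k) (i j : Fin 3) :
    T.coxeterMatrix i j ≠ 0 := by
  have := T.two_le_l
  have := T.two_le_m
  have := T.two_le_k
  change (!![1, k, m; k, 1, l; m, l, 1] : Matrix (Fin 3) (Fin 3) ℕ) i j ≠ 0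
  fin_cases i <;> fin_cases j <;> simp <;> omega

theorem rep_simple_normal (T : RotationTriangle l m k) (i j : Fin 3) :
    T.rep (T.cs.simple i) (T.normal j) =
      T.normal j + (2 * Real.cos (Real.pi / T.coxeterMatrix i j)) • T.normal i := by
  have h := mul_add_mul_eq_trace_smul (T.normal_trace i) (T.normal_trace j)
  rw [trace_normal_mul_normal] at h
  rw [rep_simple, conjNeg_apply, eq_sub_of_add_eq h, sub_mul, mul_assoc (T.normal j),
    normal_mul_self, mul_one, Matrix.smul_mul, one_mul]
  module

/-- Tits' lemma for the functional `X ↦ tr (rotGen z * X)`, which is nonnegative on the simple roots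
exactly because `z` lies in the chamber. -/
theorem trace_act_inv_nonpos (T : RotationTriangle l m k) {z : ℍ} (hz : z ∈ T.chamber)
    {g : T.coxeterMatrix.Group} {i : Fin 3} (hg : T.cs.IsRightDescent g i) :
    (rotGen (T.act g⁻¹ z) * T.normal i).trace ≤ 0 := by
  rw [trace_rotGen_act_mul, inv_inv]
  exact T.cs.root_nonpos T.rep T.normal T.coxeterMatrix_ne_zero T.rep_simple_normal
    (Matrix.traceLinearMap (Fin 2) ℝ ℝ ∘ₗ LinearMap.mulLeft ℝ (rotGen z)) hz g i hg

/-- A nontrivial `g` has a descent `i` of `g⁻¹`, and then `g z` lies on the wrong side of wall `i`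
or on it. -/
theorem eq_one_of_act_mem_openChamber (T : RotationTriangle l m k) {z : ℍ} (hz : z ∈ T.chamber)
    {g : T.coxeterMatrix.Group} (hg : T.act g z ∈ T.openChamber) : g = 1 := by
  by_contra hne
  obtain ⟨i, hi⟩ := T.cs.exists_rightDescent_of_ne_one (inv_ne_one.2 hne)
  have := T.trace_act_inv_nonpos hz hi
  rw [inv_inv] at this
  exact absurd (hg i) this.not_gt

theorem act_injective (T : RotationTriangle l m k) : Function.Injective T.act := by
  rw [injective_iff_map_eq_one]
  intro g hg
  obtain ⟨z, hz⟩ := T.openChamber_nonempty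
  apply T.eq_one_of_act_mem_openChamber (T.openChamber_subset_chamber hz)
  rwa [hg]

/-- The orbit of an interior point is uniformly separated, since no nontrivial element returns it to
the open chamber. An element moving `K` to meet `L` keeps that point in a fixed compact ball. -/
theorem finite_act_inter_nonempty (T : RotationTriangle l m k) {K L : Set ℍ} (hK : IsCompact K)
    (hL : IsCompact L) : {g | (T.act g '' K ∩ L).Nonempty}.Finite := by
  obtain ⟨z, hz⟩ := T.openChamber_nonempty
  obtain ⟨ε, hε, hball⟩ := Metric.isOpen_iff.1 T.isOpen_openChamber z hz
  have hsep : ∀ g h : T.coxeterMatrix.Group, g ≠ h → ε ≤ dist (T.act g z) (T.act h z) := by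
    intro g h hgh
    by_contra! hlt
    have : T.act (h⁻¹ * g) z ∈ T.openChamber := by
      apply hball
      rw [Metric.mem_ball, ← T.dist_act h, ← Equiv.Perm.mul_apply, ← map_mul,
        mul_inv_cancel_left]
      exact hlt
    have := T.eq_one_of_act_mem_openChamber (T.openChamber_subset_chamber hz) this
    exact hgh (inv_mul_eq_one.1 this).symm
  obtain ⟨r, hr⟩ := hK.isBounded.subset_closedBall z
  obtain ⟨s, hs⟩ := hL.isBounded.subset_closedBall z
  refine (Metric.finite_of_le_dist_of_isCompact hε hsep
    (isCompact_closedBall z (r + s))).subset ?_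
  rintro g ⟨_, ⟨x, hx, rfl⟩, hgx⟩
  have h1 := hr hx
  have h2 := hs hgx
  rw [Metric.mem_closedBall] at h1 h2
  rw [Set.mem_ofPred_eq, Metric.mem_closedBall]
  have h3 := dist_triangle (T.act g z) (T.act g x) z
  rw [dist_act, dist_comm z] at h3
  linarith

theorem act_simple_eq_self (T : RotationTriangle l m k) {z : ℍ} {i : Fin 3}
    (h : (rotGen z * T.normal i).trace = 0) : T.act (T.cs.simple i) z = z := by
  apply rotGen_injective
  have h1 := mul_add_mul_eq_trace_smul (rotGen_trace z) (T.normal_trace i)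
  rw [h, zero_smul] at h1
  rw [rotGen_act, rep_simple, conjNeg_apply, eq_neg_of_add_eq_zero_right h1, neg_mul, neg_neg,
    mul_assoc, normal_mul_self, mul_one]

/-- Choose the translate of `z` nearest to an interior point. Were it beyond some wall, reflecting
in that wall would bring it nearer. -/
theorem exists_act_mem_chamber (T : RotationTriangle l m k) (z : ℍ) :
    ∃ g, T.act g z ∈ T.chamber := by
  obtain ⟨z₀, hz₀⟩ := T.openChamber_nonempty
  have hfin := T.finite_act_inter_nonempty (isCompact_singleton (x := z))
    (isCompact_closedBall z₀ (dist z z₀))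
  simp only [Set.image_singleton, Set.singleton_inter_nonempty, Metric.mem_closedBall] at hfin
  obtain ⟨g, hg, hmin⟩ := Set.exists_min_image _ (fun g => dist (T.act g z) z₀) hfin
    ⟨1, by simp⟩
  refine ⟨g, fun i => ?_⟩
  by_contra! hlt
  have hlt' : dist (T.act (T.cs.simple i * g) z) z₀ < dist (T.act g z) z₀ := by
    have h1 := mul_add_mul_eq_trace_smul (rotGen_trace (T.act g z)) (T.normal_trace i)
    have h2 : rotGen (T.act (T.cs.simple i * g) z) = rotGen (T.act g z) -
        (rotGen (T.act g z) * T.normal i).trace • T.normal i := by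
      rw [map_mul, Equiv.Perm.mul_apply, rotGen_act T (T.cs.simple i), rep_simple, conjNeg_apply,
        eq_sub_of_add_eq' h1, sub_mul, mul_assoc _ _ (T.normal i), normal_mul_self, mul_one,
        Matrix.smul_mul, one_mul]
      abel
    have h3 := trace_rotGen_mul_rotGen (T.act (T.cs.simple i * g) z) z₀
    rw [h2, sub_mul, Matrix.trace_sub, trace_rotGen_mul_rotGen, Matrix.smul_mul,
      Matrix.trace_smul, smul_eq_mul, Matrix.trace_mul_comm (T.normal i)] at h3
    have h4 : Real.cosh (dist (T.act (T.cs.simple i * g) z) z₀) <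
        Real.cosh (dist (T.act g z) z₀) := by
      nlinarith [hz₀ i]
    have h5 := Real.cosh_lt_cosh.1 h4
    rwa [abs_of_nonneg dist_nonneg, abs_of_nonneg dist_nonneg] at h5
  have := hmin (T.cs.simple i * g) (hlt'.le.trans hg)
  linarith

theorem normal_commutator (T : RotationTriangle l m k) {i j : Fin 3} {P : ℍ} {θ : ℝ}
    (h : T.normal i * T.normal j = -(rotMatrix P θ : Matrix (Fin 2) (Fin 2) ℝ)) :
    T.normal i * T.normal j - T.normal j * T.normal i = -(2 * Real.sin θ) • rotGen P := by
  have h1 := mul_add_mul_eq_trace_smul (T.normal_trace i) (T.normal_trace j)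
  rw [eq_sub_of_add_eq' h1, h, Matrix.trace_neg, trace_rotMatrix, coe_rotMatrix]
  module

/-- Barycentric coordinates: the vertices are, up to scale, the basis dual to the normals, so points
of the chamber are nonnegative combinations of vertices. -/
theorem smul_rotGen_eq (T : RotationTriangle l m k) (z : ℍ) :
    (Real.sin (Real.pi / l) * (rotGen T.P * T.normal 0).trace) • rotGen z =
      ((rotGen z * T.normal 0).trace * Real.sin (Real.pi / l)) • rotGen T.P +
      ((rotGen z * T.normal 1).trace * Real.sin (Real.pi / m)) • rotGen T.Q +
      ((rotGen z * T.normal 2).trace * Real.sin (Real.pi / k)) • rotGen T.R := by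
  have h := trace_triple_smul (rotGen_trace z) (T.normal_trace 0) (T.normal_trace 1)
    (T.normal_trace 2)
  rw [T.normal_commutator T.normal_one_mul_normal_two,
    T.normal_commutator T.normal_two_mul_normal_zero,
    T.normal_commutator T.normal_zero_mul_normal_one, Matrix.mul_smul, Matrix.trace_smul,
    Matrix.trace_mul_comm, smul_eq_mul] at h
  have h2 : ∀ A B : Matrix (Fin 2) (Fin 2) ℝ, (-2 : ℝ) • A = (-2 : ℝ) • B → A = B :=
    fun A B hAB => smul_right_injective _ (by norm_num : (-2 : ℝ) ≠ 0) hAB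
  apply h2
  have h3 : (-2 : ℝ) • ((Real.sin (Real.pi / l) * (rotGen T.P * T.normal 0).trace) • rotGen z) =
      (-(2 * Real.sin (Real.pi / l)) * (rotGen T.P * T.normal 0).trace) • rotGen z := by
    module
  rw [h3, h]
  module

/-- Write `rotGen z` as `a, b, c ≥ 0` times the vertices. Pairing with a vertex gives `a ≤ cosh
(dist P z)`, and pairing with `z` itself gives `a * cosh (dist P z) ≤ 1`, so `a ≤ 1`; likewise for
`b`, `c`. Hence the distance from `z` to `P` is bounded. -/
theorem isCompact_chamber (T : RotationTriangle l m k) : IsCompact T.chamber := by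
  refine Metric.isCompact_of_isClosed_isBounded T.isClosed_chamber ?_
  rw [Metric.isBounded_iff_subset_closedBall T.P]
  refine ⟨Real.cosh (dist T.P T.P) + Real.cosh (dist T.Q T.P) + Real.cosh (dist T.R T.P),
    fun z hz => ?_⟩
  have s1 := T.sin_pos
  have s2 := T.rotate.sin_pos
  have s3 := T.rotate.rotate.sin_pos
  have hp : 0 < (rotGen T.P * T.normal 0).trace := T.trace_vertex_mul_normal_self_pos 0
  obtain ⟨a, b, c, ha, hb, hc, habc⟩ : ∃ a b c : ℝ, 0 ≤ a ∧ 0 ≤ b ∧ 0 ≤ c ∧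
      rotGen z = a • rotGen T.P + b • rotGen T.Q + c • rotGen T.R := by
    have h := congrArg
      (fun X => (Real.sin (Real.pi / l) * (rotGen T.P * T.normal 0).trace)⁻¹ • X)
      (T.smul_rotGen_eq z)
    simp only [smul_add, smul_smul] at h
    rw [inv_mul_cancel₀ (by positivity), one_smul] at h
    have h0 := hz 0
    have h1 := hz 1
    have h2 := hz 2
    exact ⟨_, _, _, by positivity, by positivity, by positivity, h⟩
  have htr : ∀ w, Real.cosh (dist z w) = a * Real.cosh (dist T.P w) + b * Real.cosh (dist T.Q w) +
      c * Real.cosh (dist T.R w) := fun w => by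
    have h := trace_rotGen_mul_rotGen z w
    rw [habc, add_mul, add_mul, Matrix.trace_add, Matrix.trace_add, Matrix.smul_mul,
      Matrix.smul_mul, Matrix.smul_mul, Matrix.trace_smul, Matrix.trace_smul, Matrix.trace_smul,
      trace_rotGen_mul_rotGen, trace_rotGen_mul_rotGen, trace_rotGen_mul_rotGen] at h
    simp only [smul_eq_mul] at h
    linarith
  have hz1 := htr z
  rw [dist_self, Real.cosh_zero] at hz1
  have hP1 := htr T.P
  have hQ1 := htr T.Q
  have hR1 := htr T.R
  rw [dist_comm z] at hP1 hQ1 hR1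
  simp only [dist_self, Real.cosh_zero] at hP1 hQ1 hR1
  have key : ∀ w w' w'' : ℍ, 0 ≤ b * Real.cosh (dist w w') ∧ 0 ≤ c * Real.cosh (dist w w'') :=
    fun w w' w'' => ⟨mul_nonneg hb (Real.cosh_pos _).le, mul_nonneg hc (Real.cosh_pos _).le⟩
  have key' : ∀ w w' : ℍ, 0 ≤ a * Real.cosh (dist w w') :=
    fun w w' => mul_nonneg ha (Real.cosh_pos _).le
  have ha1 : a ≤ 1 := by
    have : a ≤ Real.cosh (dist T.P z) := by
      have := key T.Q T.P T.P
      have := key T.R T.P T.P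
      linarith
    have := mul_le_mul_of_nonneg_left this ha
    have := key T.Q z z
    have := key T.R z z
    nlinarith
  have hb1 : b ≤ 1 := by
    have : b ≤ Real.cosh (dist T.Q z) := by
      have := key' T.P T.Q
      have := key T.R T.Q T.Q
      linarith
    have := mul_le_mul_of_nonneg_left this hb
    have := key' T.P z
    have := key T.R z z
    nlinarith
  have hc1 : c ≤ 1 := by
    have : c ≤ Real.cosh (dist T.R z) := by
      have := key' T.P T.R
      have := key T.Q T.R T.R
      linarith
    have := mul_le_mul_of_nonneg_left this hc
    have := key' T.P z
    have := key T.Q z z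
    nlinarith
  rw [Metric.mem_closedBall]
  calc dist z T.P ≤ Real.sinh (dist z T.P) := Real.self_le_sinh_iff.2 dist_nonneg
    _ ≤ Real.cosh (dist z T.P) := (Real.sinh_lt_cosh _).le
    _ ≤ _ := by
      rw [htr]
      have e1 := mul_le_mul_of_nonneg_right ha1 (Real.cosh_pos (dist T.P T.P)).le
      have e2 := mul_le_mul_of_nonneg_right hb1 (Real.cosh_pos (dist T.Q T.P)).le
      have e3 := mul_le_mul_of_nonneg_right hc1 (Real.cosh_pos (dist T.R T.P)).le
      linarith

theorem exists_trace_ne_zero (T : RotationTriangle l m k) (z : ℍ) :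
    ∃ i, (rotGen z * T.normal i).trace ≠ 0 := by
  by_contra! h
  have h1 := T.smul_rotGen_eq z
  rw [h 0, h 1, h 2] at h1
  simp only [zero_mul, zero_smul, add_zero] at h1
  have h2 := congrFun (congrFun h1 1) 0
  have := T.sin_pos.ne'
  have : (rotGen T.P * T.normal 0).trace ≠ 0 := (T.trace_vertex_mul_normal_self_pos 0).ne'
  have := (rotGen_one_zero_neg z).ne
  simp_all

/-- For a descent `i` of `g`, the point `g⁻¹ z = z` is on the nonpositive side of wall `i` as well
as in the chamber, so it lies on that wall. Remove the reflection and induct on length. -/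
theorem mem_closure_of_act_eq_self (T : RotationTriangle l m k) {z : ℍ} (hz : z ∈ T.chamber)
    (g : T.coxeterMatrix.Group) (hg : T.act g z = z) :
    g ∈ Subgroup.closure {s | ∃ i, (rotGen z * T.normal i).trace = 0 ∧ s = T.cs.simple i} := by
  induction hn : T.cs.length g using Nat.strong_induction_on generalizing g with
  | _ n ih =>
    by_cases h1 : g = 1
    · rw [h1]
      exact one_mem _
    obtain ⟨i, hi⟩ := T.cs.exists_rightDescent_of_ne_one h1
    have hle := T.trace_act_inv_nonpos hz hi
    have hinv : T.act g⁻¹ z = z := by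
      rw [map_inv, Equiv.Perm.inv_eq_iff_eq, hg]
    rw [hinv] at hle
    have h0 : (rotGen z * T.normal i).trace = 0 := le_antisymm hle (hz i)
    have hfix : T.act (g * T.cs.simple i) z = z := by
      rw [map_mul, Equiv.Perm.mul_apply, T.act_simple_eq_self h0, hg]
    have hmem := ih _ (hn ▸ hi) _ hfix rfl
    have := mul_mem hmem (Subgroup.subset_closure ⟨i, h0, rfl⟩)
    rwa [T.cs.simple_mul_simple_cancel_right] at this

/-- An element of finite order has a fixed point. -/
theorem exists_act_eq_self (T : RotationTriangle l m k) {g : T.coxeterMatrix.Group}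
    (hg : IsOfFinOrder g) : ∃ z, T.act g z = z := by
  have hN := hg.orderOf_pos
  -- Centre of mass of a finite orbit: `g` permutes the summands, hence fixes the sum and the point
  -- of `ℍ` on its ray.
  obtain ⟨z, μ, hμ, hz⟩ := exists_smul_rotGen_eq_sum (Finset.range (orderOf g))
    (Finset.nonempty_range_iff.2 hN.ne') fun j => T.act (g ^ j) T.P
  refine ⟨z, smul_rotGen_injective hμ hμ ?_⟩
  rw [← hz, rotGen_act, ← map_smul, ← hz, map_sum]
  have h : ∀ j, T.rep g (rotGen (T.act (g ^ j) T.P)) = rotGen (T.act (g ^ (j + 1)) T.P) := by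
    intro j
    rw [← rotGen_act, pow_succ', map_mul, Equiv.Perm.mul_apply]
  simp only [h]
  have h1 := Finset.sum_range_succ (fun j => rotGen (T.act (g ^ j) T.P)) (orderOf g)
  have h2 := Finset.sum_range_succ' (fun j => rotGen (T.act (g ^ j) T.P)) (orderOf g)
  rw [pow_orderOf_eq_one] at h1
  rw [pow_zero] at h2
  exact add_right_cancel (h2.symm.trans h1)

end RotationTriangle

/-! ### The triangle group: presentation, torsion, proper discontinuity -/

theorem exists_zpow_of_mem_closure_pair {G : Type*} [Group G] {s t : G} (hs : s * s = 1)
    (ht : t * t = 1) {g : G} (hg : g ∈ Subgroup.closure {s, t}) :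
    ∃ n : ℤ, g = (s * t) ^ n ∨ g = (s * t) ^ n * s := by
  have hsi : s⁻¹ = s := inv_eq_of_mul_eq_one_left hs
  have hti : t⁻¹ = t := inv_eq_of_mul_eq_one_left ht
  have hsc : ∀ n : ℤ, s * (s * t) ^ n = (s * t) ^ (-n) * s := fun n => by
    have h1 : s * (s * t) * s⁻¹ = (s * t)⁻¹ := by
      rw [mul_inv_rev, hti, hsi, ← mul_assoc, hs, one_mul]
    have h2 : s * (s * t) ^ n * s⁻¹ = ((s * t)⁻¹) ^ n := by rw [← h1, conj_zpow]
    rw [inv_zpow'] at h2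
    rw [← h2]
    group
  have htc : ∀ n : ℤ, t * (s * t) ^ n = (s * t) ^ (-(n + 1)) * s := fun n => by
    rw [← hsc, add_comm n 1, zpow_add, zpow_one, ← mul_assoc, ← mul_assoc, hs, one_mul]
  have hstep : ∀ x : G, x = s ∨ x = t → ∀ y : G, (∃ n : ℤ, y = (s * t) ^ n ∨ y = (s * t) ^ n * s) →
      ∃ n : ℤ, x * y = (s * t) ^ n ∨ x * y = (s * t) ^ n * s := by
    rintro x (rfl | rfl) y ⟨n, rfl | rfl⟩
    · exact ⟨-n, Or.inr (hsc n)⟩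
    · exact ⟨-n, Or.inl (by rw [← mul_assoc, hsc, mul_assoc, hs, mul_one])⟩
    · exact ⟨-(n + 1), Or.inr (htc n)⟩
    · exact ⟨-(n + 1), Or.inl (by rw [← mul_assoc, htc, mul_assoc, hs, mul_one])⟩
  induction hg using Subgroup.closure_induction_left with
  | one => exact ⟨0, Or.inl (zpow_zero _).symm⟩
  | mul_left x hx y _ ih => exact hstep x hx y ih
  | inv_mul_cancel x hx y _ ih =>
    apply hstep x⁻¹ _ y ih
    rcases hx with rfl | rfl
    · exact Or.inl hsi
    · exact Or.inr hti

namespace RotationTriangle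

variable {l m k : ℕ}

/-- The triangle group. -/
abbrev group (T : RotationTriangle l m k) : Subgroup (Equiv.Perm ℍ) := triangleGroup T.u T.v T.w

theorem u_mem (T : RotationTriangle l m k) : T.u ∈ T.group := Subgroup.subset_closure (by simp)

theorem v_mem (T : RotationTriangle l m k) : T.v ∈ T.group := Subgroup.subset_closure (by simp)

theorem w_mem (T : RotationTriangle l m k) : T.w ∈ T.group := Subgroup.subset_closure (by simp)

/-- The rotation subgroup of the Coxeter group. -/
def even (T : RotationTriangle l m k) : Subgroup T.coxeterMatrix.Group :=
  Subgroup.closure {T.cs.simple 1 * T.cs.simple 2, T.cs.simple 2 * T.cs.simple 0,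
    T.cs.simple 0 * T.cs.simple 1}

theorem map_even (T : RotationTriangle l m k) : T.even.map T.act = T.group := by
  rw [even, MonoidHom.map_closure, group, triangleGroup, Set.image_insert_eq, Set.image_pair,
    act_one_two, act_two_zero, act_zero_one]

theorem simple_mul_simple_mem_even (T : RotationTriangle l m k) (i j : Fin 3) :
    T.cs.simple i * T.cs.simple j ∈ T.even := by
  have h : ∀ i j, T.cs.simple i * T.cs.simple j ∈ T.even →
      T.cs.simple j * T.cs.simple i ∈ T.even := fun i j h => by
    have := inv_mem h
    rwa [mul_inv_rev, CoxeterSystem.inv_simple, CoxeterSystem.inv_simple] at this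
  have h12 : T.cs.simple 1 * T.cs.simple 2 ∈ T.even := Subgroup.subset_closure (by simp)
  have h20 : T.cs.simple 2 * T.cs.simple 0 ∈ T.even := Subgroup.subset_closure (by simp)
  have h01 : T.cs.simple 0 * T.cs.simple 1 ∈ T.even := Subgroup.subset_closure (by simp)
  by_cases hij : i = j
  · rw [hij, CoxeterSystem.simple_mul_simple_self]
    exact one_mem _
  · fin_cases i <;> fin_cases j <;> first | exact absurd rfl hij | skip
    · exact h01
    · exact h _ _ h20
    · exact h _ _ h01
    · exact h12
    · exact h20
    · exact h _ _ h12

theorem mem_even_or (T : RotationTriangle l m k) (g : T.coxeterMatrix.Group) :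
    g ∈ T.even ∨ T.cs.simple 2 * g ∈ T.even := by
  induction g using T.cs.simple_induction_left with
  | one => exact Or.inl (one_mem _)
  | mul_simple_left g i ih =>
    rcases ih with ih | ih
    · right
      rw [← mul_assoc]
      exact mul_mem (T.simple_mul_simple_mem_even 2 i) ih
    · left
      have := mul_mem (T.simple_mul_simple_mem_even i 2) ih
      rwa [mul_assoc, T.cs.simple_mul_simple_cancel_left] at this

theorem lengthParity_even (T : RotationTriangle l m k) {g : T.coxeterMatrix.Group}
    (hg : g ∈ T.even) : T.cs.lengthParity g = 1 := by
  have h : T.even ≤ T.cs.lengthParity.ker := by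
    rw [even, Subgroup.closure_le]
    rintro x (rfl | rfl | rfl) <;>
      simp only [SetLike.mem_coe, MonoidHom.mem_ker, map_mul, CoxeterSystem.lengthParity_simple] <;>
      rfl
  exact h hg

theorem exists_act_eq (T : RotationTriangle l m k) {g : Equiv.Perm ℍ} (hg : g ∈ T.group) :
    ∃ ω ∈ T.even, T.act ω = g := by
  rw [← map_even] at hg
  exact hg

theorem act_mem (T : RotationTriangle l m k) {ω : T.coxeterMatrix.Group} (hω : ω ∈ T.even) :
    T.act ω ∈ T.group := by
  rw [← map_even]
  exact Subgroup.mem_map_of_mem _ hω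

/-- Lift of elements of the triangle group to the Coxeter group. -/
def toCoxeter (T : RotationTriangle l m k) : T.group →* T.coxeterMatrix.Group :=
  (MonoidHom.ofInjective T.act_injective).symm.toMonoidHom.comp
    (Subgroup.inclusion (by rw [← map_even]; exact Subgroup.map_le_range _ _))

theorem act_toCoxeter (T : RotationTriangle l m k) (g : T.group) : T.act (T.toCoxeter g) = g :=
  congrArg Subtype.val ((MonoidHom.ofInjective T.act_injective).apply_symm_apply _)

theorem toCoxeter_eq (T : RotationTriangle l m k) {g : T.group} {ω : T.coxeterMatrix.Group}
    (h : T.act ω = g) : T.toCoxeter g = ω :=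
  T.act_injective ((T.act_toCoxeter g).trans h.symm)

theorem toCoxeter_mem_even (T : RotationTriangle l m k) (g : T.group) :
    T.toCoxeter g ∈ T.even := by
  obtain ⟨ω, hω, h⟩ := T.exists_act_eq g.2
  rwa [T.toCoxeter_eq h]

/-! ### The von Dyck presentation of the rotation subgroup -/

section VonDyck

variable {G : Type*} [Group G]

/-- The images of the reflections in the wreath product of `G` with the swap of two factors. -/
def swapReflection (x y : G) : Fin 3 → (G × G) ⋊[MonoidHom.id (MulAut (G × G))] MulAut (G × G) :=
  ![⟨(y⁻¹, y), MulEquiv.prodComm⟩, ⟨(x, x⁻¹), MulEquiv.prodComm⟩, ⟨1, MulEquiv.prodComm⟩]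

theorem swapReflection_mul (p q : G × G) :
    (⟨p, MulEquiv.prodComm⟩ * ⟨q, MulEquiv.prodComm⟩ :
      (G × G) ⋊[MonoidHom.id (MulAut (G × G))] MulAut (G × G)) =
      SemidirectProduct.inl (p.1 * q.2, p.2 * q.1) := by
  ext <;> rfl

/-- A homomorphism on the rotation subgroup need not extend to the Coxeter group with values in `G`,
since inverting `x` and `y` may not be an automorphism. It does extend into `G ≀ C₂`: the third
reflection goes to the swap, and `u`, `v` go to `(x, x⁻¹)`, `(y, y⁻¹)`. -/
theorem isLiftable_swapReflection (T : RotationTriangle l m k) {x y z : G} (h : x * y * z = 1)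
    (hx : x ^ l = 1) (hy : y ^ m = 1) (hz : z ^ k = 1) :
    T.coxeterMatrix.IsLiftable (swapReflection x y) := by
  have hxy : (x * y) ^ k = 1 := by rw [← inv_inv (x * y), inv_pow, inv_eq_of_mul_eq_one_right h, hz, inv_one]
  have hyx : (y * x) ^ k = 1 := by
    have : y * x = x⁻¹ * (x * y) * x⁻¹⁻¹ := by group
    rw [this, conj_pow, hxy]
    group
  have hinl : ∀ (a b : G) (n : ℕ), a ^ n = 1 → b ^ n = 1 →
      (SemidirectProduct.inl (φ := MonoidHom.id (MulAut (G × G))) (a, b)) ^ n = 1 := by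
    intro a b n ha hb
    rw [← map_pow, Prod.pow_mk, ha, hb]
    exact map_one _
  intro i j
  change (swapReflection x y i * swapReflection x y j) ^
    ((!![1, k, m; k, 1, l; m, l, 1] : Matrix (Fin 3) (Fin 3) ℕ) i j) = 1
  fin_cases i <;> fin_cases j <;>
    simp only [swapReflection, Fin.zero_eta, Fin.mk_one, Fin.reduceFinMk, Fin.isValue,
      Matrix.cons_val_zero, Matrix.cons_val_one, Matrix.cons_val, Matrix.of_apply,
      Matrix.cons_val', Matrix.cons_val_fin_one, swapReflection_mul] <;>
    apply hinl <;> try simp [hx, hy]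
  · rw [← mul_inv_rev, inv_pow, hxy, inv_one]
  · exact hyx
  · exact hxy
  · rw [← mul_inv_rev, inv_pow, hyx, inv_one]

/-- The triangle group has the presentation `⟨u, v, w | u^l = v^m = w^k = uvw = 1⟩`. -/
theorem exists_hom (T : RotationTriangle l m k) {x y z : G} (h : x * y * z = 1)
    (hx : x ^ l = 1) (hy : y ^ m = 1) (hz : z ^ k = 1) :
    ∃ f : T.group →* G, (∀ g : T.group, (g : Equiv.Perm ℍ) = T.u → f g = x) ∧
      (∀ g : T.group, (g : Equiv.Perm ℍ) = T.v → f g = y) ∧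
      ∀ g : T.group, (g : Equiv.Perm ℍ) = T.w → f g = z := by
  have hl := T.isLiftable_swapReflection h hx hy hz
  set θ := T.cs.lift ⟨_, hl⟩ with hθ
  have hs : ∀ i, θ (T.cs.simple i) = swapReflection x y i := T.cs.lift_apply_simple hl
  have h12 : θ (T.cs.simple 1 * T.cs.simple 2) = SemidirectProduct.inl (x, x⁻¹) := by
    rw [map_mul, hs, hs]
    exact (swapReflection_mul _ _).trans (by simp)
  have h20 : θ (T.cs.simple 2 * T.cs.simple 0) = SemidirectProduct.inl (y, y⁻¹) := by
    rw [map_mul, hs, hs]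
    exact (swapReflection_mul _ _).trans (by simp)
  have h01 : θ (T.cs.simple 0 * T.cs.simple 1) = SemidirectProduct.inl (z, y * x) := by
    rw [map_mul, hs, hs]
    refine (swapReflection_mul _ _).trans ?_
    rw [← inv_eq_of_mul_eq_one_right h, mul_inv_rev]
  have hright : T.even ≤ (SemidirectProduct.rightHom.comp θ).ker := by
    rw [even, Subgroup.closure_le]
    rintro g (rfl | rfl | rfl) <;> rw [SetLike.mem_coe, MonoidHom.mem_ker, MonoidHom.comp_apply]
    · rw [h12, SemidirectProduct.rightHom_inl]
    · rw [h20, SemidirectProduct.rightHom_inl]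
    · rw [h01, SemidirectProduct.rightHom_inl]
  -- Rotations have trivial swap component, so the first coordinate is multiplicative on them.
  refine ⟨MonoidHom.mk' (fun g => (θ (T.toCoxeter g)).left.1) fun a b => ?_, ?_, ?_, ?_⟩
  · have ha : (θ (T.toCoxeter a)).right = 1 := hright (T.toCoxeter_mem_even a)
    rw [map_mul, map_mul, SemidirectProduct.mul_left, ha, map_one]
    rfl
  · intro g hg
    rw [MonoidHom.mk'_apply, T.toCoxeter_eq (T.act_one_two.trans hg.symm), h12]
    rfl
  · intro g hg
    rw [MonoidHom.mk'_apply, T.toCoxeter_eq (T.act_two_zero.trans hg.symm), h20]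
    rfl
  · intro g hg
    rw [MonoidHom.mk'_apply, T.toCoxeter_eq (T.act_zero_one.trans hg.symm), h01]
    rfl

end VonDyck

theorem finite_image_inter_nonempty (T : RotationTriangle l m k) {K L : Set ℍ} (hK : IsCompact K)
    (hL : IsCompact L) : {g : T.group | ((g : Equiv.Perm ℍ) '' K ∩ L).Nonempty}.Finite := by
  have h := (T.finite_act_inter_nonempty hK hL).preimage
    (f := T.toCoxeter) (Function.Injective.injOn fun a b hab =>
      Subtype.ext (by rw [← act_toCoxeter, ← act_toCoxeter, hab]))
  refine h.subset fun g hg => ?_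
  rw [Set.mem_preimage, Set.mem_ofPred_eq, act_toCoxeter]
  exact hg

/-- The chamber and its mirror image in one side together meet every orbit of the rotation subgroup.
-/
theorem exists_isCompact (T : RotationTriangle l m k) :
    ∃ C : Set ℍ, IsCompact C ∧ ∀ z, ∃ g ∈ T.group, g z ∈ C := by
  have hcont : Continuous (T.act (T.cs.simple 2)) :=
    (Isometry.of_dist_eq (T.dist_act _)).continuous
  refine ⟨T.chamber ∪ T.act (T.cs.simple 2) '' T.chamber,
    T.isCompact_chamber.union (T.isCompact_chamber.image hcont), fun z => ?_⟩
  obtain ⟨g, hg⟩ := T.exists_act_mem_chamber z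
  rcases T.mem_even_or g with h | h
  · exact ⟨_, T.act_mem h, Or.inl hg⟩
  · refine ⟨_, T.act_mem h, Or.inr ⟨_, hg, ?_⟩⟩
    rw [map_mul, Equiv.Perm.mul_apply]

theorem group_le_autH (T : RotationTriangle l m k) : T.group ≤ autH := by
  rw [group, triangleGroup, Subgroup.closure_le]
  rintro g (rfl | rfl | rfl) <;> exact ⟨_, rfl⟩

/-- No point lies on all three walls, so the stabiliser lies in the dihedral group of two
reflections, and even length leaves only its rotations. -/
theorem mem_zpowers_of_act_eq_self (T : RotationTriangle l m k) {z : ℍ} (hz : z ∈ T.chamber)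
    {g : T.coxeterMatrix.Group} (hg : T.act g z = z) (hp : T.cs.lengthParity g = 1) :
    ∃ n : ℤ, g = (T.cs.simple 1 * T.cs.simple 2) ^ n ∨ g = (T.cs.simple 2 * T.cs.simple 0) ^ n ∨
      g = (T.cs.simple 0 * T.cs.simple 1) ^ n := by
  obtain ⟨i, hi⟩ := T.exists_trace_ne_zero z
  have hmem := T.mem_closure_of_act_eq_self hz g hg
  have hpair : ∀ a b : Fin 3, (∀ j, j ≠ i → j = a ∨ j = b) →
      ∃ n : ℤ, g = (T.cs.simple a * T.cs.simple b) ^ n := by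
    intro a b hab
    have hmem' : g ∈ Subgroup.closure {T.cs.simple a, T.cs.simple b} := by
      refine Subgroup.closure_mono ?_ hmem
      rintro _ ⟨j, hj, rfl⟩
      rcases hab j (fun h => hi (h ▸ hj)) with rfl | rfl <;> simp
    obtain ⟨n, hn | hn⟩ := exists_zpow_of_mem_closure_pair (T.cs.simple_mul_simple_self a)
      (T.cs.simple_mul_simple_self b) hmem'
    · exact ⟨n, hn⟩
    · exfalso
      rw [hn, map_mul, map_zpow, map_mul, CoxeterSystem.lengthParity_simple,
        CoxeterSystem.lengthParity_simple] at hp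
      have h1 : (Multiplicative.ofAdd (1 : ZMod 2) * Multiplicative.ofAdd (1 : ZMod 2)) = 1 := rfl
      rw [h1, one_zpow, one_mul] at hp
      exact absurd hp (by decide)
  fin_cases i
  · obtain ⟨n, hn⟩ := hpair 1 2 (by decide)
    exact ⟨n, Or.inl hn⟩
  · obtain ⟨n, hn⟩ := hpair 2 0 (by decide)
    exact ⟨n, Or.inr (Or.inl hn)⟩
  · obtain ⟨n, hn⟩ := hpair 0 1 (by decide)
    exact ⟨n, Or.inr (Or.inr hn)⟩

/-- An element of finite order of the triangle group is conjugate to a power of a canonical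
generator. -/
theorem exists_conj_of_isOfFinOrder (T : RotationTriangle l m k) {g : Equiv.Perm ℍ}
    (hg : g ∈ T.group) (hfin : IsOfFinOrder g) :
    ∃ h ∈ T.group, ∃ n : ℤ, g = h * T.u ^ n * h⁻¹ ∨ g = h * T.v ^ n * h⁻¹ ∨
      g = h * T.w ^ n * h⁻¹ := by
  obtain ⟨ω, hω, rfl⟩ := T.exists_act_eq hg
  obtain ⟨z, hz⟩ := T.exists_act_eq_self ((T.act_injective.isOfFinOrder_iff).1 hfin)
  obtain ⟨c, hc⟩ := T.exists_act_mem_chamber z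
  have hfix : T.act (c * ω * c⁻¹) (T.act c z) = T.act c z := by
    rw [← Equiv.Perm.mul_apply, ← map_mul, inv_mul_cancel_right, map_mul, Equiv.Perm.mul_apply, hz]
  have hpar : T.cs.lengthParity (c * ω * c⁻¹) = 1 := by
    rw [map_mul, map_mul, T.lengthParity_even hω, mul_one, ← map_mul, mul_inv_cancel, map_one]
  obtain ⟨n, hn⟩ := T.mem_zpowers_of_act_eq_self hc hfix hpar
  rcases T.mem_even_or c with hce | hce
  · refine ⟨T.act c⁻¹, T.act_mem (inv_mem hce), n, ?_⟩
    rw [← act_one_two, ← act_two_zero, ← act_zero_one]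
    simp only [← map_zpow, ← map_inv, ← map_mul]
    have hback : ∀ x, c * ω * c⁻¹ = x → ω = c⁻¹ * x * c⁻¹⁻¹ := by
      rintro x rfl
      group
    rcases hn with hn | hn | hn
    · exact Or.inl (congrArg _ (hback _ hn))
    · exact Or.inr (Or.inl (congrArg _ (hback _ hn)))
    · exact Or.inr (Or.inr (congrArg _ (hback _ hn)))
  -- When the conjugator `c` is orientation-reversing, use `s₂ c` instead: conjugation by `s₂` sends
  -- each canonical generator to a conjugate of its inverse.
  · have hsi := T.cs.inv_simple 2
    have hback : ∀ x y : T.coxeterMatrix.Group, ∀ e : T.coxeterMatrix.Group,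
        T.cs.simple 2 * x * T.cs.simple 2 = e * y⁻¹ * e⁻¹ → c * ω * c⁻¹ = x ^ n →
        ω = ((T.cs.simple 2 * c)⁻¹ * e) * y ^ (-n) * ((T.cs.simple 2 * c)⁻¹ * e)⁻¹ := by
      intro x y e hxy hx
      have h1 : T.cs.simple 2 * x ^ n * (T.cs.simple 2)⁻¹ = e * y ^ (-n) * e⁻¹ := by
        rw [← conj_zpow, hsi, hxy, conj_zpow, inv_zpow']
      have h2 : ω = (T.cs.simple 2 * c)⁻¹ * (T.cs.simple 2 * x ^ n * (T.cs.simple 2)⁻¹) *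
          (T.cs.simple 2 * c) := by
        rw [← hx]
        group
      rw [h2, h1]
      group
    have hcancel := T.cs.simple_mul_simple_self
    have hcancel' : ∀ i x, T.cs.simple i * (T.cs.simple i * x) = x :=
      fun i _ => T.cs.simple_mul_simple_cancel_left i
    have hinv := T.cs.inv_simple
    have e1 : T.cs.simple 2 * (T.cs.simple 1 * T.cs.simple 2) * T.cs.simple 2 =
        1 * (T.cs.simple 1 * T.cs.simple 2)⁻¹ * 1⁻¹ := by
      simp only [mul_assoc, mul_inv_rev, hinv, hcancel, inv_one, one_mul, mul_one]
    have e2 : T.cs.simple 2 * (T.cs.simple 2 * T.cs.simple 0) * T.cs.simple 2 =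
        1 * (T.cs.simple 2 * T.cs.simple 0)⁻¹ * 1⁻¹ := by
      simp only [mul_inv_rev, hinv, hcancel', inv_one, one_mul, mul_one]
    have e3 : T.cs.simple 2 * (T.cs.simple 0 * T.cs.simple 1) * T.cs.simple 2 =
        (T.cs.simple 2 * T.cs.simple 1) * (T.cs.simple 0 * T.cs.simple 1)⁻¹ *
          (T.cs.simple 2 * T.cs.simple 1)⁻¹ := by
      simp only [mul_assoc, mul_inv_rev, hinv, hcancel']
    rcases hn with hn | hn | hn
    · refine ⟨T.act ((T.cs.simple 2 * c)⁻¹ * 1), T.act_mem (mul_mem (inv_mem hce) (one_mem _)), -n,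
        Or.inl ?_⟩
      rw [← act_one_two, ← map_zpow, ← map_inv, ← map_mul, ← map_mul]
      exact congrArg _ (hback _ _ _ e1 hn)
    · refine ⟨T.act ((T.cs.simple 2 * c)⁻¹ * 1), T.act_mem (mul_mem (inv_mem hce) (one_mem _)), -n,
        Or.inr (Or.inl ?_)⟩
      rw [← act_two_zero, ← map_zpow, ← map_inv, ← map_mul, ← map_mul]
      exact congrArg _ (hback _ _ _ e2 hn)
    · refine ⟨T.act ((T.cs.simple 2 * c)⁻¹ * (T.cs.simple 2 * T.cs.simple 1)),
        T.act_mem (mul_mem (inv_mem hce) (T.simple_mul_simple_mem_even 2 1)), -n,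
        Or.inr (Or.inr ?_)⟩
      rw [← act_zero_one, ← map_zpow, ← map_inv, ← map_mul, ← map_mul]
      exact congrArg _ (hback _ _ _ e3 hn)

end RotationTriangle

/-! ### Torsion-free subgroups of finite index and regular hypermaps -/

namespace RotationTriangle

variable {l m k : ℕ}

/-- An element with a fixed point has all its powers in a finite set, hence has finite order, so
torsion-freeness gives freeness. Finite index gives cocompactness. -/
theorem isSurfaceGroup (T : RotationTriangle l m k) {K : Subgroup (Equiv.Perm ℍ)}
    (hK : K ≤ T.group) (htf : IsTorsionFreeSubgroup K) (hfin : K.relIndex T.group ≠ 0) :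
    IsSurfaceGroup K := by
  refine ⟨hK.trans T.group_le_autH, ?_, ⟨?_⟩, ?_⟩
  · intro g hg hne t ht
    have hS := T.finite_image_inter_nonempty (isCompact_singleton (x := t))
      (isCompact_singleton (x := t))
    have hmem : ∀ j : ℕ, (⟨g, hK hg⟩ : T.group) ^ j ∈
        {g : T.group | ((g : Equiv.Perm ℍ) '' {t} ∩ {t}).Nonempty} := by
      intro j
      refine ⟨t, ⟨t, rfl, ?_⟩, rfl⟩
      rw [Subgroup.coe_pow]
      induction j with
      | zero => rfl
      | succ j ih => rw [pow_succ, Equiv.Perm.mul_apply, ht, ih]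
    have hninj : ¬ Function.Injective fun j : ℕ => (⟨g, hK hg⟩ : T.group) ^ j := fun hinj =>
      Set.infinite_of_injective_forall_mem hinj hmem hS
    rw [injective_pow_iff_not_isOfFinOrder, not_not] at hninj
    exact hne (htf g hg (by simpa using T.group.subtype.isOfFinOrder hninj))
  · intro C L hC hL
    have h := (T.finite_image_inter_nonempty hC hL).preimage (f := Subgroup.inclusion hK)
      (Subgroup.inclusion_injective hK).injOn
    exact h
  · obtain ⟨C, hC, hcov⟩ := T.exists_isCompact
    have hcont : ∀ g ∈ T.group, Continuous g := by
      intro g hg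
      obtain ⟨ω, -, rfl⟩ := T.exists_act_eq hg
      exact (Isometry.of_dist_eq (T.dist_act _)).continuous
    have : Finite (T.group ⧸ K.subgroupOf T.group) :=
      (Nat.card_ne_zero.1 (by rwa [Subgroup.relIndex, Subgroup.index] at hfin)).2
    -- Translates of a compact set for the whole group by finitely many coset representatives; they
    -- meet every `K`-orbit.
    let C' : Set ℍ := ⋃ q : T.group ⧸ K.subgroupOf T.group,
      ((q.out⁻¹ : T.group) : Equiv.Perm ℍ) '' C
    have hC' : IsCompact C' := isCompact_iUnion fun q => hC.image (hcont _ (SetLike.coe_mem _))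
    refine ⟨?_⟩
    have himg : (Set.univ : Set (MulAction.orbitRel.Quotient K ℍ)) =
        (fun z : ℍ => (Quotient.mk'' z : MulAction.orbitRel.Quotient K ℍ)) '' C' := by
      symm
      rw [Set.eq_univ_iff_forall]
      intro q
      induction q using Quotient.inductionOn' with
      | _ z =>
        obtain ⟨g, hg, hgz⟩ := hcov z
        set t : T.group := (QuotientGroup.mk (⟨g, hg⟩ : T.group) :
          T.group ⧸ K.subgroupOf T.group).out with ht
        have hk : t⁻¹ * ⟨g, hg⟩ ∈ K.subgroupOf T.group :=
          QuotientGroup.eq.1 (Quotient.out_eq' _)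
        refine ⟨(t⁻¹ * ⟨g, hg⟩ : T.group).1 z, Set.mem_iUnion.2 ⟨_, g z, hgz, rfl⟩, ?_⟩
        exact Quotient.sound' ⟨⟨_, Subgroup.mem_subgroupOf.1 hk⟩, rfl⟩
    rw [himg]
    exact hC'.image continuous_quotient_mk'

/-- A torsion element of the kernel is conjugate to a power of a canonical generator. As `f`
preserves the order of that generator, the power is trivial. -/
theorem isTorsionFree_of_orderOf (T : RotationTriangle l m k) {G : Type*} [Group G]
    (f : T.group →* G) {x y z : G} (hx : ∀ g : T.group, (g : Equiv.Perm ℍ) = T.u → f g = x)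
    (hy : ∀ g : T.group, (g : Equiv.Perm ℍ) = T.v → f g = y)
    (hz : ∀ g : T.group, (g : Equiv.Perm ℍ) = T.w → f g = z)
    (ox : orderOf x = l) (oy : orderOf y = m) (oz : orderOf z = k) :
    IsTorsionFreeSubgroup (f.ker.map T.group.subtype) := by
  rintro _ ⟨g, hg, rfl⟩ hfin
  obtain ⟨h, hh, n, hn⟩ := T.exists_conj_of_isOfFinOrder g.2 hfin
  have key : ∀ (a : T.group) (r : ℕ), orderOf (f a) = r → (a : Equiv.Perm ℍ) ^ r = 1 →
      (g : Equiv.Perm ℍ) = h * (a : Equiv.Perm ℍ) ^ n * h⁻¹ → T.group.subtype g = 1 := by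
    intro a r ha har hga
    have h1 : g = ⟨h, hh⟩ * a ^ n * ⟨h, hh⟩⁻¹ := Subtype.ext hga
    have h2 : f a ^ n = 1 := by
      rw [SetLike.mem_coe, MonoidHom.mem_ker, h1, map_mul, map_mul, map_inv, map_zpow] at hg
      rwa [mul_inv_eq_one, mul_eq_left] at hg
    obtain ⟨j, rfl⟩ := orderOf_dvd_iff_zpow_eq_one.2 h2
    rw [Subgroup.coe_subtype, hga, zpow_mul, zpow_natCast, ha, har, one_zpow, mul_one,
      mul_inv_cancel]
  rcases hn with hn | hn | hn
  · exact key ⟨T.u, T.u_mem⟩ l (by rw [hx _ rfl, ox]) T.u_pow_eq_one hn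
  · exact key ⟨T.v, T.v_mem⟩ m (by rw [hy _ rfl, oy]) T.rotate.u_pow_eq_one hn
  · exact key ⟨T.w, T.w_mem⟩ k (by rw [hz _ rfl, oz]) T.rotate.rotate.u_pow_eq_one hn

end RotationTriangle

/-- The cycles of left multiplication by `g` are the right cosets of `⟨g⟩`. -/
theorem numCycles_toPerm_mul {G : Type} [Group G] (g : G) :
    Hypermap.numCycles (MulAction.toPermHom G G g) * orderOf g = Nat.card G := by
  have hrel : ∀ a b : G, MulAction.orbitRel (Subgroup.zpowers (MulAction.toPermHom G G g)) G a b ↔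
      QuotientGroup.rightRel (Subgroup.zpowers g) a b := by
    intro a b
    have hz : ∀ n : ℤ, (MulAction.toPermHom G G g ^ n) b = g ^ n * b := fun n => by
      rw [← map_zpow]
      rfl
    constructor
    · rintro ⟨⟨_, n, rfl⟩, h⟩
      exact ⟨⟨_, n, rfl⟩, (hz n).symm.trans h⟩
    · rintro ⟨⟨_, n, rfl⟩, h⟩
      exact ⟨⟨_, n, rfl⟩, (hz n).trans h⟩
  have hcard : Hypermap.numCycles (MulAction.toPermHom G G g) = (Subgroup.zpowers g).index := by
    rw [Hypermap.numCycles, Subgroup.index]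
    exact Nat.card_congr ((Quotient.congrRight hrel).trans
      (QuotientGroup.quotientRightRelEquivQuotientLeftRel _))
  rw [hcard, ← Nat.card_zpowers, Subgroup.index_mul_card]

/-- The regular hypermap of a triple of generators of a finite group. -/
theorem RotationTriangle.exists_hypermap {l m k : ℕ} (T : RotationTriangle l m k)
    {K : Subgroup (Equiv.Perm ℍ)} {G : Type} [Group G] [Finite G] (f : T.group →* G)
    (hf : Function.Surjective f) (hker : f.ker.map T.group.subtype = K)
    (htf : IsTorsionFreeSubgroup K) :
    ∃ H : Hypermap, H.IsRegular ∧ H.IsDessinOn l m k T.group K ∧ Nonempty (H.aut ≃* G) ∧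
      H.genus = 1 - ((Nat.card G : ℚ) / l + Nat.card G / m + Nat.card G / k - Nat.card G) / 2 := by
  set u : T.group := ⟨T.u, T.u_mem⟩ with hu
  set v : T.group := ⟨T.v, T.v_mem⟩ with hv
  set w : T.group := ⟨T.w, T.w_mem⟩ with hw
  have huvw : u * v * w = 1 := Subtype.ext T.u_mul_v_mul_w
  -- A torsion-free kernel makes `f` preserve the orders of torsion elements.
  have hord : ∀ g : T.group, 0 < orderOf (g : Equiv.Perm ℍ) →
      orderOf (f g) = orderOf (g : Equiv.Perm ℍ) := by
    intro g hg
    rw [Subgroup.orderOf_coe] at hg ⊢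
    refine Nat.dvd_antisymm (orderOf_map_dvd f g) (orderOf_dvd_of_pow_eq_one ?_)
    have hmem : T.group.subtype (g ^ orderOf (f g)) ∈ K := by
      rw [← hker]
      exact ⟨_, by rw [SetLike.mem_coe, MonoidHom.mem_ker, map_pow, pow_orderOf_eq_one], rfl⟩
    have := htf _ hmem (T.group.subtype.isOfFinOrder (IsOfFinOrder.pow (orderOf_pos_iff.1 hg)))
    exact Subtype.ext this
  have hl := T.two_le_l
  have hm := T.two_le_m
  have hk := T.two_le_k
  have ou : orderOf (f u) = l := by
    have := T.orderOf_u
    rw [hord u (by rw [hu, this]; omega), this]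
  have ov : orderOf (f v) = m := by
    have : orderOf T.v = m := T.rotate.orderOf_u
    rw [hord v (by rw [hv, this]; omega), this]
  have ow : orderOf (f w) = k := by
    have : orderOf T.w = k := T.rotate.rotate.orderOf_u
    rw [hord w (by rw [hw, this]; omega), this]
  have hgen : Subgroup.closure {f u, f v} = ⊤ := by
    rw [eq_top_iff]
    intro a _
    obtain ⟨⟨g, hg⟩, rfl⟩ := hf a
    have hle : T.group ≤ ((Subgroup.closure {f u, f v}).comap f).map T.group.subtype := by
      have hu' : f u ∈ Subgroup.closure {f u, f v} := Subgroup.subset_closure (by simp)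
      have hv' : f v ∈ Subgroup.closure {f u, f v} := Subgroup.subset_closure (by simp)
      have hw' : f w ∈ Subgroup.closure {f u, f v} := by
        rw [← inv_eq_of_mul_eq_one_right huvw, map_inv, map_mul]
        exact inv_mem (mul_mem hu' hv')
      nth_rw 1 [RotationTriangle.group]
      rw [triangleGroup, Subgroup.closure_le]
      rintro x (rfl | rfl | rfl)
      · exact ⟨u, hu', rfl⟩
      · exact ⟨v, hv', rfl⟩
      · exact ⟨w, hw', rfl⟩
    obtain ⟨g', hg', h⟩ := hle hg
    have : g' = ⟨g, hg⟩ := Subtype.ext h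
    exact this ▸ hg'
  set L := MulAction.toPermHom G G with hL
  have hLinj : Function.Injective L := MulAction.toPerm_injective
  have hclos : Subgroup.closure {L (f u), L (f v)} = L.range := by
    rw [← Set.image_pair, ← MonoidHom.map_closure, hgen, MonoidHom.range_eq_map]
  let H : Hypermap :=
    { Ω := G
      finite := inferInstance
      x := L (f u)
      y := L (f v)
      transitive := ⟨fun a b => ⟨⟨L (b * a⁻¹), by rw [hclos]; exact ⟨_, rfl⟩⟩,
        inv_mul_cancel_right b a⟩⟩
      nonempty := inferInstance }
  have hHz : H.z = L (f w) := by
    rw [Hypermap.z, ← inv_eq_of_mul_eq_one_right huvw, map_inv, map_inv, map_mul, map_mul]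
  -- The monodromy group is the left regular representation; its centraliser consists of the right
  -- multiplications.
  have hmemaut : ∀ σ : Equiv.Perm G, σ ∈ H.aut ↔ ∀ a b, σ (a * b) = a * σ b := by
    intro σ
    change σ ∈ Subgroup.centralizer (Subgroup.closure {L (f u), L (f v)} : Set (Equiv.Perm G)) ↔ _
    rw [hclos, Subgroup.mem_centralizer_iff]
    constructor
    · intro h a b
      exact (Equiv.Perm.congr_fun (h (L a) ⟨a, rfl⟩) b).symm
    · rintro h _ ⟨a, rfl⟩
      ext b
      exact (h a b).symm
  let R : G →* H.aut :=
    { toFun := fun g => ⟨Equiv.mulRight g⁻¹, (hmemaut _).2 fun a b => mul_assoc a b g⁻¹⟩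
      map_one' := by
        apply Subtype.ext
        ext b
        simp
      map_mul' := fun g h => by
        apply Subtype.ext
        ext b
        simp [mul_assoc] }
  have hRbij : Function.Bijective R := by
    constructor
    · intro a b hab
      have : (1 : G) * a⁻¹ = 1 * b⁻¹ := Equiv.Perm.congr_fun (congrArg Subtype.val hab) 1
      simpa using this
    · rintro ⟨σ, hσ⟩
      refine ⟨(σ 1)⁻¹, Subtype.ext ?_⟩
      ext b
      have := (hmemaut σ).1 hσ b 1
      rw [mul_one] at this
      change b * (σ 1)⁻¹⁻¹ = σ b
      rw [this, inv_inv]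
  refine ⟨H, ⟨fun a b => ⟨R (b⁻¹ * a), ?_⟩⟩, ⟨⟨?_, ?_, ?_⟩, u, v, w, T.isCanonicalTriple, rfl,
    L.comp f, rfl, rfl, hHz.symm, (1 : G), ?_⟩, ⟨(MulEquiv.ofBijective R hRbij).symm⟩, ?_⟩
  · change a * (b⁻¹ * a)⁻¹ = b
    group
  · exact (orderOf_injective L hLinj _).trans ou
  · exact (orderOf_injective L hLinj _).trans ov
  · rw [hHz]
    exact (orderOf_injective L hLinj _).trans ow
  · rw [← hker]
    congr 1
    ext g
    change f g * 1 = 1 ↔ f g = 1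
    rw [mul_one]
  · have hc : ∀ (g : G) (r : ℕ), 2 ≤ r → orderOf g = r →
        (Hypermap.numCycles (L g) : ℚ) = Nat.card G / r := by
      intro g r hr hg
      have h := numCycles_toPerm_mul g
      rw [hg] at h
      have hr0 : (r : ℚ) ≠ 0 := by
        have : r ≠ 0 := by omega
        exact_mod_cast this
      rw [eq_div_iff hr0, ← h]
      push_cast
      rfl
    rw [Hypermap.genus, hHz]
    change 1 - ((Hypermap.numCycles (L (f u)) : ℚ) + Hypermap.numCycles (L (f v)) +
      Hypermap.numCycles (L (f w)) - Nat.card G) / 2 = _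
    rw [hc _ _ hl ou, hc _ _ hm ov, hc _ _ hk ow]

/-! ### Subgroups of index two -/

/-- Modulo the normal closure, `a` dies and `c = b⁻¹` with `b² = 1`. The quotient therefore has
order at most 2, and `χ` already separates `b` from 1. -/
theorem normalClosure_eq_ker {Γ : Type*} [Group Γ] {a b c : Γ}
    (hgen : Subgroup.closure {a, b, c} = ⊤) (habc : a * b * c = 1)
    (χ : Γ →* Multiplicative (ZMod 2)) (ha : χ a = 1) (hb : χ b ≠ 1) :
    Subgroup.normalClosure {a, b ^ 2, c ^ 2} = χ.ker := by
  have hsq : ∀ s : Multiplicative (ZMod 2), s ^ 2 = 1 := by decide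
  have hle : Subgroup.normalClosure {a, b ^ 2, c ^ 2} ≤ χ.ker := by
    apply Subgroup.normalClosure_le_normal
    rintro g (rfl | rfl | rfl)
    · exact ha
    · exact (map_pow _ _ _).trans (hsq _)
    · exact (map_pow _ _ _).trans (hsq _)
  refine le_antisymm hle fun g hg => ?_
  set N := Subgroup.normalClosure {a, b ^ 2, c ^ 2} with hN
  have hqa : (a : Γ ⧸ N) = 1 :=
    (QuotientGroup.eq_one_iff a).2 (Subgroup.subset_normalClosure (by simp))
  have hqb : (b : Γ ⧸ N) ^ 2 = 1 :=
    (QuotientGroup.eq_one_iff (b ^ 2)).2 (Subgroup.subset_normalClosure (by simp))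
  have hqc : (c : Γ ⧸ N) = (b : Γ ⧸ N)⁻¹ := by
    have : ((a * b * c : Γ) : Γ ⧸ N) = 1 := by rw [habc]; rfl
    rw [QuotientGroup.mk_mul, QuotientGroup.mk_mul, hqa, one_mul] at this
    exact eq_inv_of_mul_eq_one_right this
  have hz : (⊤ : Subgroup Γ) ≤ (Subgroup.zpowers (b : Γ ⧸ N)).comap (QuotientGroup.mk' N) := by
    rw [← hgen, Subgroup.closure_le]
    have hb' := Subgroup.mem_zpowers (b : Γ ⧸ N)
    rintro g (h | h | h) <;> rw [h]
    · exact (congrArg (· ∈ Subgroup.zpowers (b : Γ ⧸ N)) hqa).mpr (one_mem _)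
    · exact hb'
    · exact (congrArg (· ∈ Subgroup.zpowers (b : Γ ⧸ N)) hqc).mpr (inv_mem hb')
  obtain ⟨i, hi⟩ := hz (Subgroup.mem_top g)
  have hi : (b : Γ ⧸ N) ^ i = g := hi
  rw [← QuotientGroup.eq_one_iff, ← hi]
  rcases Int.even_or_odd' i with ⟨j, rfl | rfl⟩
  · rw [zpow_mul, zpow_ofNat, hqb, one_zpow]
  · exfalso
    have h1 : (b ^ (2 * j + 1))⁻¹ * g ∈ χ.ker := hle (QuotientGroup.eq.1 (by
      rw [← hi]; rfl))
    have h2 : χ g = 1 := hg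
    rw [MonoidHom.mem_ker, map_mul, h2, mul_one, map_inv, inv_eq_one, map_zpow, zpow_add, zpow_mul,
      zpow_ofNat, hsq, one_zpow, one_mul, zpow_one] at h1
    exact hb h1

theorem indexTwoSubgroup_eq_map_ker {D : Subgroup (Equiv.Perm ℍ)} {a b c : Equiv.Perm ℍ}
    (hD : D = Subgroup.closure {a, b, c}) (habc : a * b * c = 1)
    (χ : D →* Multiplicative (ZMod 2)) (ha : ∀ g : D, (g : Equiv.Perm ℍ) = a → χ g = 1)
    (hb : ∀ g : D, (g : Equiv.Perm ℍ) = b → χ g ≠ 1) :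
    indexTwoSubgroup D a b c = χ.ker.map D.subtype := by
  have haD : a ∈ D := hD ▸ Subgroup.subset_closure (by simp)
  have hbD : b ∈ D := hD ▸ Subgroup.subset_closure (by simp)
  have hcD : c ∈ D := hD ▸ Subgroup.subset_closure (by simp)
  rw [indexTwoSubgroup, ← normalClosure_eq_ker (a := ⟨a, haD⟩) (b := ⟨b, hbD⟩) (c := ⟨c, hcD⟩) ?_
    (Subtype.ext habc) χ (ha _ rfl) (hb _ rfl)]
  · congr 2
    ext g
    simp [Subtype.ext_iff]
  · apply Subgroup.map_injective D.subtype_injective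
    rw [MonoidHom.map_closure, ← MonoidHom.range_eq_map, Subgroup.range_subtype,
      Set.image_insert_eq, Set.image_pair]
    exact hD.symm

/-- Since `S` contains `t` and its conjugate by `s`, `S ∪ sS` is all of `D`. This identifies the
smaller triangle groups with kernels of characters. -/
theorem map_ker_eq_of_involution {G : Type*} [Group G] {D S : Subgroup G} {s t : G}
    (hD : D = Subgroup.closure {s, t}) (hs : s * s = 1) (ht : t ∈ S) (hst : s * t * s⁻¹ ∈ S)
    (χ : D →* Multiplicative (ZMod 2)) (hS : S ≤ χ.ker.map D.subtype)
    (hχ : ∀ g : D, (g : G) = s → χ g ≠ 1) : χ.ker.map D.subtype = S := by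
  have hsi : s⁻¹ = s := inv_eq_of_mul_eq_one_left hs
  have hsD : s ∈ D := hD ▸ Subgroup.subset_closure (by simp)
  have htt : ∀ r ∈ S, s * r * s⁻¹ ∈ S → ∀ x : G, (x ∈ S ∨ s * x ∈ S) →
      (r * x ∈ S ∨ s * (r * x) ∈ S) := by
    intro r hr hsr x hx
    refine hx.imp (fun h => mul_mem hr h) fun h => ?_
    have := mul_mem hsr h
    rwa [hsi, mul_assoc, ← mul_assoc s s, hs, one_mul, mul_assoc] at this
  have key : ∀ g ∈ Subgroup.closure {s, t}, g ∈ S ∨ s * g ∈ S := by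
    intro g hg
    have hss : ∀ x : G, (x ∈ S ∨ s * x ∈ S) → (s * x ∈ S ∨ s * (s * x) ∈ S) := by
      intro x hx
      rw [← mul_assoc, hs, one_mul]
      exact hx.symm
    induction hg using Subgroup.closure_induction_left with
    | one => exact Or.inl (one_mem _)
    | mul_left x hx y _ ih =>
      rcases hx with rfl | rfl
      · exact hss y ih
      · exact htt _ ht hst y ih
    | inv_mul_cancel x hx y _ ih =>
      rcases hx with rfl | rfl
      · rw [hsi]
        exact hss y ih
      · refine htt _ (inv_mem ht) ?_ y ih
        have := inv_mem hst
        rwa [mul_inv_rev, mul_inv_rev, inv_inv, ← mul_assoc] at this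
  refine le_antisymm ?_ hS
  rintro _ ⟨g, hg, rfl⟩
  refine (key g (hD ▸ g.2)).resolve_right fun h => ?_
  obtain ⟨r, hr, hrg⟩ := hS h
  have h1 : r = ⟨s, hsD⟩ * g := Subtype.ext hrg
  have hr : χ r = 1 := hr
  have hg : χ g = 1 := hg
  rw [h1, map_mul, hg, mul_one] at hr
  exact hχ _ rfl hr

/-! ### The triangle groups of index two -/

namespace RotationTriangle

variable {n : ℕ}

theorem three_pi_div_lt (hn : 2 ≤ n) : 3 * (Real.pi / (2 * n : ℕ)) < Real.pi := by
  have hn' : (2 : ℝ) ≤ n := by exact_mod_cast hn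
  have hp := Real.pi_pos
  have : 3 * (Real.pi / (2 * n : ℕ)) = Real.pi * (3 / 2 / n) := by
    push_cast
    field_simp
  rw [this]
  have : 3 / 2 / (n : ℝ) < 1 := by
    rw [div_lt_one (by positivity)]
    linarith
  nlinarith

theorem rotMatrix_four_mul (R : ℍ) (hn : 2 ≤ n) :
    rotMatrix R (Real.pi / (2 * n : ℕ)) = rotMatrix R (Real.pi / (4 * n : ℕ)) ^ 2 := by
  rw [rotMatrix_pow]
  congr 1
  push_cast
  field_simp
  ring

theorem rotMatrix_two_mul (R : ℍ) (hn : 2 ≤ n) :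
    rotMatrix R (Real.pi / n) = rotMatrix R (Real.pi / (2 * n : ℕ)) ^ 2 := by
  rw [rotMatrix_pow]
  congr 1
  push_cast
  field_simp

theorem rotMatrix_half_mul_self (P : ℍ) :
    rotMatrix P (Real.pi / (2 : ℕ)) * rotMatrix P (Real.pi / (2 : ℕ)) = -1 := by
  rw [← rotMatrix_add, Nat.cast_two, add_halves, rotMatrix_pi]

/-- The triangle of type `(2n, 2n, 2n)` inside one of type `(2, 2n, 4n)`. -/
def equilateral (T : RotationTriangle 2 (2 * n) (4 * n)) (hn : 2 ≤ n) :
    RotationTriangle (2 * n) (2 * n) (2 * n) where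
  -- The angle at `T.P` is right, so the half-turn image of `Q` is its mirror image in the side
  -- `PR`. The doubled triangle has the angle at `R` doubled to `π/2n`.
  P := rotMatrix T.P (Real.pi / (2 : ℕ)) • T.Q
  Q := T.Q
  R := T.R
  two_le_l := by omega
  two_le_m := by omega
  two_le_k := by omega
  sum_lt := by linarith [three_pi_div_lt hn]
  mul_eq := by
    rw [rotMatrix_smul, rotMatrix_four_mul T.R hn]
    have h := T.mul_eq
    have hU := rotMatrix_half_mul_self T.P
    generalize rotMatrix T.P (Real.pi / (2 : ℕ)) = U at *
    generalize rotMatrix T.Q (Real.pi / (2 * n : ℕ)) = V at *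
    generalize rotMatrix T.R (Real.pi / (4 * n : ℕ)) = W at *
    have hUi : U⁻¹ = -U := by
      rw [inv_eq_iff_mul_eq_one, mul_neg, hU, neg_neg]
    rw [hUi, sq]
    calc U * V * -U * V * (W * W) = -(U * V * (U * V * W) * W) := by
          simp only [mul_neg, neg_mul, mul_assoc]
      _ = -1 := by rw [h, mul_neg, mul_one, neg_mul, h, neg_neg]

/-- The triangle of type `(n, 4n, 4n)` inside one of type `(2, 2n, 4n)`. -/
def isosceles (T : RotationTriangle 2 (2 * n) (4 * n)) (hn : 2 ≤ n) :
    RotationTriangle n (4 * n) (4 * n) where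
  P := T.Q
  Q := T.R
  -- Doubling across the side `PQ` instead doubles the angle at `Q` to `π/n`.
  R := rotMatrix T.P (Real.pi / (2 : ℕ)) • T.R
  two_le_l := hn
  two_le_m := by omega
  two_le_k := by omega
  sum_lt := by
    have h := three_pi_div_lt hn
    have h1 : Real.pi / n + Real.pi / (4 * n : ℕ) + Real.pi / (4 * n : ℕ) =
        3 * (Real.pi / (2 * n : ℕ)) := by
      push_cast
      field_simp
      norm_num
    rwa [h1]
  mul_eq := by
    rw [rotMatrix_smul, rotMatrix_two_mul T.Q hn]
    have h := mul_rotate_eq_neg_one T.mul_eq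
    have hU := rotMatrix_half_mul_self T.P
    generalize rotMatrix T.P (Real.pi / (2 : ℕ)) = U at *
    generalize rotMatrix T.Q (Real.pi / (2 * n : ℕ)) = V at *
    generalize rotMatrix T.R (Real.pi / (4 * n : ℕ)) = W at *
    have hUi : U⁻¹ = -U := by
      rw [inv_eq_iff_mul_eq_one, mul_neg, hU, neg_neg]
    rw [hUi, sq]
    calc V * V * W * (U * W * -U) = -(V * (V * W * U) * W * U) := by
          simp only [mul_neg, mul_assoc]
      _ = -1 := by rw [h, mul_neg, mul_one, neg_mul, neg_mul, h, neg_neg]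

theorem equilateral_u (T : RotationTriangle 2 (2 * n) (4 * n)) (hn : 2 ≤ n) :
    (T.equilateral hn).u = T.u * T.v * T.u⁻¹ := by
  rw [u, u, v, hypRotation_two_pi_div, hypRotation_two_pi_div, hypRotation_two_pi_div, equilateral,
    rotMatrix_smul, map_mul, map_mul, map_inv]

theorem isosceles_w (T : RotationTriangle 2 (2 * n) (4 * n)) (hn : 2 ≤ n) :
    (T.isosceles hn).w = T.u * T.w * T.u⁻¹ := by
  rw [w, u, w, hypRotation_two_pi_div, hypRotation_two_pi_div, hypRotation_two_pi_div, isosceles,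
    rotMatrix_smul, map_mul, map_mul, map_inv]

theorem group_eq_closure_u_v {l m k : ℕ} (T : RotationTriangle l m k) :
    T.group = Subgroup.closure {T.u, T.v} := by
  have hu : T.u ∈ Subgroup.closure {T.u, T.v} := Subgroup.subset_closure (by simp)
  have hv : T.v ∈ Subgroup.closure {T.u, T.v} := Subgroup.subset_closure (by simp)
  apply le_antisymm
  · refine (Subgroup.closure_le _).2 ?_
    rintro g (rfl | rfl | rfl)
    · exact hu
    · exact hv
    · rw [eq_inv_of_mul_eq_one_right T.u_mul_v_mul_w]
      exact inv_mem (mul_mem hu hv)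
  · refine (Subgroup.closure_le _).2 ?_
    rintro g (rfl | rfl)
    exacts [T.u_mem, T.v_mem]

theorem group_rotate {l m k : ℕ} (T : RotationTriangle l m k) : T.rotate.group = T.group := by
  change Subgroup.closure {T.v, T.w, T.u} = Subgroup.closure {T.u, T.v, T.w}
  congr 1
  ext g
  simp only [Set.mem_insert_iff, Set.mem_singleton_iff]
  tauto

theorem group_eq_closure_u_w {l m k : ℕ} (T : RotationTriangle l m k) :
    T.group = Subgroup.closure {T.u, T.w} := by
  rw [← T.group_rotate, ← T.rotate.group_rotate, group_eq_closure_u_v, Set.pair_comm]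
  rfl

/-- All three periods are even, so the values in `C₂` on `u` and `v` can be prescribed freely. -/
theorem exists_character (T : RotationTriangle 2 (2 * n) (4 * n))
    (r s : Multiplicative (ZMod 2)) : ∃ χ : T.group →* Multiplicative (ZMod 2),
      (∀ g : T.group, (g : Equiv.Perm ℍ) = T.u → χ g = r) ∧
      (∀ g : T.group, (g : Equiv.Perm ℍ) = T.v → χ g = s) ∧
      ∀ g : T.group, (g : Equiv.Perm ℍ) = T.w → χ g = r * s := by
  have hsq : ∀ s : Multiplicative (ZMod 2), s ^ 2 = 1 := by decide
  refine T.exists_hom ?_ (hsq r) ?_ ?_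
  · rw [← sq, hsq]
  · rw [pow_mul, hsq, one_pow]
  · rw [show 4 * n = 2 * (2 * n) by ring, pow_mul, hsq, one_pow]

theorem equilateral_group (T : RotationTriangle 2 (2 * n) (4 * n)) (hn : 2 ≤ n)
    {χ : T.group →* Multiplicative (ZMod 2)}
    (hu : ∀ g : T.group, (g : Equiv.Perm ℍ) = T.u → χ g ≠ 1)
    (hv : ∀ g : T.group, (g : Equiv.Perm ℍ) = T.v → χ g = 1) :
    (T.equilateral hn).group = χ.ker.map T.group.subtype := by
  refine (map_ker_eq_of_involution T.group_eq_closure_u_v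
    ((sq _).symm.trans T.u_pow_eq_one) (T.equilateral hn).v_mem
    (T.equilateral_u hn ▸ (T.equilateral hn).u_mem) χ ?_ hu).symm
  have hv' : χ ⟨T.v, T.v_mem⟩ = 1 := hv _ rfl
  rw [group_eq_closure_u_v, Subgroup.closure_le]
  rintro g (rfl | rfl)
  · rw [equilateral_u]
    refine ⟨⟨T.u, T.u_mem⟩ * ⟨T.v, T.v_mem⟩ * ⟨T.u, T.u_mem⟩⁻¹, ?_, rfl⟩
    rw [SetLike.mem_coe, MonoidHom.mem_ker, map_mul, map_mul, hv', mul_one, map_inv,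
      mul_inv_cancel]
  · exact ⟨⟨T.v, T.v_mem⟩, hv', rfl⟩

theorem isosceles_group (T : RotationTriangle 2 (2 * n) (4 * n)) (hn : 2 ≤ n)
    {χ : T.group →* Multiplicative (ZMod 2)}
    (hu : ∀ g : T.group, (g : Equiv.Perm ℍ) = T.u → χ g ≠ 1)
    (hw : ∀ g : T.group, (g : Equiv.Perm ℍ) = T.w → χ g = 1) :
    (T.isosceles hn).group = χ.ker.map T.group.subtype := by
  refine (map_ker_eq_of_involution T.group_eq_closure_u_w
    ((sq _).symm.trans T.u_pow_eq_one) (T.isosceles hn).v_mem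
    (T.isosceles_w hn ▸ (T.isosceles hn).w_mem) χ ?_ hu).symm
  have hw' : χ ⟨T.w, T.w_mem⟩ = 1 := hw _ rfl
  rw [← group_rotate, group_eq_closure_u_v, Subgroup.closure_le]
  rintro g (rfl | rfl)
  · exact ⟨⟨T.w, T.w_mem⟩, hw', rfl⟩
  · refine ⟨⟨T.u, T.u_mem⟩ * ⟨T.w, T.w_mem⟩ * ⟨T.u, T.u_mem⟩⁻¹, ?_, (T.isosceles_w hn).symm⟩
    rw [SetLike.mem_coe, MonoidHom.mem_ker, map_mul, map_mul, hw', mul_one, map_inv,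
      mul_inv_cancel]

end RotationTriangle

/-! ### Perfect groups -/

/-- The commutator subgroup of `Γ` still maps onto the perfect group `A` but dies in the abelian
group `B`, so the first coordinate can be corrected without disturbing the second. -/
theorem surjective_prod_of_commutator_eq_top {Γ A B : Type*} [Group Γ] [Group A] [CommGroup B]
    (hA : commutator A = ⊤) {f : Γ →* A} (hf : Function.Surjective f) {ψ : Γ →* B}
    (hψ : Function.Surjective ψ) : Function.Surjective (f.prod ψ) := by
  rintro ⟨a, b⟩
  obtain ⟨d, hd⟩ := hψ b
  have h1 : (commutator Γ).map f = ⊤ := by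
    rw [commutator_def, Subgroup.map_commutator, ← MonoidHom.range_eq_map,
      MonoidHom.range_eq_top.2 hf, ← commutator_def, hA]
  obtain ⟨e, he, hea⟩ : a * (f d)⁻¹ ∈ (commutator Γ).map f := h1 ▸ Subgroup.mem_top _
  have he' : ψ e = 1 := Abelianization.commutator_subset_ker ψ he
  exact ⟨e * d, by simp [hea, he', hd]⟩

theorem commutator_le_of_index_eq_two {G : Type*} [Group G] {N : Subgroup G} (hN : N.index = 2) :
    commutator G ≤ N := by
  rw [commutator_def, Subgroup.commutator_le]
  intro g _ h _
  rw [commutatorElement_def]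
  simp only [Subgroup.mul_mem_iff_of_index_two hN, inv_mem_iff]
  tauto

/-- A subgroup of index two contains all commutators, hence the perfect factor `A`. -/
theorem existsUnique_index_eq_two {A B : Type*} [Group A] [Group B] (hA : commutator A = ⊤)
    (hB : Nat.card B = 2) : ∃! N : Subgroup (A × B), N.index = 2 := by
  have h2 : (MonoidHom.snd A B).ker.index = 2 := by
    rw [Subgroup.index_ker, MonoidHom.range_eq_top.2 Prod.snd_surjective, Subgroup.card_top, hB]
  refine ⟨(MonoidHom.snd A B).ker, h2, fun N (hN : N.index = 2) => ?_⟩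
  have hle : (MonoidHom.snd A B).ker ≤ N := by
    rintro ⟨a, b⟩ (rfl : b = 1)
    apply commutator_le_of_index_eq_two hN
    have h3 : (commutator A).map (MonoidHom.inl A B) ≤ commutator (A × B) := by
      rw [commutator_def, Subgroup.map_commutator]
      exact Subgroup.commutator_mono le_top le_top
    exact h3 ⟨a, hA ▸ Subgroup.mem_top a, rfl⟩
  refine le_antisymm ?_ hle
  have h4 := Subgroup.relIndex_mul_index hle
  rw [hN, h2] at h4
  rw [← Subgroup.relIndex_eq_one]
  omega

/-! ### The two dessins -/

theorem mem_map_ker_subtype {G H : Type*} [Group G] [Group H] {D : Subgroup G} {f : D →* H}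
    {g : G} : g ∈ f.ker.map D.subtype ↔ ∃ h : g ∈ D, f ⟨g, h⟩ = 1 := by
  constructor
  · rintro ⟨d, hd, rfl⟩
    exact ⟨d.2, hd⟩
  · rintro ⟨h, hg⟩
    exact ⟨⟨g, h⟩, hg, rfl⟩

theorem relIndex_map_ker {G H : Type*} [Group G] [Group H] {D : Subgroup G} {f : D →* H}
    (hf : Function.Surjective f) : (f.ker.map D.subtype).relIndex D = Nat.card H := by
  rw [Subgroup.relIndex, Subgroup.subgroupOf, Subgroup.comap_map_eq_self_of_injective
    D.subtype_injective, Subgroup.index_ker, MonoidHom.range_eq_top.2 hf, Subgroup.card_top]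

theorem RotationTriangle.exists_hypermap_of_isSmoothQuotient {l m k : ℕ}
    (T : RotationTriangle l m k) {D K : Subgroup (Equiv.Perm ℍ)} {G : Type} [Group G] [Finite G]
    (hD : T.group = D) (h : IsSmoothQuotient D K G) :
    ∃ H : Hypermap, (H.IsRegular ∧ H.IsDessinOn l m k D K ∧ Nonempty (H.aut ≃* G)) ∧
      H.genus = 1 - ((Nat.card G : ℚ) / l + Nat.card G / m + Nat.card G / k - Nat.card G) / 2 := by
  subst hD
  obtain ⟨htf, f, hf, hker⟩ := h
  obtain ⟨H, h1, h2, h3, h4⟩ := T.exists_hypermap f hf hker htf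
  exact ⟨H, ⟨h1, h2, h3⟩, h4⟩

theorem IsTorsionFreeSubgroup.mono {K L : Subgroup (Equiv.Perm ℍ)} (hL : IsTorsionFreeSubgroup L)
    (h : K ≤ L) : IsTorsionFreeSubgroup K := fun g hg => hL g (h hg)

theorem isSmoothQuotient_restrict {D E K : Subgroup (Equiv.Perm ℍ)} {G : Type} [Group G]
    (hE : E ≤ D) (htf : IsTorsionFreeSubgroup K) (f : D →* G)
    (hf : ∀ a : G, ∃ d : D, (d : Equiv.Perm ℍ) ∈ E ∧ f d = a)
    (hK : ∀ g : D, (g : Equiv.Perm ℍ) ∈ K ↔ (g : Equiv.Perm ℍ) ∈ E ∧ f g = 1) (hKD : K ≤ D) :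
    IsSmoothQuotient E K G := by
  refine ⟨htf, f.comp (Subgroup.inclusion hE), fun a => ?_, ?_⟩
  · obtain ⟨d, hd, hda⟩ := hf a
    exact ⟨⟨d, hd⟩, hda⟩
  · ext g
    rw [mem_map_ker_subtype]
    constructor
    · rintro ⟨h, hg⟩
      exact (hK ⟨g, hE h⟩).2 ⟨h, hg⟩
    · intro hg
      obtain ⟨h1, h2⟩ := (hK ⟨g, hKD hg⟩).1 hg
      exact ⟨h1, h2⟩

/-- The whole construction for an arbitrary finite perfect group with a generating triple of type
`(2, 2n, 4n)`; nothing else about `L₂(p)` matters here. -/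
theorem RotationTriangle.exists_dessins {n : ℕ} (T : RotationTriangle 2 (2 * n) (4 * n))
    (hn : 2 ≤ n) {A : Type} [Group A] [Finite A] (hA : commutator A = ⊤) {x y z : A}
    (hxyz : x * y * z = 1) (ox : orderOf x = 2) (oy : orderOf y = 2 * n)
    (oz : orderOf z = 4 * n) (hgen : Subgroup.closure {x, z} = ⊤)
    {D₀ D₁ D₂ : Subgroup (Equiv.Perm ℍ)} (h₀ : D₀ = indexTwoSubgroup T.group T.u T.v T.w)
    (h₁ : D₁ = indexTwoSubgroup T.group T.v T.w T.u)
    (h₂ : D₂ = indexTwoSubgroup T.group T.w T.u T.v) :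
    (D₀.relIndex T.group = 2 ∧ D₁.relIndex T.group = 2 ∧ D₂.relIndex T.group = 2) ∧
    ∃ M L K : Subgroup (Equiv.Perm ℍ),
      (IsTorsionFreeSubgroup M ∧
        ∃ f : T.group →* A, Function.Surjective f ∧ f.ker.map T.group.subtype = M ∧
          (∀ g : T.group, (g : Equiv.Perm ℍ) = T.u → f g = x) ∧
          (∀ g : T.group, (g : Equiv.Perm ℍ) = T.v → f g = y) ∧
          (∀ g : T.group, (g : Equiv.Perm ℍ) = T.w → f g = z)) ∧
      (L = D₀ ⊓ M ∧ IsSmoothQuotient T.group L (A × Multiplicative (ZMod 2))) ∧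
      (K = D₁ ⊓ D₂ ⊓ M ∧ K = D₁ ⊓ L ∧ K = D₂ ⊓ L ∧
        IsSmoothQuotient D₁ K (A × Multiplicative (ZMod 2)) ∧
        IsSmoothQuotient D₂ K (A × Multiplicative (ZMod 2))) ∧
      IsSurfaceGroup K ∧
      ∃ H₁ H₂ : Hypermap,
        (H₁.IsRegular ∧ H₁.IsDessinOn (2 * n) (2 * n) (2 * n) D₁ K ∧
          Nonempty (H₁.aut ≃* A × Multiplicative (ZMod 2))) ∧
        (H₂.IsRegular ∧ H₂.IsDessinOn n (4 * n) (4 * n) D₂ K ∧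
          Nonempty (H₂.aut ≃* A × Multiplicative (ZMod 2))) ∧
        H₁.genus = 1 + (2 * n - 3) / (4 * n) * (2 * Nat.card A) ∧
        H₂.genus = 1 + (2 * n - 3) / (4 * n) * (2 * Nat.card A) := by
  obtain ⟨f, fu, fv, fw⟩ := T.exists_hom hxyz (ox ▸ pow_orderOf_eq_one x)
    (oy ▸ pow_orderOf_eq_one y) (oz ▸ pow_orderOf_eq_one z)
  have hf : Function.Surjective f := by
    rw [← MonoidHom.range_eq_top, eq_top_iff, ← hgen, Subgroup.closure_le]
    rintro g (rfl | rfl)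
    · exact ⟨⟨T.u, T.u_mem⟩, fu _ rfl⟩
    · exact ⟨⟨T.w, T.w_mem⟩, fw _ rfl⟩
  set c : Multiplicative (ZMod 2) := Multiplicative.ofAdd 1 with hc
  have hc1 : c ≠ 1 := by decide
  have hcc : c * c = 1 := by decide
  have hor : ∀ s : Multiplicative (ZMod 2), s = 1 ∨ s = c := by decide
  have hmul : ∀ s t : Multiplicative (ZMod 2), s = 1 → (s * t = 1 ↔ t = 1) := by decide
  have hmul' : ∀ s t : Multiplicative (ZMod 2), t = 1 → (s * t = 1 ↔ s = 1) := by decide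
  -- `χ₁` is trivial only on the generator `v`, `χ₂` only on `w`, and `χ₁χ₂` only on `u`; their
  -- kernels are `D₁`, `D₂`, `D₀`.
  obtain ⟨χ₁, u₁, v₁, w₁⟩ := T.exists_character c 1
  obtain ⟨χ₂, u₂, v₂, w₂⟩ := T.exists_character c c
  rw [mul_one] at w₁
  rw [hcc] at w₂
  have hχ : Function.Surjective (χ₁.prod χ₂) := by
    rintro ⟨s, t⟩
    set v : T.group := ⟨T.v, T.v_mem⟩
    set w : T.group := ⟨T.w, T.w_mem⟩
    rcases hor s with rfl | rfl <;> rcases hor t with rfl | rfl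
    · exact ⟨1, map_one _⟩
    · exact ⟨v, Prod.ext (v₁ v rfl) (v₂ v rfl)⟩
    · exact ⟨w, Prod.ext (w₁ w rfl) (w₂ w rfl)⟩
    · exact ⟨v * w, Prod.ext (by simp [v₁ v rfl, w₁ w rfl]) (by simp [v₂ v rfl, w₂ w rfl])⟩
  have hsurj : ∀ (a : A) (s t : Multiplicative (ZMod 2)),
      ∃ d : T.group, f d = a ∧ χ₁ d = s ∧ χ₂ d = t := by
    intro a s t
    obtain ⟨d, hd⟩ := surjective_prod_of_commutator_eq_top hA hf hχ (a, s, t)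
    exact ⟨d, congrArg Prod.fst hd, congrArg (fun q => q.2.1) hd, congrArg (fun q => q.2.2) hd⟩
  have e₀ : D₀ = (χ₁ * χ₂).ker.map T.group.subtype :=
    h₀.trans (indexTwoSubgroup_eq_map_ker (D := T.group) rfl T.u_mul_v_mul_w (χ₁ * χ₂)
      (fun g hg => by rw [MonoidHom.mul_apply, u₁ g hg, u₂ g hg, hcc])
      (fun g hg => by rw [MonoidHom.mul_apply, v₁ g hg, v₂ g hg, one_mul]; exact hc1))
  have e₁ : D₁ = χ₁.ker.map T.group.subtype :=
    h₁.trans (indexTwoSubgroup_eq_map_ker T.group_rotate.symm T.rotate.u_mul_v_mul_w χ₁ v₁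
      (fun g hg => by rw [w₁ g hg]; exact hc1))
  have e₂ : D₂ = χ₂.ker.map T.group.subtype :=
    h₂.trans (indexTwoSubgroup_eq_map_ker
      (T.group_rotate.symm.trans T.rotate.group_rotate.symm) T.rotate.rotate.u_mul_v_mul_w χ₂ w₂
      (fun g hg => by rw [u₂ g hg]; exact hc1))
  have m₀ : ∀ g : T.group, (g : Equiv.Perm ℍ) ∈ D₀ ↔ χ₁ g * χ₂ g = 1 := fun g => by
    rw [e₀, mem_map_ker_subtype]; exact ⟨fun h => h.2, fun h => ⟨g.2, h⟩⟩
  have m₁ : ∀ g : T.group, (g : Equiv.Perm ℍ) ∈ D₁ ↔ χ₁ g = 1 := fun g => by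
    rw [e₁, mem_map_ker_subtype]; exact ⟨fun h => h.2, fun h => ⟨g.2, h⟩⟩
  have m₂ : ∀ g : T.group, (g : Equiv.Perm ℍ) ∈ D₂ ↔ χ₂ g = 1 := fun g => by
    rw [e₂, mem_map_ker_subtype]; exact ⟨fun h => h.2, fun h => ⟨g.2, h⟩⟩
  have le₁ : D₁ ≤ T.group := e₁ ▸ Subgroup.map_subtype_le _
  have le₂ : D₂ ≤ T.group := e₂ ▸ Subgroup.map_subtype_le _
  have hcard : Nat.card (Multiplicative (ZMod 2)) = 2 := by simp
  have r₀ : D₀.relIndex T.group = 2 := by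
    rw [e₀, relIndex_map_ker, hcard]
    intro s
    obtain ⟨d, -, hs, ht⟩ := hsurj 1 s 1
    exact ⟨d, by rw [MonoidHom.mul_apply, hs, ht, mul_one]⟩
  have r₁ : D₁.relIndex T.group = 2 := by
    rw [e₁, relIndex_map_ker, hcard]
    intro s
    obtain ⟨d, -, hs, -⟩ := hsurj 1 s 1
    exact ⟨d, hs⟩
  have r₂ : D₂.relIndex T.group = 2 := by
    rw [e₂, relIndex_map_ker, hcard]
    intro s
    obtain ⟨d, -, -, hs⟩ := hsurj 1 1 s
    exact ⟨d, hs⟩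
  refine ⟨⟨r₀, r₁, r₂⟩, ?_⟩
  set M := f.ker.map T.group.subtype with hM
  have mM : ∀ g : T.group, (g : Equiv.Perm ℍ) ∈ M ↔ f g = 1 := fun g => by
    rw [hM, mem_map_ker_subtype]; exact ⟨fun h => h.2, fun h => ⟨g.2, h⟩⟩
  have leM : M ≤ T.group := Subgroup.map_subtype_le _
  have tM : IsTorsionFreeSubgroup M := T.isTorsionFree_of_orderOf f fu fv fw ox oy oz
  set K := D₁ ⊓ D₂ ⊓ M with hK
  have tK : IsTorsionFreeSubgroup K := tM.mono inf_le_right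
  have leK : K ≤ T.group := inf_le_right.trans leM
  have mK : ∀ g : T.group, (g : Equiv.Perm ℍ) ∈ K ↔ (χ₁ g = 1 ∧ χ₂ g = 1) ∧ f g = 1 := fun g => by
    rw [hK, Subgroup.mem_inf, Subgroup.mem_inf, m₁, m₂, mM]
  -- On `D₁`, where `χ₁ = 1`, the other character `χ₂` supplies the factor `C₂`.
  have q₁ : IsSmoothQuotient D₁ K (A × Multiplicative (ZMod 2)) := by
    refine isSmoothQuotient_restrict le₁ tK (f.prod χ₂) ?_ (fun g => ?_) leK
    · rintro ⟨a, t⟩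
      obtain ⟨d, ha, hs, ht⟩ := hsurj a 1 t
      exact ⟨d, (m₁ d).2 hs, Prod.ext ha ht⟩
    · rw [mK, m₁, MonoidHom.prod_apply, Prod.mk_eq_one]
      tauto
  have q₂ : IsSmoothQuotient D₂ K (A × Multiplicative (ZMod 2)) := by
    refine isSmoothQuotient_restrict le₂ tK (f.prod χ₁) ?_ (fun g => ?_) leK
    · rintro ⟨a, s⟩
      obtain ⟨d, ha, hs, ht⟩ := hsurj a s 1
      exact ⟨d, (m₂ d).2 ht, Prod.ext ha hs⟩
    · rw [mK, m₂, MonoidHom.prod_apply, Prod.mk_eq_one]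
      tauto
  obtain ⟨H₁, hH₁, g₁⟩ := (T.equilateral hn).exists_hypermap_of_isSmoothQuotient
    ((T.equilateral_group hn (fun g hg => by rw [u₁ g hg]; exact hc1) v₁).trans e₁.symm) q₁
  obtain ⟨H₂, hH₂, g₂⟩ := (T.isosceles hn).exists_hypermap_of_isSmoothQuotient
    ((T.isosceles_group hn (fun g hg => by rw [u₂ g hg]; exact hc1) w₂).trans e₂.symm) q₂
  have hcardA : Nat.card (A × Multiplicative (ZMod 2)) = 2 * Nat.card A := by
    rw [Nat.card_prod, hcard, mul_comm]
  have hn0 : (n : ℚ) ≠ 0 := by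
    have : n ≠ 0 := by omega
    exact_mod_cast this
  refine ⟨M, D₀ ⊓ M, K, ⟨tM, f, hf, rfl, fu, fv, fw⟩, ⟨rfl, ?_⟩, ⟨rfl, ?_, ?_, q₁, q₂⟩, ?_, H₁, H₂,
    hH₁, hH₂, ?_, ?_⟩
  · refine isSmoothQuotient_restrict le_rfl (tM.mono inf_le_right) (f.prod (χ₁ * χ₂)) ?_
      (fun g => ?_) (inf_le_right.trans leM)
    · rintro ⟨a, s⟩
      obtain ⟨d, ha, hs, ht⟩ := hsurj a s 1
      exact ⟨d, d.2, Prod.ext ha (by simp [hs, ht])⟩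
    · rw [Subgroup.mem_inf, m₀, mM, MonoidHom.prod_apply, Prod.mk_eq_one, MonoidHom.mul_apply]
      exact ⟨fun h => ⟨g.2, h.2, h.1⟩, fun h => ⟨h.2.2, h.2.1⟩⟩
  · ext g
    by_cases hg : g ∈ T.group
    · have h := hmul (χ₁ ⟨g, hg⟩) (χ₂ ⟨g, hg⟩)
      rw [mK ⟨g, hg⟩, Subgroup.mem_inf, Subgroup.mem_inf, m₁ ⟨g, hg⟩, m₀ ⟨g, hg⟩, mM ⟨g, hg⟩]
      tauto
    · exact iff_of_false (fun h => hg (leK h)) fun h => hg (le₁ h.1)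
  · ext g
    by_cases hg : g ∈ T.group
    · have h := hmul' (χ₁ ⟨g, hg⟩) (χ₂ ⟨g, hg⟩)
      rw [mK ⟨g, hg⟩, Subgroup.mem_inf, Subgroup.mem_inf, m₂ ⟨g, hg⟩, m₀ ⟨g, hg⟩, mM ⟨g, hg⟩]
      tauto
    · exact iff_of_false (fun h => hg (leK h)) fun h => hg (le₂ h.1)
  · refine T.isSurfaceGroup leK tK ?_
    -- As the joint kernel of maps to finite groups, `K` has finite index.
    have : K = (f.prod (χ₁.prod χ₂)).ker.map T.group.subtype := by
      ext g
      rw [mem_map_ker_subtype]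
      constructor
      · intro hg
        have := (mK ⟨g, leK hg⟩).1 hg
        exact ⟨leK hg, by simp [this.1.1, this.1.2, this.2]⟩
      · rintro ⟨hg, h⟩
        simp only [MonoidHom.prod_apply, Prod.mk_eq_one] at h
        exact (mK ⟨g, hg⟩).2 ⟨h.2, h.1⟩
    rw [this, relIndex_map_ker (surjective_prod_of_commutator_eq_top hA hf hχ)]
    exact Nat.card_pos.ne'
  -- Both types have reciprocal sum `3/(2n)`, so the genera agree.
  · rw [g₁, hcardA]
    push_cast
    field_simp
    ring
  · rw [g₂, hcardA]
    push_cast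
    field_simp
    ring

/-! ### Unipotent elements of `SL₂` -/

section Unipotent

variable {F : Type*} [Field F]

/-- The unipotent matrix `1 + t N`, where `N` is nilpotent with image spanned by `(x, y)`. -/
def unipotent (x y t : F) : SL(2, F) :=
  ⟨!![1 - t * x * y, t * x ^ 2; -(t * y ^ 2), 1 + t * x * y], by
    rw [Matrix.det_fin_two_of]
    ring⟩

theorem unipotent_mul (x y s t : F) :
    unipotent x y s * unipotent x y t = unipotent x y (s + t) := by
  apply Subtype.ext
  rw [Matrix.SpecialLinearGroup.coe_mul]
  ext i j
  fin_cases i <;> fin_cases j <;>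
    simp [unipotent, Matrix.mul_apply, Fin.sum_univ_two] <;> ring

theorem unipotent_zero (x y : F) : unipotent x y 0 = 1 := by
  apply Subtype.ext
  ext i j
  fin_cases i <;> fin_cases j <;> simp [unipotent]

theorem unipotent_pow (x y t : F) (k : ℕ) : unipotent x y t ^ k = unipotent x y (k * t) := by
  induction k with
  | zero => simp [unipotent_zero]
  | succ k ih => rw [pow_succ, ih, unipotent_mul]; congr 1; push_cast; ring

theorem unipotent_smul (x y s t : F) :
    unipotent (s * x) (s * y) t = unipotent x y (s ^ 2 * t) := by
  apply Subtype.ext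
  ext i j
  fin_cases i <;> fin_cases j <;> simp [unipotent] <;> ring

theorem conj_unipotent (g : SL(2, F)) (x y t : F) :
    g * unipotent x y t * g⁻¹ =
      unipotent (g 0 0 * x + g 0 1 * y) (g 1 0 * x + g 1 1 * y) t := by
  rw [mul_inv_eq_iff_eq_mul]
  apply Subtype.ext
  have hdet := g.det_coe
  rw [Matrix.det_fin_two] at hdet
  rw [Matrix.SpecialLinearGroup.coe_mul, Matrix.SpecialLinearGroup.coe_mul]
  generalize (g : Matrix (Fin 2) (Fin 2) F) = A at *
  ext i j
  fin_cases i <;> fin_cases j <;>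
    simp [unipotent, Matrix.mul_apply, Fin.sum_univ_two]
  · linear_combination (t * y * (A 0 0 * x + A 0 1 * y)) * hdet
  · linear_combination (-t * x * (A 0 0 * x + A 0 1 * y)) * hdet
  · linear_combination (t * y * (A 1 0 * x + A 1 1 * y)) * hdet
  · linear_combination (-t * x * (A 1 0 * x + A 1 1 * y)) * hdet

/-- Trace 2 and determinant 1 give `(g - 1)² = 0`; the vector `(x, y)` spans a line fixed by `g`. -/
theorem exists_eq_unipotent {g : SL(2, F)}
    (hg : (g : Matrix (Fin 2) (Fin 2) F).trace = 2) :
    ∃ x y t : F, (x ≠ 0 ∨ y ≠ 0) ∧ g = unipotent x y t := by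
  have hdet := g.det_coe
  rw [Matrix.det_fin_two] at hdet
  rw [Matrix.trace_fin_two] at hg
  obtain ⟨A, hA⟩ := g
  change A 0 0 + A 1 1 = 2 at hg
  change A 0 0 * A 1 1 - A 0 1 * A 1 0 = 1 at hdet
  have h11 : A 1 1 = 2 - A 0 0 := by linear_combination hg
  rw [h11] at hdet
  by_cases hc : A 1 0 = 0
  · rw [hc] at hdet
    have h00 : A 0 0 = 1 := by
      have : (A 0 0 - 1) ^ 2 = 0 := by linear_combination -hdet
      linear_combination pow_eq_zero_iff (two_ne_zero) |>.1 this
    refine ⟨1, 0, A 0 1, Or.inl one_ne_zero, Subtype.ext ?_⟩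
    ext i j
    fin_cases i <;> fin_cases j <;> simp [unipotent, h00, hc, h11]
    norm_num
  · refine ⟨(A 0 0 - 1) / A 1 0, 1, -A 1 0, Or.inr one_ne_zero, Subtype.ext ?_⟩
    ext i j
    fin_cases i <;> fin_cases j <;> simp [unipotent, h11] <;> field_simp
    · ring
    · linear_combination -hdet
    · ring

/-- A change of basis `S` of determinant 1 carries the coordinate axes to the two fixed lines. The
two subgroups become the upper and lower transvections, which generate `SL₂`. -/
theorem eq_top_of_unipotent_mem {H : Subgroup SL(2, F)} {x y x' y' : F}
    (h : ∀ t, unipotent x y t ∈ H) (h' : ∀ t, unipotent x' y' t ∈ H)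
    (hne : x * y' - x' * y ≠ 0) : H = ⊤ := by
  obtain ⟨δ, hδ⟩ : ∃ δ, δ = x * y' - x' * y := ⟨_, rfl⟩
  rw [← hδ] at hne
  let S : SL(2, F) := ⟨!![x, x' / δ; y, y' / δ], by
    rw [Matrix.det_fin_two_of]
    field_simp
    exact hδ.symm⟩
  have hS : ∀ A : SL(2, F), S * A * S⁻¹ ∈ H := by
    intro A
    induction A using Matrix.SL2.transvection_induction with
    | hmul A B hA hB =>
      have := mul_mem hA hB
      rwa [mul_assoc (S * A), ← mul_assoc S⁻¹, ← mul_assoc S⁻¹, inv_mul_cancel, one_mul,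
        ← mul_assoc, mul_assoc S] at this
    | htransvec i j hij c =>
      have h01 : Matrix.SpecialLinearGroup.transvection (zero_ne_one (α := Fin 2)) c =
          unipotent 1 0 c := by
        apply Subtype.ext
        ext i j
        fin_cases i <;> fin_cases j <;>
          simp [unipotent, Matrix.SpecialLinearGroup.transvection_coe]
      have h10 : Matrix.SpecialLinearGroup.transvection (one_ne_zero (α := Fin 2)) c =
          unipotent 0 1 (-c) := by
        apply Subtype.ext
        ext i j
        fin_cases i <;> fin_cases j <;>
          simp [unipotent, Matrix.SpecialLinearGroup.transvection_coe]
      fin_cases i <;> fin_cases j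
      · exact absurd rfl hij
      · change S * Matrix.SpecialLinearGroup.transvection (zero_ne_one (α := Fin 2)) c * S⁻¹ ∈ H
        rw [h01, conj_unipotent]
        simpa [S] using h c
      · change S * Matrix.SpecialLinearGroup.transvection (one_ne_zero (α := Fin 2)) c * S⁻¹ ∈ H
        rw [h10, conj_unipotent]
        have := h' ((δ⁻¹) ^ 2 * -c)
        rw [← unipotent_smul] at this
        simpa [S, div_eq_inv_mul] using this
      · exact absurd rfl hij
  rw [Subgroup.eq_top_iff']
  intro A
  have := hS (S⁻¹ * A * S)
  rwa [mul_assoc, mul_assoc, mul_inv_cancel, mul_one, mul_inv_cancel_left] at this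

end Unipotent

/-! ### Groups all of whose non-trivial elements have two fixed points -/

open MulAction in
-- Burnside's count, with `1` and `e` fixing every point and all other elements two, combined with
-- the orbit-stabiliser formula for `|Ω|`.
theorem sum_orbits_of_two_fixed_points {G Ω : Type*} [Group G] [MulAction G Ω] [Finite G]
    [Finite Ω] [Fintype (orbitRel.Quotient G Ω)] {e : G} (he : e ≠ 1) (htriv : ∀ x : Ω, e • x = x)
    (hfix : ∀ g : G, g ≠ 1 → g ≠ e → Nat.card (fixedBy Ω g) = 2) :
    ∑ ω : orbitRel.Quotient G Ω, (1 - 2 / (Nat.card (stabilizer G ω.out) : ℚ)) =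
      2 - 4 / (Nat.card G : ℚ) := by
  classical
  have := Fintype.ofFinite G
  have := Fintype.ofFinite Ω
  have hG : (Nat.card G : ℚ) ≠ 0 := by exact_mod_cast Nat.card_pos.ne'
  have h1 := MulAction.sum_card_fixedBy_eq_card_orbits_mul_card_group G Ω
  have h2 : ∑ g : G, Fintype.card (fixedBy Ω g) =
      2 * Fintype.card Ω + (Fintype.card G - 2) * 2 := by
    have hs : ∑ g ∈ ({1, e} : Finset G), Fintype.card (fixedBy Ω g) = 2 * Fintype.card Ω := by
      rw [Finset.sum_pair he.symm, two_mul]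
      congr 1
      · simp
      · rw [Fintype.card_eq_nat_card, Fintype.card_eq_nat_card,
          Set.eq_univ_of_forall (s := fixedBy Ω e) htriv, Nat.card_univ]
    rw [← Finset.sum_add_sum_compl {1, e}, hs]
    congr 1
    rw [Finset.sum_congr rfl (g := fun _ => 2)]
    · rw [Finset.sum_const, Finset.card_compl, Finset.card_pair he.symm, smul_eq_mul]
    · intro g hg
      rw [Finset.mem_compl, Finset.mem_insert, Finset.mem_singleton, not_or] at hg
      rw [Fintype.card_eq_nat_card, hfix g hg.1 hg.2]
  have hG2 : 2 ≤ Fintype.card G := by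
    rw [← Finset.card_pair he.symm]
    exact Finset.card_le_univ _
  have h3 : (Fintype.card Ω : ℚ) =
      ∑ ω : orbitRel.Quotient G Ω, (Nat.card G : ℚ) / Nat.card (stabilizer G ω.out) := by
    rw [MulAction.card_eq_sum_card_group_div_card_stabilizer G Ω, Nat.cast_sum]
    refine Finset.sum_congr rfl fun ω _ => ?_
    rw [Nat.cast_div, Fintype.card_eq_nat_card, Fintype.card_eq_nat_card]
    · rw [Fintype.card_eq_nat_card, Fintype.card_eq_nat_card]
      exact Subgroup.card_subgroup_dvd_card _
    · rw [Fintype.card_eq_nat_card]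
      exact_mod_cast Nat.card_pos.ne'
  rw [h2] at h1
  have h4 : (2 * Fintype.card Ω + (Nat.card G - 2) * 2 : ℚ) =
      Fintype.card (orbitRel.Quotient G Ω) * Nat.card G := by
    rw [← Fintype.card_eq_nat_card]
    have := congrArg (Nat.cast (R := ℚ)) h1
    push_cast [Nat.cast_sub hG2] at this
    convert this using 3
  have h5 : (Nat.card G : ℚ) *
      ∑ ω : orbitRel.Quotient G Ω, (1 - 2 / (Nat.card (stabilizer G ω.out) : ℚ)) =
        Fintype.card (orbitRel.Quotient G Ω) * Nat.card G - 2 * Fintype.card Ω := by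
    rw [h3, Finset.sum_sub_distrib, mul_sub, Finset.mul_sum, Finset.mul_sum, Finset.mul_sum,
      Finset.sum_const, Finset.card_univ, nsmul_eq_mul]
    congr 1
    · ring
    · exact Finset.sum_congr rfl fun ω _ => by ring
  rw [← h4] at h5
  apply mul_left_cancel₀ hG
  rw [h5]
  field_simp
  ring

/-- The bounds force exactly two nonzero terms, and `1/2 + 1/2 = 1` and `1/2 + 2/3 = 7/6` leave
nothing strictly between. -/
theorem sum_notMem_Ioo {ι : Type*} [DecidableEq ι] (s : Finset ι) (φ : ι → ℚ)
    (hφ : ∀ i ∈ s, φ i = 0 ∨ φ i = 1 / 2 ∨ 2 / 3 ≤ φ i) (hφ1 : ∀ i ∈ s, φ i < 1)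
    (h1 : 1 < ∑ i ∈ s, φ i) (h2 : ∑ i ∈ s, φ i < 7 / 6) : False := by
  have hsum : ∑ i ∈ s with φ i ≠ 0, φ i = ∑ i ∈ s, φ i := Finset.sum_filter_ne_zero s
  rw [← hsum] at h1 h2
  have hB : ∀ i ∈ s.filter (φ · ≠ 0), φ i = 1 / 2 ∨ 2 / 3 ≤ φ i := by
    intro i hi
    rw [Finset.mem_filter] at hi
    exact (hφ i hi.1).resolve_left hi.2
  have hB1 : ∀ i ∈ s.filter (φ · ≠ 0), φ i < 1 := fun i hi => hφ1 i (Finset.mem_filter.1 hi).1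
  generalize s.filter (φ · ≠ 0) = B at *
  have hhalf : (B.card : ℚ) * (1 / 2) ≤ ∑ i ∈ B, φ i := by
    rw [← nsmul_eq_mul]
    refine Finset.card_nsmul_le_sum _ _ _ fun i hi => ?_
    rcases hB i hi with h | h <;> linarith
  have hone : ∑ i ∈ B, φ i ≤ (B.card : ℚ) * 1 := by
    rw [← nsmul_eq_mul]
    exact Finset.sum_le_card_nsmul _ _ _ fun i hi => (hB1 i hi).le
  have hc : B.card = 2 := by
    have h3 : (B.card : ℚ) < 3 := by linarith
    have h4 : (1 : ℚ) < B.card := by linarith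
    norm_cast at h3 h4
    omega
  obtain ⟨i, j, hij, rfl⟩ := Finset.card_eq_two.1 hc
  rw [Finset.sum_pair hij] at h1 h2
  rcases hB i (by simp) with hi | hi <;> rcases hB j (by simp) with hj | hj <;> linarith

open MulAction in
-- The orbit of `x` contributes `1 - 2/s`, with `s ≥ 16` the order of its stabiliser. The other
-- orbits must then sum to `1 + 2/s - 4/|G|`. This exceeds 1 because `|G| ≥ 3s`, and is at most `9/8
-- < 7/6`. Stabilisers contain `e`, so they have even order `2j` and each term has the form `1 -
-- 1/j`.
theorem not_two_fixed_points {G Ω : Type*} [Group G] [MulAction G Ω] [Finite G] [Finite Ω] {e : G}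
    (he : e ≠ 1) (he2 : e ^ 2 = 1) (htriv : ∀ x : Ω, e • x = x)
    (hfix : ∀ g : G, g ≠ 1 → g ≠ e → Nat.card (fixedBy Ω g) = 2) {x : Ω}
    (hstab : 16 ≤ Nat.card (stabilizer G x)) (horb : 3 ≤ Nat.card (orbit G x)) : False := by
  classical
  have := Fintype.ofFinite (orbitRel.Quotient G Ω)
  have hsum := sum_orbits_of_two_fixed_points he htriv hfix
  set ω₀ : orbitRel.Quotient G Ω := Quotient.mk'' x with hω₀
  have hs₀ : Nat.card (stabilizer G ω₀.out) = Nat.card (stabilizer G x) := by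
    have : ω₀.out ∈ orbit G x := orbitRel_apply.1 (Quotient.mk_out x)
    obtain ⟨g, hg⟩ := this
    rw [← hg]
    exact (Nat.card_congr (stabilizerEquivStabilizerOfOrbitRel (orbitRel_apply.2 ⟨g, rfl⟩)).toEquiv)
  have hos : Nat.card (orbit G x) * Nat.card (stabilizer G x) = Nat.card G :=
    by rw [← Nat.card_prod]; exact Nat.card_congr (orbitProdStabilizerEquivGroup G x)
  rw [← Finset.add_sum_erase _ _ (Finset.mem_univ ω₀), hs₀] at hsum
  have hS : (16 : ℚ) ≤ Nat.card (stabilizer G x) := by exact_mod_cast hstab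
  have hO : (3 : ℚ) ≤ Nat.card (orbit G x) := by exact_mod_cast horb
  have hG : (Nat.card G : ℚ) = Nat.card (orbit G x) * Nat.card (stabilizer G x) := by
    exact_mod_cast hos.symm
  have hdvd : ∀ y : Ω, 2 ∣ Nat.card (stabilizer G y) := fun y => by
    rw [← orderOf_eq_prime he2 he, ← Nat.card_zpowers]
    exact Subgroup.card_dvd_of_le ((Subgroup.zpowers_le).2 (htriv y))
  have hpos : ∀ y : Ω, 0 < Nat.card (stabilizer G y) := fun y => Nat.card_pos
  refine sum_notMem_Ioo (Finset.univ.erase ω₀)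
    (fun ω => 1 - 2 / (Nat.card (stabilizer G ω.out) : ℚ)) ?_ ?_ ?_ ?_
  · intro ω _
    obtain ⟨j, hj⟩ := hdvd ω.out
    have hp := hpos ω.out
    rw [hj]
    have hj0 : 0 < j := by omega
    have : (1 - 2 / ((2 * j : ℕ) : ℚ)) = 1 - 1 / j := by
      push_cast
      field_simp
    rw [this]
    rcases (by omega : j = 1 ∨ j = 2 ∨ 3 ≤ j) with rfl | rfl | h3
    · norm_num
    · norm_num
    · right; right
      have h3' : (3 : ℚ) ≤ j := by exact_mod_cast h3
      have : (1 : ℚ) / j ≤ 1 / 3 := by gcongr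
      linarith
  · intro ω _
    have hp : (0 : ℚ) < Nat.card (stabilizer G ω.out) := by exact_mod_cast hpos ω.out
    have : (0 : ℚ) < 2 / Nat.card (stabilizer G ω.out) := by positivity
    linarith
  · have : (4 : ℚ) / Nat.card G < 2 / Nat.card (stabilizer G x) := by
      rw [hG, div_lt_div_iff₀ (by positivity) (by positivity)]
      nlinarith
    linarith
  · have h1 : (2 : ℚ) / Nat.card (stabilizer G x) ≤ 2 / 16 := by gcongr
    have h2 : (0 : ℚ) ≤ 4 / Nat.card G := by positivity
    linarith

/-! ### A generation criterion for `SL₂(p)` -/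

/-- Euler's criterion: `(p² - 1)/2` is a multiple of `p - 1`. Hence characteristic polynomials over
`𝔽_p` split over `𝔽_{p²}`. -/
theorem isSquare_algebraMap_galoisField {p : ℕ} [Fact p.Prime] (hp : p ≠ 2) (a : ZMod p) :
    IsSquare (algebraMap (ZMod p) (GaloisField p 2) a) := by
  by_cases ha : a = 0
  · rw [ha, map_zero]
    exact IsSquare.zero
  have := Fintype.ofFinite (GaloisField p 2)
  have hchar : ringChar (GaloisField p 2) ≠ 2 := by rwa [ringChar.eq (GaloisField p 2) p]
  rw [FiniteField.isSquare_iff hchar (by simpa using ha), ← map_pow, Fintype.card_eq_nat_card,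
    GaloisField.card p 2 two_ne_zero]
  obtain ⟨j, hj⟩ := (Fact.out : p.Prime).odd_of_ne_two hp
  have : p ^ 2 / 2 = (p - 1) * (j + 1) := by
    have h1 : p ^ 2 = 2 * ((p - 1) * (j + 1)) + 1 := by
      rw [hj, Nat.add_sub_cancel]
      ring
    omega
  rw [this, pow_mul, ZMod.pow_card_sub_one_eq_one ha, one_pow, map_one]

theorem smul_coe_eq_iff {K : Type*} [Field K] [DecidableEq K] (g : GL (Fin 2) K) (k : K) :
    g • (k : OnePoint K) = k ↔ g 1 0 * k ^ 2 + (g 1 1 - g 0 0) * k - g 0 1 = 0 := by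
  rw [← Matrix.GeneralLinearGroup.fixpointPolynomial_aeval_eq_zero_iff]
  simp [Matrix.GeneralLinearGroup.fixpointPolynomial]

theorem card_fixedBy_eq_two {K : Type*} [Field K] [DecidableEq K] (h2 : (2 : K) ≠ 0)
    (g : GL (Fin 2) K) {r : K} (hr : r ≠ 0)
    (hdisc : (g 0 0 + g 1 1) ^ 2 - 4 * (g 0 0 * g 1 1 - g 0 1 * g 1 0) = r * r) :
    Nat.card (MulAction.fixedBy (OnePoint K) g) = 2 := by
  suffices h : ∃ x y : OnePoint K, x ≠ y ∧ MulAction.fixedBy (OnePoint K) g = {x, y} by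
    obtain ⟨x, y, hxy, h⟩ := h
    rw [h]
    exact Set.ncard_pair hxy
  by_cases hc : g 1 0 = 0
  · rw [hc] at hdisc
    have hd : g 1 1 - g 0 0 ≠ 0 := by
      intro hd
      apply hr
      rw [← mul_self_eq_zero, ← hdisc]
      linear_combination (g 1 1 - g 0 0) * hd
    refine ⟨OnePoint.infty, ((g 0 1 / (g 1 1 - g 0 0) : K) : OnePoint K),
      OnePoint.infty_ne_coe _, Set.ext fun x => ?_⟩
    rw [MulAction.mem_fixedBy, Set.mem_insert_iff, Set.mem_singleton_iff]
    cases x with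
    | infty => simp [OnePoint.smul_infty_eq_self_iff, hc]
    | coe k =>
      rw [smul_coe_eq_iff, hc, OnePoint.coe_eq_coe, eq_div_iff hd]
      simp only [OnePoint.coe_ne_infty, false_or]
      constructor <;> intro h <;> linear_combination h
  · refine ⟨(((g 0 0 - g 1 1 + r) / (2 * g 1 0) : K) : OnePoint K),
      (((g 0 0 - g 1 1 - r) / (2 * g 1 0) : K) : OnePoint K), ?_, Set.ext fun x => ?_⟩
    · rw [Ne, OnePoint.coe_eq_coe, div_left_inj' (mul_ne_zero h2 hc)]
      intro h
      have : 2 * r = 0 := by linear_combination h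
      exact (mul_ne_zero h2 hr) this
    · rw [MulAction.mem_fixedBy, Set.mem_insert_iff, Set.mem_singleton_iff]
      cases x with
      | infty => simp [OnePoint.smul_infty_eq_self_iff, hc]
      | coe k =>
        have h4 : 4 * g 1 0 ≠ 0 := by
          have : (4 : K) = 2 * 2 := by norm_num
          rw [this]
          exact mul_ne_zero (mul_ne_zero h2 h2) hc
        have key : (k * (2 * g 1 0) - (g 0 0 - g 1 1 + r)) *
            (k * (2 * g 1 0) - (g 0 0 - g 1 1 - r)) =
              4 * g 1 0 * (g 1 0 * k ^ 2 + (g 1 1 - g 0 0) * k - g 0 1) := by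
          linear_combination hdisc
        rw [smul_coe_eq_iff, OnePoint.coe_eq_coe, OnePoint.coe_eq_coe,
          eq_div_iff (mul_ne_zero h2 hc), eq_div_iff (mul_ne_zero h2 hc), ← mul_right_inj' h4,
          mul_zero, ← key, mul_eq_zero, sub_eq_zero, sub_eq_zero]

section Generation

variable {p : ℕ} [Fact p.Prime]

theorem two_ne_zero_of_ne_two (hp : p ≠ 2) : (2 : ZMod p) ≠ 0 := by
  intro h
  have := (ZMod.natCast_eq_zero_iff 2 p).1 (by exact_mod_cast h)
  exact hp ((Nat.prime_dvd_prime_iff_eq Fact.out Nat.prime_two).1 this)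

theorem SL2_neg_one_ne_one (hp : p ≠ 2) : (-1 : SL(2, ZMod p)) ≠ 1 := by
  intro h
  have := congrArg (fun g : SL(2, ZMod p) => g 0 0) h
  simp only [Matrix.SpecialLinearGroup.coe_neg, Matrix.SpecialLinearGroup.coe_one,
    Matrix.neg_apply, Matrix.one_apply_eq] at this
  apply two_ne_zero_of_ne_two hp
  linear_combination -this

/-- The field is prime, so the powers of one nontrivial transvection exhaust its root group. -/
theorem unipotent_mem {H : Subgroup SL(2, ZMod p)} {x y s : ZMod p} (hs : s ≠ 0)
    (h : unipotent x y s ∈ H) (t : ZMod p) : unipotent x y t ∈ H := by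
  have := H.pow_mem h (t / s).val
  rwa [unipotent_pow, ZMod.natCast_zmod_val, div_mul_cancel₀ _ hs] at this

theorem trace_eq_two_of_pow_eq_one {g : SL(2, ZMod p)} (hg : g ^ p = 1) :
    (g : Matrix (Fin 2) (Fin 2) (ZMod p)).trace = 2 := by
  have h : IsNilpotent ((g : Matrix (Fin 2) (Fin 2) (ZMod p)) - 1) := by
    refine ⟨p, ?_⟩
    rw [sub_pow_char_of_commute _ (Commute.one_right _), ← Matrix.SpecialLinearGroup.coe_pow, hg,
      one_pow, Matrix.SpecialLinearGroup.coe_one, sub_self]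
  have h1 := (Matrix.isNilpotent_trace_of_isNilpotent h).eq_zero
  rw [Matrix.trace_sub, Matrix.trace_one, sub_eq_zero] at h1
  simpa using h1

theorem pow_eq_one_of_trace_eq_two {g : SL(2, ZMod p)}
    (hg : (g : Matrix (Fin 2) (Fin 2) (ZMod p)).trace = 2) : g ^ p = 1 := by
  obtain ⟨x, y, t, -, rfl⟩ := exists_eq_unipotent hg
  rw [unipotent_pow, CharP.cast_eq_zero, zero_mul, unipotent_zero]

theorem matX_mul_self (a b c : ZMod p) (h : a ^ 2 + b * c + 1 = 0) :
    matX a b c h * matX a b c h = -1 := by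
  apply Subtype.ext
  rw [Matrix.SpecialLinearGroup.coe_mul, Matrix.SpecialLinearGroup.coe_neg]
  ext i j
  fin_cases i <;> fin_cases j <;> simp [matX, Matrix.mul_apply, Fin.sum_univ_two]
  · linear_combination h
  · ring
  · ring
  · linear_combination h

theorem matZ_pow (d : (ZMod p)ˣ) (k : ℕ) : matZ d ^ k = matZ (d ^ k) := by
  induction k with
  | zero =>
    rw [pow_zero, pow_zero]
    apply Subtype.ext
    ext i j
    fin_cases i <;> fin_cases j <;> simp [matZ, -ZMod.inv_coe_unit]
  | succ k ih =>
    rw [pow_succ, ih]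
    apply Subtype.ext
    rw [Matrix.SpecialLinearGroup.coe_mul]
    ext i j
    fin_cases i <;> fin_cases j <;> simp [matZ, Matrix.mul_apply, Fin.sum_univ_two, pow_succ,
        -ZMod.inv_coe_unit]
    ring

theorem orderOf_matZ (d : (ZMod p)ˣ) : orderOf (matZ d) = orderOf d := by
  refine orderOf_eq_orderOf_iff.2 fun k => ?_
  rw [matZ_pow]
  constructor
  · intro h
    have := congrArg (fun g : SL(2, ZMod p) => g 0 0) h
    exact Units.ext (by simpa [matZ] using this)
  · intro h
    rw [h, ← pow_zero d, ← matZ_pow, pow_zero]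

/-- An element of order `p` is a transvection. If its fixed line is a coordinate axis, `X` moves it
because `b, c ≠ 0`; any other line is moved by `Z` because `d² ≠ 1`. -/
theorem eq_top_of_prime_dvd_card {H : Subgroup SL(2, ZMod p)} {a b c : ZMod p} {d : (ZMod p)ˣ}
    {h : a ^ 2 + b * c + 1 = 0} (hX : matX a b c h ∈ H) (hZ : matZ d ∈ H) (hb : b ≠ 0)
    (hc : c ≠ 0) (hd : d ^ 2 ≠ 1) (hdvd : p ∣ Nat.card H) : H = ⊤ := by
  obtain ⟨g, hg⟩ := exists_prime_orderOf_dvd_card' p hdvd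
  have hgp : (g : SL(2, ZMod p)) ^ p = 1 := by
    have := pow_orderOf_eq_one g
    rw [hg] at this
    exact congrArg Subtype.val this
  have htr := trace_eq_two_of_pow_eq_one hgp
  obtain ⟨x, y, s, hxy, hgs⟩ := exists_eq_unipotent htr
  have hs : s ≠ 0 := by
    rintro rfl
    rw [unipotent_zero] at hgs
    rw [show g = 1 from Subtype.ext hgs, orderOf_one] at hg
    exact (Fact.out : p.Prime).one_lt.ne hg
  have hmem : ∀ t, unipotent x y t ∈ H := unipotent_mem hs (hgs ▸ g.2)
  have hconj : ∀ A ∈ H, ∀ t, unipotent (A 0 0 * x + A 0 1 * y) (A 1 0 * x + A 1 1 * y) t ∈ H := by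
    intro A hA t
    rw [← conj_unipotent]
    exact mul_mem (mul_mem hA (hmem t)) (inv_mem hA)
  by_cases hy : y = 0
  · have hx := hxy.resolve_right (not_not.2 hy)
    refine eq_top_of_unipotent_mem hmem (hconj _ hX) ?_
    have : c * x ^ 2 ≠ 0 := mul_ne_zero hc (pow_ne_zero 2 hx)
    convert this using 1
    simp [matX, hy]
    ring
  by_cases hx : x = 0
  · refine eq_top_of_unipotent_mem hmem (hconj _ hX) ?_
    have : -b * y ^ 2 ≠ 0 := mul_ne_zero (neg_ne_zero.2 hb) (pow_ne_zero 2 hy)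
    convert this using 1
    simp [matX, hx]
    ring
  · refine eq_top_of_unipotent_mem hmem (hconj _ hZ) ?_
    have hd1 : (d : ZMod p) ^ 2 ≠ 1 := fun h => hd (Units.ext (by simpa using h))
    have : x * y * ((1 - (d : ZMod p) ^ 2) * (d : ZMod p)⁻¹) ≠ 0 :=
      mul_ne_zero (mul_ne_zero hx hy)
        (mul_ne_zero (sub_ne_zero.2 hd1.symm) (inv_ne_zero d.ne_zero))
    convert this using 1
    have := d.ne_zero
    simp [matZ, -ZMod.inv_coe_unit]
    field_simp

/-- If `p` does not divide `|H|`, no element other than `±1` has trace `±2`. The discriminant `tr² -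
4` is then a nonzero square in `𝔽_{p²}`, giving two fixed points on the projective line and
contradicting the orbit count. -/
theorem prime_dvd_card_of_mem {H : Subgroup SL(2, ZMod p)} {a b c : ZMod p} {d : (ZMod p)ˣ}
    {h : a ^ 2 + b * c + 1 = 0} (hX : matX a b c h ∈ H) (hZ : matZ d ∈ H) (ha : a ≠ 0)
    (hc : c ≠ 0) (hd : 16 ≤ orderOf d) : p ∣ Nat.card H := by
  classical
  by_contra hndvd
  have hp2 : p ≠ 2 := by
    rintro rfl
    have := orderOf_dvd_card (x := d)
    rw [ZMod.card_units] at this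
    have := Nat.le_of_dvd (by norm_num) this
    omega
  have h2 := two_ne_zero_of_ne_two hp2
  let K := GaloisField p 2
  let ι := algebraMap (ZMod p) K
  have hι : Function.Injective ι := ι.injective
  let φ : H →* GL (Fin 2) K := (Matrix.SpecialLinearGroup.mapGL K).comp H.subtype
  have hφ : ∀ (g : H) i j, φ g i j = ι (g.1 i j) := fun g i j => rfl
  let _ : MulAction H (OnePoint K) := MulAction.compHom _ φ
  have hsmul : ∀ (g : H) (x : OnePoint K), g • x = φ g • x := fun _ _ => rfl
  have hneg : (-1 : SL(2, ZMod p)) ∈ H := matX_mul_self a b c h ▸ mul_mem hX hX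
  have hne := SL2_neg_one_ne_one hp2
  have htr : ∀ g ∈ H, g ≠ 1 → (g : Matrix (Fin 2) (Fin 2) (ZMod p)).trace ≠ 2 := by
    intro g hg hg1 ht
    have := orderOf_eq_prime (pow_eq_one_of_trace_eq_two ht) hg1
    have h1 := Subgroup.orderOf_dvd_natCard H hg
    rw [this] at h1
    exact hndvd h1
  have : Finite (OnePoint K) := inferInstanceAs (Finite (Option K))
  refine not_two_fixed_points (G := H) (Ω := OnePoint K) (e := ⟨-1, hneg⟩)
    (x := OnePoint.infty) (fun h => hne (congrArg Subtype.val h)) ?_ ?_ ?_ ?_ ?_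
  · exact Subtype.ext (by simp)
  · intro x
    rw [hsmul]
    cases x with
    | infty => rw [OnePoint.smul_infty_eq_self_iff, hφ]; simp
    | coe k => rw [smul_coe_eq_iff]; simp [hφ]
  · intro g hg1 hg2
    obtain ⟨r, hr⟩ := isSquare_algebraMap_galoisField hp2
      ((g : Matrix (Fin 2) (Fin 2) (ZMod p)).trace ^ 2 - 4)
    have hdet := (g : SL(2, ZMod p)).det_coe
    rw [Matrix.det_fin_two] at hdet
    refine card_fixedBy_eq_two (r := r) ?_ (φ g) ?_ ?_
    · rw [← map_ofNat ι 2]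
      exact (map_ne_zero ι).2 h2
    · rintro rfl
      rw [mul_zero, map_eq_zero] at hr
      have h4 : ((g : Matrix (Fin 2) (Fin 2) (ZMod p)).trace - 2) *
          ((g : Matrix (Fin 2) (Fin 2) (ZMod p)).trace + 2) = 0 := by linear_combination hr
      rcases mul_eq_zero.1 h4 with h5 | h5
      · exact htr g g.2 (fun h => hg1 (Subtype.ext h)) (sub_eq_zero.1 h5)
      · refine htr (-g) ?_ (fun h => hg2 (Subtype.ext (neg_eq_iff_eq_neg.1 h))) ?_
        · rw [← neg_one_mul]
          exact mul_mem hneg g.2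
        · rw [Matrix.SpecialLinearGroup.coe_neg, Matrix.trace_neg]
          linear_combination -h5
    · rw [← hr, Matrix.trace_fin_two, hφ, hφ, hφ, hφ, ← map_mul, ← map_mul, ← map_sub, hdet,
        map_one, mul_one, map_sub, map_pow, map_add, map_ofNat]
  -- The powers of `Z` fix `∞`, and `Z` has the order of `d`, at least 16.
  · have hle : Subgroup.zpowers (⟨matZ d, hZ⟩ : H) ≤
        MulAction.stabilizer H (OnePoint.infty : OnePoint K) := by
      rw [Subgroup.zpowers_le, MulAction.mem_stabilizer_iff, hsmul,
        OnePoint.smul_infty_eq_self_iff, hφ]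
      simp [matZ, -ZMod.inv_coe_unit]
    have h3 := Subgroup.card_le_of_le hle
    rw [Nat.card_zpowers, ← Subgroup.orderOf_coe, orderOf_matZ] at h3
    exact hd.trans h3
  · have hd2 : (d : ZMod p) ^ 2 ≠ 1 := by
      intro h
      have : d ^ 2 = 1 := Units.ext (by simpa using h)
      have := Nat.le_of_dvd two_pos (orderOf_dvd_of_pow_eq_one this)
      omega
    have hX1 : (⟨_, hX⟩ : H) • (OnePoint.infty : OnePoint K) = ((ι (a / c) : K) : OnePoint K) := by
      rw [hsmul, OnePoint.smul_infty_eq_ite, hφ, hφ, map_div₀]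
      simp [matX, hc]
    have hZ1 : (⟨_, hZ⟩ : H) • ((ι (a / c) : K) : OnePoint K) =
        ((ι (d ^ 2 * (a / c)) : K) : OnePoint K) := by
      rw [hsmul, OnePoint.smul_some_eq_ite, hφ, hφ, hφ, hφ]
      have hd0 : ι d ≠ 0 := (map_ne_zero ι).2 d.ne_zero
      simp [matZ, ι, -ZMod.inv_coe_unit]
      ring
    -- The points `∞`, `X ∞ = a/c` and `Z X ∞ = d² a/c` are distinct.
    have hsub : ({OnePoint.infty, ((ι (a / c) : K) : OnePoint K),
        ((ι (d ^ 2 * (a / c)) : K) : OnePoint K)} : Set (OnePoint K)) ⊆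
        MulAction.orbit H (OnePoint.infty : OnePoint K) := by
      rintro x (rfl | rfl | rfl)
      · exact MulAction.mem_orbit_self _
      · exact ⟨_, hX1⟩
      · exact ⟨⟨_, hZ⟩ * ⟨_, hX⟩, by rw [← hZ1, ← hX1, ← mul_smul]⟩
    have h3 := Set.ncard_le_ncard hsub (Set.toFinite _)
    rw [Set.ncard_insert_of_notMem (by simp), Set.ncard_pair] at h3
    · exact h3
    · rw [Ne, OnePoint.coe_eq_coe]
      intro h
      have h4 := hι h
      have hac : a / c ≠ 0 := div_ne_zero ha hc
      exact hd2 ((mul_eq_right₀ hac).1 h4.symm)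

theorem closure_matX_matZ_eq_top {a b c : ZMod p} {d : (ZMod p)ˣ} (h : a ^ 2 + b * c + 1 = 0)
    (ha : a ≠ 0) (hb : b ≠ 0) (hc : c ≠ 0) (hd : 16 ≤ orderOf d) :
    Subgroup.closure {matX a b c h, matZ d} = ⊤ := by
  have hX : matX a b c h ∈ Subgroup.closure {matX a b c h, matZ d} :=
    Subgroup.subset_closure (by simp)
  have hZ : matZ d ∈ Subgroup.closure {matX a b c h, matZ d} := Subgroup.subset_closure (by simp)
  refine eq_top_of_prime_dvd_card hX hZ hb hc (fun h2 => ?_)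
    (prime_dvd_card_of_mem hX hZ ha hc hd)
  have := Nat.le_of_dvd two_pos (orderOf_dvd_of_pow_eq_one h2)
  omega

end Generation

/-! ### The generating triple of `L₂(p)` -/

section L2

variable {p : ℕ}

theorem toL2_mul (A B : SL(2, ZMod p)) : toL2 (A * B) = toL2 A * toL2 B := rfl

theorem toL2_pow (A : SL(2, ZMod p)) (k : ℕ) : toL2 (A ^ k) = toL2 A ^ k := rfl

variable [Fact p.Prime]

theorem SL2_mem_center_iff {A : SL(2, ZMod p)} :
    A ∈ Subgroup.center SL(2, ZMod p) ↔ A = 1 ∨ A = -1 := by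
  rw [Matrix.SpecialLinearGroup.mem_center_iff]
  constructor
  · rintro ⟨r, hr, hA⟩
    rw [Fintype.card_fin, sq, mul_self_eq_one_iff] at hr
    refine hr.imp (fun h => ?_) fun h => ?_
    · exact Subtype.ext (by rw [← hA, h, map_one, Matrix.SpecialLinearGroup.coe_one])
    · exact Subtype.ext (by
        rw [← hA, h, map_neg, map_one, Matrix.SpecialLinearGroup.coe_neg,
          Matrix.SpecialLinearGroup.coe_one])
  · rintro (rfl | rfl)
    · exact ⟨1, one_pow _, by simp⟩
    · exact ⟨-1, by simp, by
        rw [map_neg, map_one, Matrix.SpecialLinearGroup.coe_neg,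
          Matrix.SpecialLinearGroup.coe_one]⟩

theorem toL2_eq_one_iff {A : SL(2, ZMod p)} : toL2 A = 1 ↔ A = 1 ∨ A = -1 :=
  (QuotientGroup.eq_one_iff A).trans SL2_mem_center_iff

theorem card_center_SL2 (hp : p ≠ 2) : Nat.card (Subgroup.center SL(2, ZMod p)) = 2 := by
  have : (Subgroup.center SL(2, ZMod p) : Set SL(2, ZMod p)) = {1, -1} :=
    Set.ext fun A => SL2_mem_center_iff
  have h2 := Set.ncard_pair (SL2_neg_one_ne_one hp).symm
  rw [← this] at h2
  exact h2

theorem card_SL2 : Nat.card SL(2, ZMod p) = p * (p ^ 2 - 1) := by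
  have hp1 : 1 < p := (Fact.out : p.Prime).one_lt
  have h1 := Subgroup.card_mul_index
    (Matrix.GeneralLinearGroup.det : GL (Fin 2) (ZMod p) →* (ZMod p)ˣ).ker
  have h2 : (Matrix.GeneralLinearGroup.det : GL (Fin 2) (ZMod p) →* (ZMod p)ˣ).ker =
      (Matrix.SpecialLinearGroup.toGL : SL(2, ZMod p) →* GL (Fin 2) (ZMod p)).range := by
    ext g
    rw [MonoidHom.mem_ker]
    constructor
    · intro hg
      exact ⟨⟨g, congrArg Units.val hg⟩, Units.ext rfl⟩
    · rintro ⟨A, rfl⟩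
      exact Units.ext A.2
  rw [Subgroup.index_ker, MonoidHom.range_eq_top.2 Matrix.GeneralLinearGroup.det_surjective,
    Subgroup.card_top, Matrix.card_GL_field, h2, Nat.card_units, Nat.card_zmod,
    ← Nat.card_congr
      (MonoidHom.ofInjective Matrix.SpecialLinearGroup.toGL_injective).toEquiv,
    Fin.prod_univ_two, ZMod.card, Fin.val_zero, Fin.val_one, pow_zero, pow_one] at h1
  have h3 : p ^ 2 - p = p * (p - 1) := by rw [sq, Nat.mul_sub, mul_one]
  rw [h3, ← mul_assoc, mul_comm _ p] at h1
  exact Nat.eq_of_mul_eq_mul_right (by omega) h1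

theorem two_mul_card_L2 (hp : p ≠ 2) : 2 * Nat.card (L2 p) = p * (p ^ 2 - 1) := by
  rw [← card_SL2, Subgroup.card_eq_card_quotient_mul_card_subgroup
    (Subgroup.center SL(2, ZMod p)), card_center_SL2 hp, mul_comm]

theorem commutator_L2 {d : (ZMod p)ˣ} (hd : d ^ 2 ≠ 1) : commutator (L2 p) = ⊤ := by
  have h : commutator SL(2, ZMod p) = ⊤ :=
    Matrix.SL2.commutator_eq_top d.ne_zero fun h => hd (Units.ext (by simpa using h))
  have h1 := congrArg (Subgroup.map (QuotientGroup.mk' (Subgroup.center SL(2, ZMod p)))) h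
  rwa [commutator_def, Subgroup.map_commutator, ← MonoidHom.range_eq_map,
    MonoidHom.range_eq_top.2 (QuotientGroup.mk'_surjective _), ← commutator_def] at h1

theorem matY_mul_matZ (a b c : ZMod p) (d : (ZMod p)ˣ) (h : a ^ 2 + b * c + 1 = 0) :
    matY a b c d h * matZ d = matX a b c h := by
  apply Subtype.ext
  rw [Matrix.SpecialLinearGroup.coe_mul]
  have := d.ne_zero
  ext i j
  fin_cases i <;> fin_cases j <;>
    simp [matX, matY, matZ, Matrix.mul_apply, Fin.sum_univ_two, -ZMod.inv_coe_unit]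

theorem toL2_mul_mul_eq_one (a b c : ZMod p) (d : (ZMod p)ˣ) (h : a ^ 2 + b * c + 1 = 0) :
    toL2 (matX a b c h) * toL2 (matY a b c d h) * toL2 (matZ d) = 1 := by
  rw [← toL2_mul, ← toL2_mul, mul_assoc, matY_mul_matZ, matX_mul_self, toL2_eq_one_iff]
  exact Or.inr rfl

theorem orderOf_toL2_matX {a b c : ZMod p} (h : a ^ 2 + b * c + 1 = 0) (hb : b ≠ 0) :
    orderOf (toL2 (matX a b c h)) = 2 := by
  apply orderOf_eq_prime
  · rw [← toL2_pow, sq, matX_mul_self, toL2_eq_one_iff]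
    exact Or.inr rfl
  · rw [Ne, toL2_eq_one_iff]
    have h1 : ∀ A : SL(2, ZMod p), A = 1 ∨ A = -1 → A 0 1 = 0 := by
      rintro A (rfl | rfl) <;> simp
    exact fun h2 => hb (h1 _ h2)

theorem toL2_matZ_eq_one_iff (d : (ZMod p)ˣ) : toL2 (matZ d) = 1 ↔ d ^ 2 = 1 := by
  have hsq : d ^ 2 = 1 ↔ (d : ZMod p) = 1 ∨ (d : ZMod p) = -1 := by
    rw [← mul_self_eq_one_iff, ← Units.val_inj, sq, Units.val_mul, Units.val_one]
  rw [toL2_eq_one_iff, hsq]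
  constructor
  · rintro (h | h)
    · left
      simpa [matZ, -ZMod.inv_coe_unit] using congrArg (fun g : SL(2, ZMod p) => g 0 0) h
    · right
      simpa [matZ, -ZMod.inv_coe_unit] using congrArg (fun g : SL(2, ZMod p) => g 0 0) h
  · rintro (h | h)
    · have : d = 1 := Units.ext h
      rw [this, ← pow_zero (1 : (ZMod p)ˣ), ← matZ_pow, pow_zero]
      exact Or.inl rfl
    · have : d = -1 := Units.ext h
      refine Or.inr (Subtype.ext ?_)
      rw [this, Matrix.SpecialLinearGroup.coe_neg]
      ext i j
      fin_cases i <;> fin_cases j <;> simp [matZ]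

theorem orderOf_toL2_matZ {n : ℕ} {d : (ZMod p)ˣ} (hd : orderOf d = 2 * n) :
    orderOf (toL2 (matZ d)) = n := by
  refine Nat.dvd_right_iff_eq.1 fun k => ?_
  rw [orderOf_dvd_iff_pow_eq_one, ← toL2_pow, matZ_pow, toL2_matZ_eq_one_iff, ← pow_mul,
    ← orderOf_dvd_iff_pow_eq_one, hd, mul_comm k, Nat.mul_dvd_mul_iff_left two_pos]

theorem SL2_sq (A : SL(2, ZMod p)) : (A : Matrix (Fin 2) (Fin 2) (ZMod p)) * A =
    (A : Matrix (Fin 2) (Fin 2) (ZMod p)).trace • (A : Matrix (Fin 2) (Fin 2) (ZMod p)) - 1 := by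
  have hdet := A.det_coe
  rw [Matrix.det_fin_two] at hdet
  rw [Matrix.trace_fin_two]
  generalize (A : Matrix (Fin 2) (Fin 2) (ZMod p)) = B at *
  ext i j
  fin_cases i <;> fin_cases j <;> simp [Matrix.mul_apply, Fin.sum_univ_two]
  · linear_combination -hdet
  · ring
  · ring
  · linear_combination -hdet

/-- Cayley–Hamilton solved as a linear recurrence with roots `e`, `f`, scaled by `e - f` to avoid
division. -/
theorem SL2_pow_succ {A : SL(2, ZMod p)} {e f : ZMod p} (hef : e * f = 1)
    (hA : (A : Matrix (Fin 2) (Fin 2) (ZMod p)).trace = e + f) (k : ℕ) :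
    (e - f) • (A : Matrix (Fin 2) (Fin 2) (ZMod p)) ^ (k + 1) =
      (e ^ (k + 1) - f ^ (k + 1)) • (A : Matrix (Fin 2) (Fin 2) (ZMod p)) -
        (e ^ k - f ^ k) • (1 : Matrix (Fin 2) (Fin 2) (ZMod p)) := by
  induction k with
  | zero => simp
  | succ k ih =>
    rw [pow_succ _ (k + 1), ← Matrix.smul_mul, ih, Matrix.sub_mul, Matrix.smul_mul, SL2_sq, hA,
      Matrix.smul_mul, one_mul, smul_sub, smul_smul]
    have h1 : e ^ (k + 1 + 1) - f ^ (k + 1 + 1) =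
        (e ^ (k + 1) - f ^ (k + 1)) * (e + f) - (e ^ k - f ^ k) := by
      linear_combination (f ^ k - e ^ k) * hef
    rw [h1]
    module

/-- A nonzero off-diagonal entry makes `A ^ k` scalar exactly when the coefficient of `A` in its
expansion vanishes. -/
theorem SL2_pow_mem_center_iff {A : SL(2, ZMod p)} {e f : ZMod p} (hef : e * f = 1)
    (hA : (A : Matrix (Fin 2) (Fin 2) (ZMod p)).trace = e + f) (hne : e ≠ f) (h01 : A 0 1 ≠ 0)
    (k : ℕ) : A ^ k ∈ Subgroup.center SL(2, ZMod p) ↔ e ^ k = f ^ k := by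
  cases k with
  | zero => simp
  | succ k =>
    have h1 := SL2_pow_succ hef hA k
    have hne' : e - f ≠ 0 := sub_ne_zero.2 hne
    constructor
    · intro h
      rw [SL2_mem_center_iff] at h
      have h2 : (A ^ (k + 1)) 0 1 = 0 := by rcases h with h | h <;> rw [h] <;> simp
      have h3 := congrFun (congrFun h1 0) 1
      rw [← Matrix.SpecialLinearGroup.coe_pow] at h3
      rw [Matrix.smul_apply, Matrix.sub_apply, Matrix.smul_apply, Matrix.smul_apply, h2] at h3
      rw [Matrix.one_apply_ne zero_ne_one, smul_zero, smul_zero, sub_zero, smul_eq_mul,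
        zero_eq_mul] at h3
      exact sub_eq_zero.1 (h3.resolve_right h01)
    · intro h
      rw [Matrix.SpecialLinearGroup.mem_center_iff]
      rw [h, sub_self, zero_smul, zero_sub] at h1
      have h2 : Matrix.scalar (Fin 2) (-((e - f)⁻¹ * (e ^ k - f ^ k))) =
          ((A ^ (k + 1) : SL(2, ZMod p)) : Matrix (Fin 2) (Fin 2) (ZMod p)) := by
        rw [Matrix.SpecialLinearGroup.coe_pow, eq_comm, ← inv_smul_smul₀ hne'
          ((A : Matrix (Fin 2) (Fin 2) (ZMod p)) ^ (k + 1)), h1, smul_neg, smul_smul,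
          Matrix.scalar_apply, ← neg_smul, Matrix.smul_one_eq_diagonal]
      refine ⟨_, ?_, h2⟩
      have h3 := (A ^ (k + 1)).det_coe
      rwa [← h2, Matrix.scalar_apply, Matrix.det_diagonal, Finset.prod_const] at h3

/-- The prescribed `a` gives `tr Y = d² + d⁻²`, so `Y ^ k` is central exactly when `d ^ (4k) = 1`.
-/
theorem orderOf_toL2_matY {n : ℕ} {a b c : ZMod p} {d : (ZMod p)ˣ} (h : a ^ 2 + b * c + 1 = 0)
    (hb : b ≠ 0) (hd : orderOf d = 8 * n) (hd4 : d ^ 4 ≠ 1)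
    (ha : a * ((d : ZMod p) - (d : ZMod p) ^ 3) = (d : ZMod p) ^ 4 + 1) :
    orderOf (toL2 (matY a b c d h)) = 2 * n := by
  refine Nat.dvd_right_iff_eq.1 fun k => ?_
  have hd0 := d.ne_zero
  have hid : (d : ZMod p) * ((d⁻¹ : (ZMod p)ˣ) : ZMod p) = 1 := d.mul_inv
  rw [orderOf_dvd_iff_pow_eq_one, ← toL2_pow, toL2, QuotientGroup.eq_one_iff,
    SL2_pow_mem_center_iff (e := ((d ^ 2 : (ZMod p)ˣ) : ZMod p))
      (f := (((d ^ 2)⁻¹ : (ZMod p)ˣ) : ZMod p)) (Units.mul_inv _)]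
  · rw [← Units.val_pow_eq_pow_val, ← Units.val_pow_eq_pow_val, Units.val_inj, inv_pow,
      eq_inv_iff_mul_eq_one, ← mul_pow, ← pow_add, ← pow_mul, ← orderOf_dvd_iff_pow_eq_one, hd]
    rw [show 8 * n = (2 + 2) * (2 * n) by ring, Nat.mul_dvd_mul_iff_left (by norm_num)]
  · have hi : (((d ^ 2)⁻¹ : (ZMod p)ˣ) : ZMod p) = ((d⁻¹ : (ZMod p)ˣ) : ZMod p) ^ 2 := by
      rw [← inv_pow, Units.val_pow_eq_pow_val]
    rw [Matrix.trace_fin_two, hi, Units.val_pow_eq_pow_val]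
    change a * ((d⁻¹ : (ZMod p)ˣ) : ZMod p) + -(a * d) = _
    generalize ((d⁻¹ : (ZMod p)ˣ) : ZMod p) = i at *
    have : a * ((d : ZMod p) - (d : ZMod p) ^ 3) * i ^ 2 = ((d : ZMod p) ^ 4 + 1) * i ^ 2 := by
      rw [ha]
    linear_combination this + (-a * i + a * d * (d * i + 1) +
      (d : ZMod p) ^ 2 * (d * i + 1)) * hid
  · intro h1
    apply hd4
    have := Units.ext h1
    rwa [eq_inv_iff_mul_eq_one, ← pow_add] at this
  · change b * d ≠ 0
    exact mul_ne_zero hb hd0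

theorem closure_toL2_eq_top {a b c : ZMod p} {d : (ZMod p)ˣ} (h : a ^ 2 + b * c + 1 = 0)
    (ha : a ≠ 0) (hb : b ≠ 0) (hc : c ≠ 0) (hd : 16 ≤ orderOf d) :
    Subgroup.closure {toL2 (matX a b c h), toL2 (matZ d)} = ⊤ := by
  have h1 := congrArg (Subgroup.map (QuotientGroup.mk' (Subgroup.center SL(2, ZMod p))))
    (closure_matX_matZ_eq_top h ha hb hc hd)
  rwa [MonoidHom.map_closure, Set.image_pair, ← MonoidHom.range_eq_map,
    MonoidHom.range_eq_top.2 (QuotientGroup.mk'_surjective _)] at h1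

theorem exists_orderOf_eq {m : ℕ} (h : p ≡ 1 [MOD m]) : ∃ d : (ZMod p)ˣ, orderOf d = m := by
  have hp1 := (Fact.out : p.Prime).one_lt
  obtain ⟨j, hj⟩ := (Nat.modEq_iff_dvd' hp1.le).1 h.symm
  obtain ⟨g, hg⟩ := IsCyclic.exists_ofOrder_eq_natCard (α := (ZMod p)ˣ)
  rw [Nat.card_units, Nat.card_zmod, hj] at hg
  have hj0 : j ≠ 0 := by
    rintro rfl
    omega
  refine ⟨g ^ j, ?_⟩
  rw [orderOf_pow_of_dvd hj0 (hg ▸ dvd_mul_left _ _), hg, Nat.mul_div_cancel _ (by omega)]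

/-- If `bc = 0` then `a² = -1`, and clearing denominators gives `(d² + 1)(d⁶ + 1) = 0`, so `d⁴ = 1`
or `d¹² = 1`. If `a = 0` then `d⁸ = 1`. All are excluded because `d` has order `8n ≥ 16`. -/
theorem parameters_ne_zero {n : ℕ} (hn : 2 ≤ n) {a b c : ZMod p} {d : (ZMod p)ˣ}
    (h : a ^ 2 + b * c + 1 = 0) (hd : orderOf d = 8 * n)
    (ha : a = ((d : ZMod p) ^ 4 + 1) / ((d : ZMod p) - (d : ZMod p) ^ 3)) :
    a * ((d : ZMod p) - (d : ZMod p) ^ 3) = (d : ZMod p) ^ 4 + 1 ∧ a ≠ 0 ∧ b ≠ 0 ∧ c ≠ 0 := by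
  have hpow : ∀ k, 0 < k → k < 16 → (d : ZMod p) ^ k ≠ 1 := by
    intro k hk hk' h1
    have h2 : d ^ k = 1 := Units.ext (by simpa using h1)
    have := Nat.le_of_dvd hk (orderOf_dvd_of_pow_eq_one h2)
    omega
  have hd0 : (d : ZMod p) ≠ 0 := d.ne_zero
  generalize (d : ZMod p) = e at *
  have hden : e - e ^ 3 ≠ 0 := by
    intro h1
    have : e * (1 - e ^ 2) = 0 := by linear_combination h1
    rcases mul_eq_zero.1 this with h2 | h2
    · exact hd0 h2
    · exact hpow 2 (by norm_num) (by norm_num) (sub_eq_zero.1 h2).symm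
  have ha' : a * (e - e ^ 3) = e ^ 4 + 1 := by rw [ha, div_mul_cancel₀ _ hden]
  have hbc : b * c ≠ 0 := by
    intro h0
    have h1 : (e ^ 2 + 1) * (e ^ 6 + 1) = 0 := by
      linear_combination (e - e ^ 3) ^ 2 * (h - h0) - (a * (e - e ^ 3) + e ^ 4 + 1) * ha'
    rcases mul_eq_zero.1 h1 with h2 | h2
    · exact hpow 4 (by norm_num) (by norm_num) (by linear_combination (e ^ 2 - 1) * h2)
    · exact hpow 12 (by norm_num) (by norm_num) (by linear_combination (e ^ 6 - 1) * h2)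
  refine ⟨ha', ?_, left_ne_zero_of_mul hbc, right_ne_zero_of_mul hbc⟩
  rintro rfl
  exact hpow 8 (by norm_num) (by norm_num) (by linear_combination (1 - e ^ 4) * ha')

end L2

end

/-! ### Assembly of the main theorem -/

theorem mainTheorem9 (n : ℕ) (hn : 2 ≤ n) :
    {p : ℕ | p.Prime ∧ p ≡ 1 [MOD 8 * n]}.Infinite ∧
    (∃ u v w : Equiv.Perm ℍ, IsCanonicalTriple 2 (2 * n) (4 * n) u v w) ∧
    ∀ (p : ℕ) [Fact p.Prime], p ≡ 1 [MOD 8 * n] →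
      (∃ (a b c : ZMod p) (d : (ZMod p)ˣ), a ^ 2 + b * c + 1 = 0 ∧ orderOf d = 8 * n ∧
        a = ((d : ZMod p) ^ 4 + 1) / ((d : ZMod p) - (d : ZMod p) ^ 3)) ∧
      ∀ (a b c : ZMod p) (d : (ZMod p)ˣ) (habc : a ^ 2 + b * c + 1 = 0),
        orderOf d = 8 * n →
        a = ((d : ZMod p) ^ 4 + 1) / ((d : ZMod p) - (d : ZMod p) ^ 3) →
        -- the generating triple of `L₂(p)`
        (orderOf (toL2 (matX a b c habc)) = 2 ∧
          orderOf (toL2 (matY a b c d habc)) = 2 * n ∧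
          orderOf (toL2 (matZ d)) = 4 * n ∧
          toL2 (matX a b c habc) * toL2 (matY a b c d habc) * toL2 (matZ d) = 1 ∧
          Subgroup.closure {toL2 (matX a b c habc), toL2 (matZ d)} = ⊤) ∧
        -- `Δ* = Δ(2, 2n, 4n)`, with canonical generators `u, v, w`
        ∀ u v w : Equiv.Perm ℍ, IsCanonicalTriple 2 (2 * n) (4 * n) u v w →
          ∀ D D₀ D₁ D₂ : Subgroup (Equiv.Perm ℍ),
            D = triangleGroup u v w →
            D₀ = indexTwoSubgroup D u v w →
            D₁ = indexTwoSubgroup D v w u →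
            D₂ = indexTwoSubgroup D w u v →
            (D₀.relIndex D = 2 ∧ D₁.relIndex D = 2 ∧ D₂.relIndex D = 2) ∧
            ∃ M L K : Subgroup (Equiv.Perm ℍ),
              -- `L₂(p)` is the smooth quotient `Δ* / M`, with `u, v, w` sent to `x, y, z`
              (IsTorsionFreeSubgroup M ∧
                ∃ f : D →* L2 p, Function.Surjective f ∧ f.ker.map D.subtype = M ∧
                  (∀ g : D, (g : Equiv.Perm ℍ) = u → f g = toL2 (matX a b c habc)) ∧
                  (∀ g : D, (g : Equiv.Perm ℍ) = v → f g = toL2 (matY a b c d habc)) ∧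
                  (∀ g : D, (g : Equiv.Perm ℍ) = w → f g = toL2 (matZ d))) ∧
              -- `G = L₂(p) × C₂` has a unique subgroup of index 2 and is the smooth quotient
              -- `Δ* / L` of `Δ*`, with `L ≤ Δ₀`
              (L = D₀ ⊓ M ∧ Finite (L2C2 p) ∧ (∃! N : Subgroup (L2C2 p), N.index = 2) ∧
                IsSmoothQuotient D L (L2C2 p)) ∧
              -- `G` is a smooth quotient `Δᵢ / K` of `Δᵢ` for `i = 1, 2`
              (K = D₁ ⊓ D₂ ⊓ M ∧ K = D₁ ⊓ L ∧ K = D₂ ⊓ L ∧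
                IsSmoothQuotient D₁ K (L2C2 p) ∧ IsSmoothQuotient D₂ K (L2C2 p)) ∧
              -- the two regular dessins on the Riemann surface `ℍ / K`
              IsSurfaceGroup K ∧
              ∃ H₁ H₂ : Hypermap,
                (H₁.IsRegular ∧ H₁.IsDessinOn (2 * n) (2 * n) (2 * n) D₁ K ∧
                  Nonempty (H₁.aut ≃* L2C2 p)) ∧
                (H₂.IsRegular ∧ H₂.IsDessinOn n (4 * n) (4 * n) D₂ K ∧
                  Nonempty (H₂.aut ≃* L2C2 p)) ∧
                (H₁.genus = 1 + (2 * n - 3) / (4 * n) * (p * (p ^ 2 - 1)) ∧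
                  H₂.genus = 1 + (2 * n - 3) / (4 * n) * (p * (p ^ 2 - 1))) ∧
                (n = 2 → p = 17 → H₁.genus = 613 ∧ H₂.genus = 613) := by
  refine ⟨Nat.infinite_setOfPred_prime_modEq_one (by omega), ?_, fun p _ hp => ⟨?_, ?_⟩⟩
  · obtain ⟨T⟩ := exists_rotationTriangle hn
    exact ⟨T.u, T.v, T.w, T.isCanonicalTriple⟩
  · obtain ⟨d, hd⟩ := exists_orderOf_eq hp
    obtain ⟨a, ha⟩ : ∃ a, a = ((d : ZMod p) ^ 4 + 1) / ((d : ZMod p) - (d : ZMod p) ^ 3) :=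
      ⟨_, rfl⟩
    exact ⟨a, 1, -(a ^ 2 + 1), d, by ring, hd, ha⟩
  intro a b c d habc hd ha
  obtain ⟨ha', ha0, hb0, hc0⟩ := parameters_ne_zero hn habc hd ha
  have hpow : ∀ k, 0 < k → k < 16 → d ^ k ≠ 1 := fun k hk hk' h1 => by
    have := Nat.le_of_dvd hk (orderOf_dvd_of_pow_eq_one h1)
    omega
  have hp2 : p ≠ 2 := by
    rintro rfl
    exact hpow 1 (by norm_num) (by norm_num) (Subsingleton.elim _ _)
  have hx := orderOf_toL2_matX habc hb0
  have hy := orderOf_toL2_matY habc hb0 hd (hpow 4 (by norm_num) (by norm_num)) ha'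
  have hz : orderOf (toL2 (matZ d)) = 4 * n := orderOf_toL2_matZ (by rw [hd]; ring)
  have hxyz := toL2_mul_mul_eq_one a b c d habc
  have hgen := closure_toL2_eq_top habc ha0 hb0 hc0 (by omega : 16 ≤ orderOf d)
  refine ⟨⟨hx, hy, hz, hxyz, hgen⟩, ?_⟩
  rintro u v w huvw D D₀ D₁ D₂ rfl h₀ h₁ h₂
  obtain ⟨T, rfl, rfl, rfl⟩ := huvw.exists_rotationTriangle hn
  have hperf : commutator (L2 p) = ⊤ := commutator_L2 (hpow 2 (by norm_num) (by norm_num))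
  have hcard : (2 * Nat.card (L2 p) : ℚ) = p * (p ^ 2 - 1) := by
    have h1 : 1 ≤ p ^ 2 := Nat.one_le_pow _ _ (Fact.out : p.Prime).pos
    have := congrArg (Nat.cast (R := ℚ)) (two_mul_card_L2 hp2)
    push_cast [Nat.cast_sub h1] at this
    exact this
  obtain ⟨hrel, M, L, K, hM, ⟨hL, hLq⟩, hK, hsurf, H₁, H₂, hH₁, hH₂, hg₁, hg₂⟩ :=
    T.exists_dessins hn hperf hxyz hx hy hz hgen h₀ h₁ h₂
  rw [hcard] at hg₁ hg₂
  refine ⟨hrel, M, L, K, hM, ⟨hL, inferInstance, existsUnique_index_eq_two hperf (by simp), hLq⟩,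
    hK, hsurf, H₁, H₂, hH₁, hH₂, ⟨hg₁, hg₂⟩, ?_⟩
  rintro rfl rfl
  rw [hg₁, hg₂]
  norm_num
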